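/- Let $S$ be a cancellative monoid that is reversible, i.e. $sS\cap tS\neq\emptyset$ and $Ss\cap St\neq\emptyset$ for all $s,t\in S$, and let $\mathscr S=S^{-1}S$ be its group of quotients. Let $A$ be a torsion-free abelian group of finite rank and $\sigma\colon S\to\mathrm{End}_{\mathbb Z}(A)$ an injective monoid homomorphism such that every $\sigma_s$ is injective. Let $\mathcal C$ be the family of subgroups $\sigma_{s_1}^{-1}\sigma_{t_1}\cdots\sigma_{s_m}^{-1}\sigma_{t_m}A$ of $A$ ($m\ge 1$, $s_i,t_i\in S$), where $\sigma_s^{-1}$ denotes preimage, and assume that the action is exact: $\bigcap_{C\in\mathcal C}C=\{0\}$. Put $\overline A=\varprojlim_{C\in\mathcal C}A/C$ with the inverse limit topology (each $A/C$ discrete), to which each $\sigma_s$ extends continuously. Let $\mathscr A=\varinjlim_{s\in S}\{A;\sigma_s\}$ and $\overline{\mathscr A}=\varinjlim_{s\in S}\{\overline A;\sigma_s\}$ be the inductive limits in which the copy at $s$ is mapped by $\sigma_r$ to the copy at $rs$; $\overline{\mathscr A}$ carries the inductive limit topology. Identify $A$, $\overline A$ with the copies at $s=1$. The group $\mathscr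 S$ acts on $\mathscr A$ and $\overline{\mathscr A}$ by automorphisms $\tilde\sigma_g$ extending $\sigma$, and $\mathscr A$ acts on $\overline{\mathscr A}$ by translation. Let $\mathbb Z\overline{\mathscr A}=C_c(\overline{\mathscr A},\mathbb Z)$ be the $\mathscr A$-module of compactly supported continuous $\mathbb Z$-valued functions, with $(a\cdot f)(x)=f(x-a)$, and let $\theta\colon\mathscr S\curvearrowright \mathrm H_q(\mathscr A,\mathbb Z\overline{\mathscr A})$ be the action on group homology induced by the pairs $(\tilde\sigma_g,\ f\mapsto f\circ\tilde\sigma_g^{-1})$, $g\in\mathscr S$. Let $\mathbb Z[\mathbb I^{-1}]\subseteq\mathbb Q$ be the subring generated by all $1/k$, where $k$ divides an index $[A:C]$ with $C\in\mathcal C$. Then the indicator function $1_{\overline A}$ belongs to $\mathbb Z\overline{\mathscr A}$, and for every $q\ge 0$ the following hold. (i) There is an injective homomorphism $$j\colon{\textstyle\bigwedge}^qA\to \mathrm H_q(\mathscr A,\mathbb Z\overline{\mathscr A}),$$ which sends $a_1\wedge\dots\wedge a_q$ to the class of the bar cycle $\sum_{\pi\in\mathfrak S_q}\mathrm{sgn}(\pi)\,1_{\overline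 A}\otimes[a_{\pi(1)}|\cdots|a_{\pi(q)}]$; that is, $j$ is the canonical (Pontryagin product) map ${\textstyle\bigwedge}^qA\to \mathrm H_q(A,\mathbb Z)$ followed by the map induced by $A\hookrightarrow\mathscr A$ and $1\mapsto 1_{\overline A}$. (ii) There is an injective homomorphism $k\colon \mathrm H_q(\mathscr A,\mathbb Z\overline{\mathscr A})\to({\textstyle\bigwedge}^qA)\otimes\mathbb Z[\mathbb I^{-1}]$ with $k(j(x))=x\otimes 1$ for all $x\in{\textstyle\bigwedge}^qA$. Thus $\mathrm H_q(\mathscr A,\mathbb Z\overline{\mathscr A})$ is identified with an intermediate group $${\textstyle\bigwedge}^qA\le \mathrm H_q(\mathscr A,\mathbb Z\overline{\mathscr A})\le({\textstyle\bigwedge}^qA)\otimes\mathbb Z[\mathbb I^{-1}].$$ (iii) The $\mathbb Z[\mathbb I^{-1}]$-linear extension of $k$ is an isomorphism $$\mathrm H_q(\mathscr A,\mathbb Z\overline{\mathscr A})\otimes\mathbb Z[\mathbb I^{-1}]\cong({\textstyle\bigwedge}^qA)\otimes\mathbb Z[\mathbb I^{-1}],$$ and under this identification, for every $s\in S$, $$\theta_s\otimes\mathrm{id}_{\mathbb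 Z[\mathbb I^{-1}]}={\textstyle\bigwedge}^q(\sigma_s)\otimes\frac1{[A:\sigma_sA]}.$$ -/

import Mathlib

open scoped TensorProduct CompactlySupported

namespace AlgebraicAction

section Quotients

/-- A monoid is reversible if any two principal right ideals meet (left reversibility) and any two
principal left ideals meet (right reversibility). -/
class IsReversible (S : Type) [Monoid S] : Prop where
  left : ∀ s t : S, ∃ x y : S, s * x = t * y
  right : ∀ s t : S, ∃ x y : S, x * s = y * t

variable (S : Type) [Monoid S] [IsCancelMul S] [IsReversible S]

/-- A cancellative right reversible monoid satisfies the Ore condition for left fractions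
`s⁻¹ t`. -/
noncomputable instance oreSetTop : OreLocalization.OreSet (⊤ : Submonoid S) where
  ore_right_cancel r₁ r₂ s h := ⟨1, by rw [mul_right_cancel h]⟩
  oreNum r s := (IsReversible.right r (s : S)).choose_spec.choose
  oreDenom r s := ⟨(IsReversible.right r (s : S)).choose, trivial⟩
  ore_eq r s := (IsReversible.right r (s : S)).choose_spec.choose_spec

/-- The group of left quotients `S⁻¹S`. -/
abbrev FractionGroup : Type := OreLocalization (⊤ : Submonoid S) S

theorem isUnit_fractionGroup (g : FractionGroup S) : IsUnit g := by
  induction g using OreLocalization.ind with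
  | _ r s =>
    let r' : (⊤ : Submonoid S) := ⟨r, trivial⟩
    exact ⟨⟨OreLocalization.oreDiv (r' : S) s, OreLocalization.oreDiv (s : S) r',
      OreLocalization.mul_inv r' s, OreLocalization.mul_inv s r'⟩, rfl⟩

noncomputable instance : Group (FractionGroup S) := groupOfIsUnit (isUnit_fractionGroup S)

/-- The inductive limit over `s ∈ S` (ordered by `s ∣ t ↔ t ∈ S s`) of copies of `X` along the maps
`x ↦ r • x` from the copy at `s` to the copy at `r s`, realised as the module of left fractions
`s⁻¹ x`: the fraction `x /ₒ s` is the image of `x` under the canonical map from the copy at `s`.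
The group of quotients `S⁻¹S` acts on it. -/
abbrev Limit (X : Type) [AddCommGroup X] [DistribMulAction S X] : Type :=
  OreLocalization (⊤ : Submonoid S) X

variable {S}
variable {X Y : Type} [AddCommGroup X] [DistribMulAction S X] [AddCommGroup Y]
  [DistribMulAction S Y]

/-- The canonical map from the copy of `X` at `s` to the limit. -/
noncomputable def toLimit (s : S) (x : X) : Limit S X :=
  OreLocalization.oreDiv x (⟨s, trivial⟩ : (⊤ : Submonoid S))

/-- Two fractions agree in the limit iff they agree in some common later copy. -/
theorem toLimit_eq_iff (s t : S) (x y : X) :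
    toLimit s x = toLimit t y ↔ ∃ u v : S, u * s = v * t ∧ u • x = v • y := by
  unfold toLimit
  rw [OreLocalization.oreDiv_eq_iff]
  constructor
  · rintro ⟨u, v, h1, h2⟩
    exact ⟨v, u, h2.symm, h1.symm⟩
  · rintro ⟨u, v, h1, h2⟩
    exact ⟨⟨v, trivial⟩, u, h2.symm, h1.symm⟩

/-- An `S`-equivariant homomorphism induces a homomorphism of inductive limits. -/
noncomputable def limitMap (f : X →+[S] Y) : Limit S X →+ Limit S Y where
  toFun := OreLocalization.liftExpand (fun x s => OreLocalization.oreDiv (f x) s) (by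
    intro x t s hst
    simp only [map_smul]
    exact OreLocalization.expand (f x) s t hst)
  map_zero' := by
    rw [OreLocalization.zero_def, OreLocalization.liftExpand_of, map_zero,
      ← OreLocalization.zero_def]
  map_add' a b := by
    induction a using OreLocalization.ind with
    | _ x s =>
      induction b using OreLocalization.ind with
      | _ y t =>
        simp only [OreLocalization.oreDiv_add_oreDiv, OreLocalization.liftExpand_of, map_add]
        congr 2
        · exact map_smul f _ _
        · exact map_smul f _ _

@[simp]
theorem limitMap_oreDiv (f : X →+[S] Y) (x : X) (s : (⊤ : Submonoid S)) :
    limitMap f (OreLocalization.oreDiv x s) = OreLocalization.oreDiv (f x) s := rfl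

theorem limitMap_smul (f : X →+[S] Y) (g : FractionGroup S) (a : Limit S X) :
    limitMap f (g • a) = g • limitMap f a := by
  induction g using OreLocalization.ind with
  | _ r t =>
    induction a using OreLocalization.ind with
    | _ x s =>
      simp only [OreLocalization.oreDiv_smul_oreDiv, limitMap_oreDiv, map_smul]

end Quotients

section Completion

variable (S A : Type) [Monoid S] [AddCommGroup A] [DistribMulAction S A]

variable {S} in
/-- The endomorphism `σ_s` of `A`. -/
abbrev endo (s : S) : A →+ A := DistribSMul.toAddMonoidHom A s

/-- The `S`-constructible subgroups `σ_{s₁}⁻¹ σ_{t₁} ⋯ σ_{sₘ}⁻¹ σ_{tₘ} A`, `m ≥ 1`. -/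
inductive IsConstructible : AddSubgroup A → Prop
  | base (s t : S) : IsConstructible (((⊤ : AddSubgroup A).map (endo A t)).comap (endo A s))
  | step (s t : S) (C : AddSubgroup A) : IsConstructible C →
      IsConstructible ((C.map (endo A t)).comap (endo A s))

/-- The family of `S`-constructible subgroups. -/
def constructible : Set (AddSubgroup A) := {C | IsConstructible S A C}

variable {S A} in
theorem constructible_comap (s : S) {C : AddSubgroup A} (hC : C ∈ constructible S A) :
    C.comap (endo A s) ∈ constructible S A := by
  have h := IsConstructible.step s (1 : S) C hC
  have h1 : C.map (endo A (1 : S)) = C := by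
    ext x
    simp [AddSubgroup.mem_map]
  rwa [h1] at h

theorem range_mem_constructible (s : S) : (endo A s).range ∈ constructible S A := by
  have h := IsConstructible.base (A := A) (1 : S) s
  have h1 : ((⊤ : AddSubgroup A).map (endo A s)).comap (endo A (1 : S)) = (endo A s).range := by
    ext x
    simp [AddSubgroup.mem_map]
  rwa [h1] at h

/-- The completion `lim_C A / C` over the `S`-constructible subgroups, as the group of compatible
families. -/
def completion : AddSubgroup (∀ C : constructible S A, A ⧸ (C : AddSubgroup A)) where
  carrier := {x | ∀ (C D : constructible S A) (h : (C : AddSubgroup A) ≤ D),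
    QuotientAddGroup.map (C : AddSubgroup A) D (AddMonoidHom.id A)
      (by rwa [AddSubgroup.comap_id]) (x C) = x D}
  zero_mem' C D h := map_zero _
  add_mem' {x y} hx hy C D h := by
    rw [Pi.add_apply, map_add, hx C D h, hy C D h, Pi.add_apply]
  neg_mem' {x} hx C D h := by
    rw [Pi.neg_apply, map_neg, hx C D h, Pi.neg_apply]

/-- The completion carries the inverse limit topology, each `A / C` being discrete. -/
instance : TopologicalSpace (completion S A) :=
  ⨅ C : constructible S A, TopologicalSpace.induced (fun x => x.1 C) ⊥

variable {S A}

theorem continuous_to_completion {Z : Type*} [TopologicalSpace Z] {f : Z → completion S A}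
    (hf : ∀ C : constructible S A, IsLocallyConstant fun z => (f z).1 C) : Continuous f := by
  refine continuous_iInf_rng.2 fun C => continuous_induced_rng.2 ?_
  let _ : TopologicalSpace (A ⧸ (C : AddSubgroup A)) := ⊥
  exact (hf C).continuous

theorem isLocallyConstant_coord (C : constructible S A) :
    IsLocallyConstant fun x : completion S A => x.1 C := by
  let _ : TopologicalSpace (A ⧸ (C : AddSubgroup A)) := ⊥
  have _ : DiscreteTopology (A ⧸ (C : AddSubgroup A)) := ⟨rfl⟩
  rw [IsLocallyConstant.iff_continuous]
  exact continuous_iInf_dom continuous_induced_dom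

theorem completion_continuous_add_left (b : completion S A) :
    Continuous fun x : completion S A => b + x :=
  continuous_to_completion fun C => (isLocallyConstant_coord C).comp fun y => b.1 C + y

/-- The subgroup `σ_s⁻¹ C` as a constructible subgroup. -/
def pullback (s : S) (C : constructible S A) : constructible S A :=
  ⟨(C : AddSubgroup A).comap (endo A s), constructible_comap s C.2⟩

/-- The map `A / σ_s⁻¹ C → A / C` induced by `σ_s`. -/
def quotientEndo (s : S) (C : constructible S A) :
    A ⧸ (pullback s C : AddSubgroup A) →+ A ⧸ (C : AddSubgroup A) :=
  QuotientAddGroup.map _ _ (endo A s) le_rfl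

/-- If `a` represents a compatible family at `C`, it represents it at every larger `D`. -/
theorem completion_rep (x : completion S A) (C D : constructible S A)
    (h : (C : AddSubgroup A) ≤ D) (a : A) (ha : x.1 C = (a : A ⧸ (C : AddSubgroup A))) :
    x.1 D = (a : A ⧸ (D : AddSubgroup A)) := by
  rw [← x.2 C D h, ha]
  rfl

/-- The coordinate at `C` of `σ_s x` is the image of the coordinate of `x` at `σ_s⁻¹ C` under the
map `A / σ_s⁻¹ C → A / C` induced by `σ_s`. -/
instance : SMul S (completion S A) where
  smul s x := ⟨fun C => quotientEndo s C (x.1 (pullback s C)), by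
    intro C D h
    obtain ⟨a, ha⟩ := QuotientAddGroup.mk_surjective (x.1 (pullback s C))
    have h' : ((pullback s C : constructible S A) : AddSubgroup A) ≤ pullback s D :=
      AddSubgroup.comap_mono h
    have hD := completion_rep x _ _ h' a ha.symm
    change QuotientAddGroup.map _ _ (AddMonoidHom.id A) _ (quotientEndo s C (x.1 (pullback s C))) =
      quotientEndo s D (x.1 (pullback s D))
    rw [← ha, hD]
    rfl⟩

theorem completion_smul_apply (s : S) (x : completion S A) (C : constructible S A) :
    (s • x).1 C = quotientEndo s C (x.1 (pullback s C)) := rfl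

instance : DistribMulAction S (completion S A) where
  one_smul x := by
    refine Subtype.ext (funext fun C => ?_)
    rw [completion_smul_apply]
    obtain ⟨a, ha⟩ := QuotientAddGroup.mk_surjective (x.1 (pullback 1 C))
    have h : ((pullback (1 : S) C : constructible S A) : AddSubgroup A) ≤ C := by
      intro y hy
      simpa [pullback] using hy
    rw [completion_rep x _ C h a ha.symm, ← ha]
    exact congrArg _ (one_smul S a)
  mul_smul s t x := by
    refine Subtype.ext (funext fun C => ?_)
    rw [completion_smul_apply, completion_smul_apply, completion_smul_apply]
    obtain ⟨a, ha⟩ := QuotientAddGroup.mk_surjective (x.1 (pullback (s * t) C))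
    have h : ((pullback (s * t) C : constructible S A) : AddSubgroup A)
        ≤ pullback t (pullback s C) := by
      intro y hy
      simpa [pullback, mul_smul] using hy
    rw [completion_rep x _ _ h a ha.symm, ← ha]
    exact congrArg _ (mul_smul s t a)
  smul_zero s := by
    refine Subtype.ext (funext fun C => ?_)
    rw [completion_smul_apply]
    exact map_zero _
  smul_add s x y := by
    refine Subtype.ext (funext fun C => ?_)
    exact map_add (quotientEndo s C) _ _

theorem completion_continuous_smul (s : S) : Continuous fun x : completion S A => s • x :=
  continuous_to_completion fun C =>
    (isLocallyConstant_coord (pullback s C)).comp (quotientEndo s C)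

variable (S A) in
/-- The canonical map from `A` to its completion; it intertwines the actions of `S`. -/
def toCompletion : A →+[S] completion S A where
  toFun a := ⟨fun _ => (a : A), fun _ _ _ => rfl⟩
  map_smul' _ _ := rfl
  map_zero' := rfl
  map_add' _ _ := rfl

end Completion

section Action

variable {G Q V : Type} [Group G] [Group Q] [AddCommGroup V] (ρ : Representation ℤ G V)
  (β : Representation ℤ Q V) (α : Q → G →* G)

/-- If `Q` acts on `G` by `α` and on the `G`-module `V` by `β`, compatibly, then `β g` is a map from
`V` to the restriction of `V` along `α g`. -/
noncomputable def resHom (hβ : ∀ g a v, β g (ρ a v) = ρ (α g a) (β g v)) (g : Q) :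
    Rep.of ρ ⟶ Rep.res (α g) (Rep.of ρ) :=
  Rep.ofHom ⟨β g, fun a => LinearMap.ext fun v => hβ g a v⟩

/-- The resulting action `g ↦ H_q(α g, β g)` of `Q` on `H_q(G, V)`. -/
noncomputable def homologyRep (hone : α 1 = MonoidHom.id G)
    (hmul : ∀ g h, α (g * h) = (α g).comp (α h))
    (hβ : ∀ g a v, β g (ρ a v) = ρ (α g a) (β g v)) (q : ℕ) :
    Representation ℤ Q (groupHomology (Rep.of ρ) q) where
  toFun g := (groupHomology.map (α g) (resHom ρ β α hβ g) q).hom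
  map_one' := by
    have h1 : (resHom ρ β α hβ 1).hom.toLinearMap =
        (CategoryTheory.CategoryStruct.id (Rep.of ρ)).hom.toLinearMap :=
      LinearMap.ext fun v => congrArg (fun T : V →ₗ[ℤ] V => T v) (map_one β)
    rw [groupHomology.map_congr hone h1, groupHomology.map_id]
    rfl
  map_mul' g h := by
    have h1 : (resHom ρ β α hβ (g * h)).hom.toLinearMap =
        (CategoryTheory.CategoryStruct.comp (resHom ρ β α hβ h)
          ((Rep.resFunctor (α h)).map (resHom ρ β α hβ g))).hom.toLinearMap :=
      LinearMap.ext fun v => congrArg (fun T : V →ₗ[ℤ] V => T v) (map_mul β g h)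
    rw [groupHomology.map_congr (hmul g h) h1, groupHomology.map_comp]
    rfl

end Action

section Homology

variable (S A : Type) [Monoid S] [IsCancelMul S] [IsReversible S] [AddCommGroup A]
  [DistribMulAction S A]

/-- The group `𝒜 = lim_s (A; σ_s)` (inductive limit). -/
abbrev LimitGroup : Type := Limit S A

/-- The group `lim_s (Ā; σ_s)` (inductive limit), where `Ā` is the completion of `A`. -/
abbrev LimitCompletion : Type := Limit S (completion S A)

/-- The inductive limit topology. -/
noncomputable instance : TopologicalSpace (LimitCompletion S A) :=
  ⨆ s : (⊤ : Submonoid S), TopologicalSpace.coinduced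
    (fun x : completion S A => OreLocalization.oreDiv x s) inferInstance

variable {S A}

theorem continuous_oreDiv (s : (⊤ : Submonoid S)) :
    Continuous fun x : completion S A => (OreLocalization.oreDiv x s : LimitCompletion S A) :=
  continuous_iSup_rng (i := s) continuous_coinduced_rng

theorem continuous_from_limit {f : LimitCompletion S A → LimitCompletion S A}
    (hf : ∀ s : (⊤ : Submonoid S),
      Continuous fun x : completion S A => f (OreLocalization.oreDiv x s)) : Continuous f :=
  continuous_iSup_dom.2 fun s => continuous_coinduced_dom.2 (hf s)

theorem limit_continuous_add_left (b : LimitCompletion S A) :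
    Continuous fun x : LimitCompletion S A => b + x := by
  induction b using OreLocalization.ind with
  | _ y t =>
    refine continuous_from_limit fun s => ?_
    simp only [OreLocalization.oreDiv_add_oreDiv]
    exact (continuous_oreDiv _).comp
      ((completion_continuous_add_left _).comp (completion_continuous_smul _))

theorem limit_continuous_smul (g : FractionGroup S) :
    Continuous fun x : LimitCompletion S A => g • x := by
  induction g using OreLocalization.ind with
  | _ r t =>
    refine continuous_from_limit fun s => ?_
    simp only [OreLocalization.oreDiv_smul_oreDiv]
    exact (continuous_oreDiv _).comp (completion_continuous_smul _)

/-- Translation by `b`. -/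
noncomputable def translate (b : LimitCompletion S A) :
    LimitCompletion S A ≃ₜ LimitCompletion S A where
  toEquiv := Equiv.addLeft b
  continuous_toFun := limit_continuous_add_left b
  continuous_invFun := limit_continuous_add_left (-b)

/-- The automorphism `x ↦ g • x` for `g` in the group of quotients of `S`. -/
noncomputable def auto (g : FractionGroup S) : LimitCompletion S A ≃ₜ LimitCompletion S A where
  toEquiv := MulAction.toPerm g
  continuous_toFun := limit_continuous_smul g
  continuous_invFun := limit_continuous_smul g⁻¹

/-- The map `f ↦ f ∘ e⁻¹` on compactly supported continuous integer valued functions. -/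
noncomputable def push {X : Type} [TopologicalSpace X] (e : X ≃ₜ X) : C_c(X, ℤ) →ₗ[ℤ] C_c(X, ℤ) :=
  CompactlySupportedContinuousMap.compLinearMap e.symm.toCocompactMap

@[simp]
theorem push_apply {X : Type} [TopologicalSpace X] (e : X ≃ₜ X) (f : C_c(X, ℤ)) (x : X) :
    push e f x = f (e.symm x) := rfl

theorem auto_symm_apply (g : FractionGroup S) (x : LimitCompletion S A) :
    (auto g).symm x = g⁻¹ • x := rfl

theorem push_auto_one : push (auto (A := A) (1 : FractionGroup S)) = LinearMap.id := by
  ext f x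
  rw [push_apply, auto_symm_apply, inv_one, one_smul, LinearMap.id_apply]

theorem push_auto_mul (g h : FractionGroup S) :
    push (auto (A := A) (g * h)) = push (auto g) ∘ₗ push (auto h) := by
  ext f x
  rw [LinearMap.comp_apply, push_apply, push_apply, push_apply, auto_symm_apply, auto_symm_apply,
    auto_symm_apply, mul_inv_rev, mul_smul]

variable (S A)

/-- The canonical map from `𝒜` to the inductive limit of the completions. -/
noncomputable def incl : LimitGroup S A →+ LimitCompletion S A := limitMap (toCompletion S A)

/-- `𝒜` acts on the functions by translation: `(a · f)(x) = f (x - a)`. -/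
noncomputable def translationRep :
    Representation ℤ (Multiplicative (LimitGroup S A)) C_c(LimitCompletion S A, ℤ) where
  toFun a := push (translate (incl S A a.toAdd))
  map_one' := by
    ext f x
    change f (-(incl S A 0) + x) = f x
    rw [(incl S A).map_zero, neg_zero, zero_add]
  map_mul' a b := by
    ext f x
    change f (-(incl S A (a.toAdd + b.toAdd)) + x) =
      f (-(incl S A b.toAdd) + (-(incl S A a.toAdd) + x))
    rw [(incl S A).map_add, neg_add_rev, add_assoc]

/-- The `𝒜`-module of compactly supported continuous integer valued functions on the inductive limit
of the completions. -/
noncomputable abbrev coeff : Rep ℤ (Multiplicative (LimitGroup S A)) :=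
  Rep.of (translationRep S A)

variable {S} in
/-- The automorphism `a ↦ g • a` of `𝒜`. -/
noncomputable def groupAuto (g : FractionGroup S) :
    Multiplicative (LimitGroup S A) →* Multiplicative (LimitGroup S A) :=
  AddMonoidHom.toMultiplicative (DistribSMul.toAddMonoidHom (LimitGroup S A) g)

/-- The action `g ↦ (f ↦ f ∘ g⁻¹)` of the group of quotients on the functions. -/
noncomputable def functionRep :
    Representation ℤ (FractionGroup S) C_c(LimitCompletion S A, ℤ) where
  toFun g := push (auto g)
  map_one' := push_auto_one
  map_mul' := push_auto_mul

theorem groupAuto_one : groupAuto A (1 : FractionGroup S) = MonoidHom.id _ := by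
  refine MonoidHom.ext fun a => ?_
  exact congrArg Multiplicative.ofAdd (one_smul (FractionGroup S) a.toAdd)

variable {S} in
theorem groupAuto_mul (g h : FractionGroup S) :
    groupAuto A (g * h) = (groupAuto A g).comp (groupAuto A h) := by
  refine MonoidHom.ext fun a => ?_
  exact congrArg Multiplicative.ofAdd (mul_smul g h a.toAdd)

theorem functionRep_compat (g : FractionGroup S) (a : Multiplicative (LimitGroup S A))
    (f : C_c(LimitCompletion S A, ℤ)) :
    functionRep S A g (translationRep S A a f) =
      translationRep S A (groupAuto A g a) (functionRep S A g f) := by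
  ext x
  change f (-(incl S A a.toAdd) + g⁻¹ • x) = f (g⁻¹ • (-(incl S A (g • a.toAdd)) + x))
  rw [incl, limitMap_smul, smul_add, smul_neg, inv_smul_smul]

/-- The group homology `H_q(𝒜, Z𝒜̄)`. -/
noncomputable abbrev homology (q : ℕ) : Type := groupHomology (coeff S A) q

/-- The action `g ↦ H_q(σ̃_g, f ↦ f ∘ σ̃_g⁻¹)` of the group of quotients on `H_q(𝒜, Z𝒜̄)`. -/
noncomputable def theta (q : ℕ) : Representation ℤ (FractionGroup S) (homology S A q) :=
  homologyRep (translationRep S A) (functionRep S A) (groupAuto A) (groupAuto_one S A)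
    (groupAuto_mul A) (functionRep_compat S A) q

/-- The chain `∑_π sgn(π) [a_π(1) | ⋯ | a_π(q)] ⊗ χ`, i.e. the Pontryagin product of the classes of
`a₁, …, a_q` in the bar complex of `A`, pushed to `𝒜` with coefficient `χ`. -/
noncomputable def shuffleChain {q : ℕ} (χ : C_c(LimitCompletion S A, ℤ)) (a : Fin q → A) :
    (Fin q → Multiplicative (LimitGroup S A)) →₀ C_c(LimitCompletion S A, ℤ) :=
  ∑ π : Equiv.Perm (Fin q), Finsupp.single
    (fun i => Multiplicative.ofAdd (toLimit (1 : S) (a (π i)))) ((Equiv.Perm.sign π : ℤ) • χ)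

/-- `h` is the homology class of the cycle `c`. -/
def IsClassOf {q : ℕ} (h : homology S A q)
    (c : (Fin q → Multiplicative (LimitGroup S A)) →₀ C_c(LimitCompletion S A, ℤ)) : Prop :=
  ∃ z : groupHomology.cycles (coeff S A) q,
    groupHomology.iCycles (coeff S A) q z = c ∧ groupHomology.π (coeff S A) q z = h

end Homology

section Indices

variable (S A : Type) [Monoid S] [AddCommGroup A] [DistribMulAction S A]

/-- The subring `Z[I⁻¹]` of `ℚ` generated by the `1 / k` with `k` dividing the index of some
constructible subgroup. -/
def invRing : Subring ℚ :=
  Subring.closure {x : ℚ | ∃ C ∈ constructible S A, ∃ k : ℕ, k ∣ C.index ∧ x = (k : ℚ)⁻¹}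

variable {S} in
/-- The element `1 / [A : σ_s A]` of `Z[I⁻¹]`. -/
noncomputable def invIndex (s : S) : invRing S A :=
  ⟨((endo A s).range.index : ℚ)⁻¹,
    Subring.subset_closure ⟨_, range_mem_constructible S A s, _, dvd_rfl, rfl⟩⟩

end Indices

end AlgebraicAction

/-!
Write `𝒜` for the limit of the copies of `A` and `μ` for the Haar measure on the limit of the
completions, normalised by `μ(Ā) = 1`, so that `μ` of the indicator function of `s Ā` is
`1 / [A : s A]`. Since `⋀^q` of a torsion-free group embeds in the exterior power of its
rationalisation, everything takes place in `W = ⋀^q (ℚ ⊗ 𝒜)`, the exterior power over `ℚ`.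

On inhomogeneous chains, `f ⊗ [g₁|⋯|g_q] ↦ (μ(f) / q!) g₁ ∧ ⋯ ∧ g_q` vanishes on boundaries
(`pairing_bd`), because `μ` is translation invariant and a multilinear map is a cocycle. It
therefore induces a homomorphism `wedgeClass` from the homology of `𝒜` to `W`. It maps the product
`[a₁] × ⋯ × [a_q]` with coefficient `f` to `μ(f) a₁ ∧ ⋯ ∧ a_q` (`wedgeValue_shuffleProd`). The
theorem follows once its image and its kernel are known.

The source of this information is `exists_represents_prodSpan`: every class is represented by a
combination of products `[e_{i₁}] × ⋯ × [e_{i_q}]`, `i₁ < ⋯ < i_q`, whose common coefficient is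
the indicator function of some `s Ā`, and where the `e_i` are independent elements of `s A`. The
corresponding `e_{i₁} ∧ ⋯ ∧ e_{i_q}` are linearly independent in `W`, so `wedgeClass` is
injective; and its values are `1 / [A : s A]` times elements of `⋀^q A`, so its image lies in that
of `ℤ[𝕀⁻¹] ⊗ ⋀^q A`, which embeds in `W`. The maps `k` and `j` are then obtained by comparing the
images in `W`. Both `k` and the embedding of `⋀^q A` in `W` stay injective after extending scalars
to `ℤ[𝕀⁻¹]`, as every element of `ℤ[𝕀⁻¹] ⊗ N` is a pure tensor `u ⊗ x` with `u` invertible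
(`liftBaseChange_injective`). The formula for the action of `s` reflects that
`f ↦ f ∘ s⁻¹` multiplies `μ` by `1 / [A : s A]` (`haar_functionRep`).

The description of the classes is obtained as follows. By compactness a function is invariant
under some `s Ā` and vanishes on all but finitely many cosets, so the coefficients of a cycle lie
in the span of the translates of the indicator function of `s Ā`, which is a copy of `ℤ[𝒜 / s A]`.
Lifting the cycle to coefficients in `ℤ[𝒜]`, its boundary already vanishes in `ℤ[𝒜 / F]` for a
finitely generated, hence free, subgroup `F` of `s A` (`exists_prodSpan_of_cycle`). The homology
with these coefficients is generated by the products of the elements of a basis of `F`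
(`isGenerated_quotient`). This is an induction on the rank: adding a basis element `t` to a
subgroup `K` gives an exact sequence `0 → ℤ[𝒜 / K] → ℤ[𝒜 / K] → ℤ[𝒜 / (K + ℤt)] → 0`, whose first
map is the difference of the translation by `-t` and the identity, and the shuffle product with
`[t]` is a homotopy from that difference to zero (`bd_shuffle_succ`, `IsGenerated.cons`).
-/

namespace AlgebraicAction

/-! ### The bar complex of a commutative group -/

section Bar

variable {G : Type} {V : Type} [AddCommGroup V] {q : ℕ}

/-- Inhomogeneous `q`-chains of `G` with coefficients in `V`. -/
abbrev Chain (G V : Type) [AddCommGroup V] (q : ℕ) : Type := (Fin q → G) →₀ V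

/-- The map `[g₁|⋯|g_q] ↦ [g|g₁|⋯|g_q]`, the coefficients being unchanged. -/
noncomputable def consChain (g : G) : Chain G V q →ₗ[ℤ] Chain G V (q + 1) :=
  Finsupp.lmapDomain V ℤ fun w => (Fin.cons g w : Fin (q + 1) → G)

@[simp]
theorem consChain_single (g : G) (w : Fin q → G) (v : V) :
    consChain g (Finsupp.single w v) = Finsupp.single (Fin.cons g w : Fin (q + 1) → G) v := by
  simp [consChain]

theorem single_eq_consChain (w : Fin (q + 1) → G) (v : V) :
    Finsupp.single w v = consChain (w 0) (Finsupp.single (Fin.tail w) v) := by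
  rw [consChain_single, Fin.cons_self_tail]

/-- Linear maps on chains of positive degree agree if they agree on all `[g|c]`. -/
theorem chain_hom_ext {W : Type*} [AddCommGroup W] {f₁ f₂ : Chain G V (q + 1) →ₗ[ℤ] W}
    (h : ∀ g c, f₁ (consChain g c) = f₂ (consChain g c)) : f₁ = f₂ := by
  refine Finsupp.lhom_ext fun w v => ?_
  rw [single_eq_consChain, h]

/-- The action of a linear map on the coefficients of chains. -/
noncomputable abbrev mapCoeff {V' : Type} [AddCommGroup V'] (φ : V →ₗ[ℤ] V') :
    Chain G V q →ₗ[ℤ] Chain G V' q :=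
  Finsupp.mapRange.linearMap φ

theorem mapCoeff_single {V' : Type} [AddCommGroup V'] (φ : V →ₗ[ℤ] V') (w : Fin q → G) (v : V) :
    mapCoeff φ (Finsupp.single w v) = Finsupp.single w (φ v) := by
  simp [mapCoeff]

theorem mapCoeff_consChain {V' : Type} [AddCommGroup V'] (φ : V →ₗ[ℤ] V') (g : G)
    (c : Chain G V q) : mapCoeff φ (consChain g c) = consChain g (mapCoeff φ c) := by
  induction c using Finsupp.induction_linear with
  | zero => simp
  | add c₁ c₂ h₁ h₂ => simp only [map_add, h₁, h₂]
  | single w v => simp only [consChain_single, mapCoeff_single]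

/-- The shuffle product with the one-chain `[a]`, that is
`[g₁|⋯|g_q] ↦ ∑ᵢ (-1)ⁱ [g₁|⋯|gᵢ|a|gᵢ₊₁|⋯|g_q]`, defined by recursion on `q`. -/
noncomputable def shuffle (a : G) : (q : ℕ) → Chain G V q →ₗ[ℤ] Chain G V (q + 1)
  | 0 => consChain a
  | q + 1 => Finsupp.lsum ℤ fun w => consChain a ∘ₗ Finsupp.lsingle w -
      consChain (w 0) ∘ₗ shuffle a q ∘ₗ Finsupp.lsingle (Fin.tail w)

theorem shuffle_zero (a : G) (c : Chain G V 0) : shuffle a 0 c = consChain a c := rfl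

theorem shuffle_consChain (a g : G) (c : Chain G V q) :
    shuffle a (q + 1) (consChain g c) = consChain a (consChain g c) -
      consChain g (shuffle a q c) := by
  induction c using Finsupp.induction_linear with
  | zero => simp
  | add c₁ c₂ h₁ h₂ => simp only [map_add, h₁, h₂]; abel
  | single w v => simp [shuffle]

theorem mapCoeff_shuffle {V' : Type} [AddCommGroup V'] (φ : V →ₗ[ℤ] V') (a : G)
    (c : Chain G V q) : mapCoeff φ (shuffle a q c) = shuffle a q (mapCoeff φ c) := by
  induction q with
  | zero => simp only [shuffle_zero, mapCoeff_consChain]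
  | succ q ih =>
    suffices h : mapCoeff φ ∘ₗ shuffle a (q + 1) = shuffle a (q + 1) ∘ₗ mapCoeff φ from
      LinearMap.congr_fun h c
    refine chain_hom_ext fun g c => ?_
    simp only [LinearMap.comp_apply, shuffle_consChain, map_sub, mapCoeff_consChain, ih]

/-- The iterated shuffle product `[a₁] × ⋯ × [a_q]` with coefficient `v`. -/
noncomputable def shuffleProd (v : V) : (q : ℕ) → (Fin q → G) → Chain G V q
  | 0, _ => Finsupp.single default v
  | q + 1, a => shuffle (a 0) q (shuffleProd v q (Fin.tail a))

theorem mapCoeff_shuffleProd {V' : Type} [AddCommGroup V'] (φ : V →ₗ[ℤ] V') (v : V)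
    (a : Fin q → G) : mapCoeff φ (shuffleProd v q a) = shuffleProd (φ v) q a := by
  induction q with
  | zero => simp only [shuffleProd, mapCoeff_single]
  | succ q ih => simp only [shuffleProd, mapCoeff_shuffle, ih]

variable [CommGroup G]

/-- The part of the boundary of `[g|c]` that does not move the coefficients. -/
noncomputable def innerFace (g : G) : Chain G V q →ₗ[ℤ] Chain G V q :=
  Finsupp.lsum ℤ fun w => ∑ j : Fin (q + 1), (-1 : ℤ) ^ ((j : ℕ) + 1) •
    Finsupp.lsingle (Fin.contractNth j (· * ·) (Fin.cons g w : Fin (q + 1) → G))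

theorem innerFace_single (g : G) (w : Fin q → G) (v : V) :
    innerFace g (Finsupp.single w v) = ∑ j : Fin (q + 1), (-1 : ℤ) ^ ((j : ℕ) + 1) •
      Finsupp.single (Fin.contractNth j (· * ·) (Fin.cons g w : Fin (q + 1) → G)) v := by
  simp [innerFace]

theorem innerFace_zero (g : G) (c : Chain G V 0) : innerFace g c = -c := by
  suffices h : innerFace g = -(LinearMap.id : Chain G V 0 →ₗ[ℤ] Chain G V 0) by
    rw [h]; rfl
  refine Finsupp.lhom_ext fun w v => ?_
  rw [innerFace_single]
  simp [Subsingleton.elim _ w]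

theorem contractNth_zero_cons (g h : G) (w : Fin q → G) :
    Fin.contractNth 0 (· * ·) (Fin.cons g (Fin.cons h w) : Fin (q + 2) → G) =
      (Fin.cons (g * h) w : Fin (q + 1) → G) := by
  funext k
  refine Fin.cases ?_ (fun k => ?_) k
  · rw [Fin.contractNth_apply_of_eq _ _ _ _ rfl]; rfl
  · rw [Fin.contractNth_apply_of_gt _ _ _ _ (by simp)]; rfl

theorem contractNth_succ_cons (g : G) (j : Fin (q + 1)) (w : Fin (q + 1) → G) :
    Fin.contractNth j.succ (· * ·) (Fin.cons g w : Fin (q + 2) → G) =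
      (Fin.cons g (Fin.contractNth j (· * ·) w) : Fin (q + 1) → G) := by
  funext k
  refine Fin.cases ?_ (fun k => ?_) k
  · rw [Fin.contractNth_apply_of_lt _ _ _ _ (by simp)]; rfl
  · rw [Fin.cons_succ]
    rcases lt_trichotomy (k : ℕ) j with h | h | h
    · rw [Fin.contractNth_apply_of_lt _ _ _ _ h, Fin.contractNth_apply_of_lt _ _ _ _ (by simpa)]
      rfl
    · rw [Fin.contractNth_apply_of_eq _ _ _ _ h, Fin.contractNth_apply_of_eq _ _ _ _ (by simpa)]
      rfl
    · rw [Fin.contractNth_apply_of_gt _ _ _ _ h, Fin.contractNth_apply_of_gt _ _ _ _ (by simpa)]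
      rfl

theorem innerFace_consChain (g h : G) (c : Chain G V q) :
    innerFace g (consChain h c) = -consChain (g * h) c - consChain g (innerFace h c) := by
  induction c using Finsupp.induction_linear with
  | zero => simp
  | add c₁ c₂ h₁ h₂ => simp only [map_add, h₁, h₂]; abel
  | single w v =>
    rw [consChain_single, innerFace_single, innerFace_single, Fin.sum_univ_succ, map_sum,
      sub_eq_add_neg, ← Finset.sum_neg_distrib]
    congr 1
    · simp [contractNth_zero_cons]
    · refine Finset.sum_congr rfl fun j _ => ?_
      rw [contractNth_succ_cons, map_zsmul, consChain_single, Fin.val_succ, pow_succ, mul_neg_one,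
        neg_smul]

theorem mapCoeff_innerFace {V' : Type} [AddCommGroup V'] (φ : V →ₗ[ℤ] V') (g : G)
    (c : Chain G V q) : mapCoeff φ (innerFace g c) = innerFace g (mapCoeff φ c) := by
  induction c using Finsupp.induction_linear with
  | zero => simp
  | add c₁ c₂ h₁ h₂ => simp only [map_add, h₁, h₂]
  | single w v => simp only [innerFace_single, mapCoeff_single, map_sum, map_zsmul]

/-- The boundary operator of the bar complex. -/
noncomputable def bd (ρ : Representation ℤ G V) (q : ℕ) : Chain G V (q + 1) →ₗ[ℤ] Chain G V q :=
  (groupHomology.inhomogeneousChains.d (Rep.of ρ) q).hom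

theorem bd_consChain (ρ : Representation ℤ G V) (g : G) (c : Chain G V q) :
    bd ρ q (consChain g c) = mapCoeff (ρ g⁻¹) c + innerFace g c := by
  induction c using Finsupp.induction_linear with
  | zero => simp
  | add c₁ c₂ h₁ h₂ => simp only [map_add, h₁, h₂]; abel
  | single w v =>
    rw [consChain_single, innerFace_single, mapCoeff_single]
    exact groupHomology.inhomogeneousChains.d_single (A := Rep.of ρ) q _ v

theorem bd_bd (ρ : Representation ℤ G V) (c : Chain G V (q + 2)) :
    bd ρ q (bd ρ (q + 1) c) = 0 := by
  have h := groupHomology.inhomogeneousChains.d_comp_d (n := q) (Rep.of ρ)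
  exact congrArg (fun T => T.hom c) h

theorem mapCoeff_bd {V' : Type} [AddCommGroup V'] {ρ : Representation ℤ G V}
    {ρ' : Representation ℤ G V'} (φ : V →ₗ[ℤ] V') (hφ : ∀ g v, φ (ρ g v) = ρ' g (φ v))
    (c : Chain G V (q + 1)) : mapCoeff φ (bd ρ q c) = bd ρ' q (mapCoeff φ c) := by
  suffices h : mapCoeff φ ∘ₗ bd ρ q = bd ρ' q ∘ₗ mapCoeff φ from LinearMap.congr_fun h c
  refine chain_hom_ext fun g c => ?_
  simp only [LinearMap.comp_apply]
  rw [bd_consChain, map_add, mapCoeff_innerFace, mapCoeff_consChain, bd_consChain]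
  congr 1
  simp only [← LinearMap.comp_apply, ← Finsupp.mapRange.linearMap_comp]
  congr 2
  exact LinearMap.ext fun v => hφ g⁻¹ v

theorem innerFace_shuffle (g a : G) (c : Chain G V q) :
    innerFace g (shuffle a q c) = consChain g c - consChain (a * g) c -
      consChain a (innerFace g c) + shuffle a q (innerFace g c) := by
  induction q generalizing g with
  | zero =>
    rw [shuffle_zero, innerFace_consChain, innerFace_zero, innerFace_zero, shuffle_zero,
      mul_comm a g]
    simp only [map_neg]
    abel
  | succ q ih =>
    suffices h : innerFace g ∘ₗ shuffle a (q + 1) = consChain g - consChain (a * g) -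
        consChain a ∘ₗ innerFace g + shuffle a (q + 1) ∘ₗ innerFace g from
      LinearMap.congr_fun h c
    refine chain_hom_ext fun h c => ?_
    simp only [LinearMap.comp_apply, LinearMap.add_apply, LinearMap.sub_apply, shuffle_consChain,
      innerFace_consChain, map_sub, map_neg, map_add, ih, mul_comm a]
    abel

/-- In a commutative group the shuffle product with `[a]` is a homotopy between the identity and
the action of `a⁻¹` on the coefficients. -/
theorem bd_shuffle_succ (ρ : Representation ℤ G V) (a : G) (c : Chain G V (q + 1)) :
    bd ρ (q + 1) (shuffle a (q + 1) c) =
      mapCoeff (ρ a⁻¹) c - c - shuffle a q (bd ρ q c) := by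
  suffices h : bd ρ (q + 1) ∘ₗ shuffle a (q + 1) =
      mapCoeff (ρ a⁻¹) - LinearMap.id - shuffle a q ∘ₗ bd ρ q from LinearMap.congr_fun h c
  refine chain_hom_ext fun g c => ?_
  simp only [LinearMap.comp_apply, LinearMap.sub_apply, shuffle_consChain, map_sub, map_add,
    bd_consChain, mapCoeff_consChain, innerFace_consChain, LinearMap.id_apply, mapCoeff_shuffle,
    innerFace_shuffle]
  abel

theorem bd_shuffle_zero (ρ : Representation ℤ G V) (a : G) (c : Chain G V 0) :
    bd ρ 0 (shuffle a 0 c) = mapCoeff (ρ a⁻¹) c - c := by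
  rw [shuffle_zero, bd_consChain, innerFace_zero, sub_eq_add_neg]

/-- A chain is a cycle if its boundary vanishes; in degree zero all chains are cycles. -/
def IsCycle (ρ : Representation ℤ G V) : (q : ℕ) → Chain G V q → Prop
  | 0, _ => True
  | q + 1, c => bd ρ q c = 0

theorem mapCoeff_shuffleProd_of_fixed (ρ : Representation ℤ G V) {v : V} {a : Fin q → G} {g : G}
    (hv : ρ g v = v) : mapCoeff (ρ g) (shuffleProd v q a) = shuffleProd v q a := by
  rw [mapCoeff_shuffleProd, hv]

theorem isCycle_shuffleProd (ρ : Representation ℤ G V) {v : V} {a : Fin q → G}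
    (ha : ∀ i, ρ (a i)⁻¹ v = v) : IsCycle ρ q (shuffleProd v q a) := by
  induction q with
  | zero => trivial
  | succ q ih =>
    have h := ih (a := Fin.tail a) fun i => ha i.succ
    change bd ρ q (shuffle (a 0) q (shuffleProd v q (Fin.tail a))) = 0
    cases q with
    | zero => rw [bd_shuffle_zero, mapCoeff_shuffleProd_of_fixed ρ (ha 0), sub_self]
    | succ q =>
      rw [bd_shuffle_succ, mapCoeff_shuffleProd_of_fixed ρ (ha 0), sub_self, h, map_zero, sub_zero]

theorem IsCycle.mapCoeff {V' : Type} [AddCommGroup V'] {ρ : Representation ℤ G V}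
    {ρ' : Representation ℤ G V'} (φ : V →ₗ[ℤ] V') (hφ : ∀ g v, φ (ρ g v) = ρ' g (φ v))
    {c : Chain G V q} (hc : IsCycle ρ q c) : IsCycle ρ' q (mapCoeff φ c) := by
  cases q with
  | zero => trivial
  | succ q =>
    change bd ρ' q _ = 0
    rw [← mapCoeff_bd φ hφ, show bd ρ q c = 0 from hc, map_zero]

end Bar

/-! ### Homology with coefficients in permutation modules -/

section Generation

variable {G : Type} {V : Type} [AddCommGroup V] {q n : ℕ}

/-- The chains spanned by the shuffle products `[e_{i₁}] × ⋯ × [e_{i_q}]`, `i₁ < ⋯ < i_q`, with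
coefficient `v`. -/
noncomputable def prodSpan (v : V) (e : Fin n → G) (q : ℕ) : Submodule ℤ (Chain G V q) :=
  Submodule.span ℤ (Set.range fun f : Fin q ↪o Fin n => shuffleProd v q (e ∘ f))

theorem mapCoeff_mem_prodSpan {V' : Type} [AddCommGroup V'] (φ : V →ₗ[ℤ] V') {v : V}
    {e : Fin n → G} {c : Chain G V q} (hc : c ∈ prodSpan v e q) :
    mapCoeff φ c ∈ prodSpan (φ v) e q := by
  unfold prodSpan at hc
  induction hc using Submodule.span_induction with
  | mem x hx =>
    obtain ⟨f, rfl⟩ := hx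
    exact Submodule.subset_span ⟨f, (mapCoeff_shuffleProd φ v _).symm⟩
  | zero => rw [map_zero]; exact zero_mem _
  | add x y _ _ hx hy => rw [map_add]; exact add_mem hx hy
  | smul a x _ hx => rw [map_zsmul]; exact Submodule.smul_mem _ a hx

theorem prodSpan_le_cons (v : V) (t : G) (e : Fin n → G) :
    prodSpan v e q ≤ prodSpan v (Fin.cons t e : Fin (n + 1) → G) q := by
  refine Submodule.span_le.2 ?_
  rintro _ ⟨f, rfl⟩
  refine Submodule.subset_span ⟨f.trans (Fin.succOrderEmb n), ?_⟩
  congr 1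

theorem shuffle_mem_prodSpan_cons {v : V} (t : G) {e : Fin n → G} {c : Chain G V q}
    (hc : c ∈ prodSpan v e q) :
    shuffle t q c ∈ prodSpan v (Fin.cons t e : Fin (n + 1) → G) (q + 1) := by
  have h : prodSpan v e q ≤
      (prodSpan v (Fin.cons t e : Fin (n + 1) → G) (q + 1)).comap (shuffle t q) := by
    refine Submodule.span_le.2 ?_
    rintro _ ⟨f, rfl⟩
    let F : Fin (q + 1) → Fin (n + 1) := Fin.cons 0 fun i => (f i).succ
    have hF : StrictMono F := by
      intro i j hij
      refine Fin.cases (fun hij => ?_) (fun i hij => ?_) i hij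
      · obtain ⟨j, rfl⟩ := Fin.exists_succ_eq.2 (Fin.pos_iff_ne_zero.1 hij)
        exact Fin.succ_pos _
      · obtain ⟨j, rfl⟩ := Fin.exists_succ_eq.2 (Fin.pos_iff_ne_zero.1 ((Fin.succ_pos i).trans hij))
        exact Fin.succ_lt_succ_iff.2 (f.strictMono (Fin.succ_lt_succ_iff.1 hij))
    exact Submodule.subset_span ⟨OrderEmbedding.ofStrictMono F hF, rfl⟩
  exact h hc

/-- If the values of a chain lie in the range of `τ`, the chain comes from a chain by `τ`. -/
theorem exists_mapCoeff_eq {V' : Type} [AddCommGroup V'] (τ : V →ₗ[ℤ] V') (c : Chain G V' q)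
    (hc : ∀ w, c w ∈ LinearMap.range τ) : ∃ b : Chain G V q, mapCoeff τ b = c := by
  change c ∈ LinearMap.range (mapCoeff τ)
  rw [← Finsupp.sum_single c]
  refine Submodule.sum_mem _ fun w _ => ?_
  obtain ⟨v, hv⟩ := hc w
  exact ⟨Finsupp.single w v, by rw [mapCoeff_single, hv]⟩

/-- The kernel of the map of free modules induced by `p` is spanned by the differences of the
points with the same image. -/
theorem mem_span_of_mapDomain_eq_zero {X Y : Type} (p : X → Y) (f : X →₀ ℤ)
    (hf : Finsupp.lmapDomain ℤ ℤ p f = 0) :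
    f ∈ Submodule.span ℤ {y | ∃ x x', p x = p x' ∧
      y = Finsupp.single x (1 : ℤ) - Finsupp.single x' 1} := by
  classical
  cases isEmpty_or_nonempty X with
  | inl h => rw [Subsingleton.elim f 0]; exact zero_mem _
  | inr h =>
    have h1 : Finsupp.lmapDomain ℤ ℤ (fun x => Function.invFun p (p x)) f = 0 := by
      have h2 := congrArg (Finsupp.lmapDomain ℤ ℤ (Function.invFun p)) hf
      rw [map_zero, Finsupp.lmapDomain_apply, Finsupp.lmapDomain_apply,
        ← Finsupp.mapDomain_comp] at h2
      exact h2
    have h2 : f = f.sum fun x m => m • (Finsupp.single x (1 : ℤ) -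
        Finsupp.single (Function.invFun p (p x)) 1) := by
      have h3 : (f.sum fun x m => m • Finsupp.single x (1 : ℤ)) = f := by simp
      have h4 : (f.sum fun x m => m • Finsupp.single (Function.invFun p (p x)) (1 : ℤ)) = 0 := by
        rw [← h1]; simp [Finsupp.mapDomain]
      simp only [smul_sub, Finsupp.sum_sub, h3, h4, sub_zero]
    rw [h2]
    refine Submodule.sum_mem _ fun x _ => Submodule.smul_mem _ _ (Submodule.subset_span ?_)
    exact ⟨x, _, (Function.invFun_eq ⟨x, rfl⟩).symm, rfl⟩

/-- Linear maps on chains with coefficients in `ℤ[X]` agree if they agree on all `x ⊗ b`. -/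
theorem chain_free_hom_ext {X : Type} {W : Type*} [AddCommGroup W]
    {f₁ f₂ : Chain G (X →₀ ℤ) q →ₗ[ℤ] W}
    (h : ∀ y (b : Chain G ℤ q), f₁ (mapCoeff (Finsupp.lsingle y) b) =
      f₂ (mapCoeff (Finsupp.lsingle y) b)) : f₁ = f₂ := by
  refine Finsupp.lhom_ext' fun w => Finsupp.lhom_ext fun y m => ?_
  have h1 := h y (Finsupp.single w m)
  rw [mapCoeff_single] at h1
  exact h1

variable [CommGroup G]

/-- Every cycle with coefficients in `V` is homologous to a combination of the products
`[e_{i₁}] × ⋯ × [e_{i_q}]`, `i₁ < ⋯ < i_q`, with coefficient `v`. -/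
def IsGenerated (ρ : Representation ℤ G V) (v : V) (e : Fin n → G) : Prop :=
  ∀ (q : ℕ) (z : Chain G V q), IsCycle ρ q z → ∃ c ∈ prodSpan v e q, ∃ u, z = c + bd ρ q u

theorem isCycle_of_mem_prodSpan (ρ : Representation ℤ G V) {v : V} {e : Fin n → G}
    (he : ∀ i, ρ (e i)⁻¹ v = v) {c : Chain G V q} (hc : c ∈ prodSpan v e q) : IsCycle ρ q c := by
  cases q with
  | zero => trivial
  | succ q =>
    have h : prodSpan v e (q + 1) ≤ LinearMap.ker (bd ρ q) := by
      refine Submodule.span_le.2 ?_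
      rintro _ ⟨f, rfl⟩
      exact isCycle_shuffleProd (q := q + 1) (a := e ∘ f) ρ fun i => he _
    exact h hc

/-- The Wang sequence: if `t` acts freely on `V'` with coinvariants `V`, the homology with
coefficients in `V` is generated by that with coefficients in `V'` and its products with `[t]`. -/
theorem IsGenerated.cons {V' : Type} [AddCommGroup V'] {ρ' : Representation ℤ G V'}
    {ρ : Representation ℤ G V} {v : V'} {e : Fin n → G} (h : IsGenerated ρ' v e)
    (he : ∀ i, ρ' (e i)⁻¹ v = v) (φ : V' →ₗ[ℤ] V) (hφ : ∀ g v, φ (ρ' g v) = ρ g (φ v))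
    (hsurj : Function.Surjective φ) (t : G) (ht : ∀ x, φ (ρ' t⁻¹ x) = φ x)
    (hker : ∀ x, φ x = 0 → x ∈ LinearMap.range (ρ' t⁻¹ - 1))
    (hinj : ∀ x, ρ' t⁻¹ x = x → x = 0) :
    IsGenerated ρ (φ v) (Fin.cons t e : Fin (n + 1) → G) := by
  intro q z hz
  obtain ⟨z', rfl⟩ := exists_mapCoeff_eq φ z fun w => hsurj _
  -- the case of a cycle which lifts to a cycle with coefficients in `V'`
  have key : ∀ {q : ℕ} (y : Chain G V' q), IsCycle ρ' q y →
      ∃ c ∈ prodSpan (φ v) (Fin.cons t e : Fin (n + 1) → G) q, ∃ u,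
        mapCoeff φ y = c + bd ρ q u := by
    intro q y hy
    obtain ⟨c, hc, u, rfl⟩ := h q y hy
    exact ⟨_, prodSpan_le_cons _ t e (mapCoeff_mem_prodSpan φ hc), mapCoeff φ u, by
      rw [map_add, mapCoeff_bd φ hφ]⟩
  cases q with
  | zero => exact key z' trivial
  | succ q =>
    have hτ : ∀ g x, (ρ' t⁻¹ - 1) (ρ' g x) = ρ' g ((ρ' t⁻¹ - 1) x) := by
      intro g x
      simp only [LinearMap.sub_apply, Module.End.one_apply, map_sub]
      rw [← Module.End.mul_apply, ← Module.End.mul_apply, ← map_mul, ← map_mul, mul_comm]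
    -- the boundary of a lift is the image under `t⁻¹ - 1` of a cycle `w`
    obtain ⟨w, hw⟩ := exists_mapCoeff_eq (ρ' t⁻¹ - 1) (bd ρ' q z') fun x => hker _ (by
      have h1 : mapCoeff φ (bd ρ' q z') = 0 := by rw [mapCoeff_bd φ hφ]; exact hz
      simpa using DFunLike.congr_fun h1 x)
    have hτ_inj : ∀ {p : ℕ} (c : Chain G V' p), mapCoeff (ρ' t⁻¹ - 1) c = 0 → c = 0 := by
      intro p c hc
      ext1 x
      refine hinj _ (sub_eq_zero.1 ?_)
      simpa using DFunLike.congr_fun hc x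
    have hwc : IsCycle ρ' q w := by
      cases q with
      | zero => trivial
      | succ q => exact hτ_inj _ (by rw [mapCoeff_bd _ hτ, hw, bd_bd])
    obtain ⟨b, hb, u, rfl⟩ := h q w hwc
    have hbt : bd ρ' q (shuffle t q b) = mapCoeff (ρ' t⁻¹ - 1) b := by
      have h2 : mapCoeff (ρ' t⁻¹ - 1) b = mapCoeff (ρ' t⁻¹) b - b := by
        ext1 x; simp
      rw [h2]
      cases q with
      | zero => exact bd_shuffle_zero ρ' t b
      | succ q =>
        rw [bd_shuffle_succ, show bd ρ' q b = 0 from isCycle_of_mem_prodSpan ρ' he hb, map_zero,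
          sub_zero]
    -- with `w = b + ∂u`, subtracting `[t] × b` and `(t⁻¹ - 1) u` turns the lift into a cycle
    obtain ⟨c, hc, y, hy⟩ := key (z' - shuffle t q b - mapCoeff (ρ' t⁻¹ - 1) u) (by
      change bd ρ' q _ = 0
      rw [map_sub, map_sub, ← mapCoeff_bd _ hτ, hbt, ← hw, map_add]
      abel)
    have h3 : mapCoeff φ (mapCoeff (ρ' t⁻¹ - 1) u) = 0 := by
      ext1 x
      simp [ht]
    refine ⟨c + shuffle t q (mapCoeff φ b),
      add_mem hc (shuffle_mem_prodSpan_cons t (mapCoeff_mem_prodSpan φ hb)), y, ?_⟩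
    rw [map_sub, map_sub, h3, mapCoeff_shuffle, sub_zero, sub_eq_iff_eq_add] at hy
    rw [hy]
    abel

/-- The permutation module `ℤ[X]` of a `G`-set `X`. -/
noncomputable def permRep (G X : Type) [CommGroup G] [MulAction G X] :
    Representation ℤ G (X →₀ ℤ) where
  toFun g := Finsupp.lmapDomain ℤ ℤ (g • ·)
  map_one' := by ext; simp
  map_mul' g h := by ext; simp [mul_smul]

theorem permRep_single {X : Type} [MulAction G X] (g : G) (x : X) (m : ℤ) :
    permRep G X g (Finsupp.single x m) = Finsupp.single (g • x) m :=
  Finsupp.mapDomain_single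

theorem permRep_apply {X : Type} [MulAction G X] (g : G) (f : X →₀ ℤ) (x : X) :
    permRep G X g f x = f (g⁻¹ • x) := by
  conv_lhs => rw [← smul_inv_smul g x]
  exact Finsupp.mapDomain_apply (MulAction.injective g) f _

section Cone

variable {X : Type} (c : X → G)

/-- The contraction of the bar complex with coefficients in `ℤ[X]`, where `X` is a principal
homogeneous space and `c x` carries the base point to `x`. -/
noncomputable def cone (x₀ : X) : Chain G (X →₀ ℤ) q →ₗ[ℤ] Chain G (X →₀ ℤ) (q + 1) :=
  Finsupp.lsum ℤ fun w => Finsupp.lsum ℤ fun y =>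
    consChain (c y)⁻¹ ∘ₗ Finsupp.lsingle w ∘ₗ Finsupp.lsingle x₀

theorem cone_mapCoeff (x₀ y : X) (b : Chain G ℤ q) :
    cone c x₀ (mapCoeff (Finsupp.lsingle y) b) =
      consChain (c y)⁻¹ (mapCoeff (Finsupp.lsingle x₀) b) := by
  induction b using Finsupp.induction_linear with
  | zero => simp
  | add c₁ c₂ h₁ h₂ => simp only [map_add, h₁, h₂]
  | single w v =>
    rw [mapCoeff_single, mapCoeff_single]
    simp only [cone, Finsupp.lsum_single, Finsupp.lsingle_apply, LinearMap.comp_apply]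

variable [MulAction G X]

theorem permRep_comp_lsingle (g : G) (y : X) (b : Chain G ℤ q) :
    mapCoeff (permRep G X g) (mapCoeff (Finsupp.lsingle y) b) =
      mapCoeff (Finsupp.lsingle (g • y)) b := by
  induction b using Finsupp.induction_linear with
  | zero => simp
  | add c₁ c₂ h₁ h₂ => simp only [map_add, h₁, h₂]
  | single w v => simp only [mapCoeff_single, Finsupp.lsingle_apply,
      permRep_single]

/-- The homology with coefficients in a free module of rank one vanishes in positive degrees. -/
theorem isGenerated_free (x₀ : X) (hc : ∀ (g : G) x, c (g • x) = g * c x) (hx : ∀ x, c x • x₀ = x)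
    (e : Fin 0 → G) :
    IsGenerated (permRep G X) (Finsupp.single x₀ (1 : ℤ)) e := by
  intro q z hz
  cases q with
  | zero =>
    let ε : (X →₀ ℤ) →ₗ[ℤ] ℤ := Finsupp.lsum ℤ fun _ => LinearMap.id
    have h : bd (permRep G X) 0 ∘ₗ cone c x₀ =
        LinearMap.id - mapCoeff (Finsupp.lsingle x₀ ∘ₗ ε) := by
      refine chain_free_hom_ext fun y b => ?_
      have h1 : mapCoeff (Finsupp.lsingle x₀ ∘ₗ ε) (mapCoeff (Finsupp.lsingle y) b) =
          mapCoeff (Finsupp.lsingle x₀) b := by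
        rw [← LinearMap.comp_apply, ← Finsupp.mapRange.linearMap_comp]
        congr 2
        ext; simp [ε]
      rw [LinearMap.comp_apply, cone_mapCoeff, bd_consChain, inv_inv, permRep_comp_lsingle, hx,
        innerFace_zero, LinearMap.sub_apply, h1, LinearMap.id_apply, sub_eq_add_neg]
    refine ⟨mapCoeff (Finsupp.lsingle x₀ ∘ₗ ε) z, ?_, cone c x₀ z, ?_⟩
    · have h2 : mapCoeff (Finsupp.lsingle x₀ ∘ₗ ε) z =
          ε (z default) • shuffleProd (Finsupp.single x₀ (1 : ℤ)) 0
            (e ∘ (RelEmbedding.ofIsEmpty _ _ : Fin 0 ↪o Fin 0)) := by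
        refine Finsupp.ext fun w => ?_
        rw [Subsingleton.elim w default]
        simp [shuffleProd]
      rw [h2]
      exact Submodule.smul_mem _ _ (Submodule.subset_span ⟨_, rfl⟩)
    · have h2 := LinearMap.congr_fun h z
      rw [LinearMap.comp_apply, LinearMap.sub_apply, LinearMap.id_apply] at h2
      rw [h2]; abel
  | succ q =>
    have h : bd (permRep G X) (q + 1) ∘ₗ cone c x₀ =
        LinearMap.id - cone c x₀ ∘ₗ bd (permRep G X) q := by
      refine chain_free_hom_ext fun y b => ?_
      suffices h' : bd (permRep G X) (q + 1) ∘ₗ cone c x₀ ∘ₗ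
          mapCoeff (Finsupp.lsingle y) = (LinearMap.id - cone c x₀ ∘ₗ
          bd (permRep G X) q) ∘ₗ mapCoeff (Finsupp.lsingle y) from
        LinearMap.congr_fun h' b
      refine chain_hom_ext fun g b => ?_
      simp only [LinearMap.comp_apply, LinearMap.sub_apply, LinearMap.id_apply]
      rw [cone_mapCoeff, bd_consChain, inv_inv, permRep_comp_lsingle, hx, mapCoeff_consChain,
        mapCoeff_consChain, bd_consChain, innerFace_consChain, map_add, permRep_comp_lsingle,
        cone_mapCoeff, hc, ← mapCoeff_innerFace (Finsupp.lsingle y), cone_mapCoeff,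
        mapCoeff_innerFace, mul_inv_rev, inv_inv]
      abel
    refine ⟨0, zero_mem _, cone c x₀ z, ?_⟩
    have h2 := LinearMap.congr_fun h z
    rw [LinearMap.comp_apply, LinearMap.sub_apply, LinearMap.id_apply, LinearMap.comp_apply,
      show bd (permRep G X) q z = 0 from hz, map_zero, sub_zero] at h2
    rw [h2, zero_add]

end Cone

theorem smul_mk {K : Subgroup G} (g x : G) : g • (x : G ⧸ K) = ((g * x : G) : G ⧸ K) := rfl

theorem exists_zpow_prod_of_mem_closure (e : Fin n → G) {x : G}
    (hx : x ∈ Subgroup.closure (Set.range e)) : ∃ m : Fin n → ℤ, x = ∏ i, e i ^ m i := by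
  induction hx using Subgroup.closure_induction with
  | mem x hx =>
    obtain ⟨i, rfl⟩ := hx
    refine ⟨Pi.single i 1, ?_⟩
    rw [Finset.prod_eq_single i (fun j _ hj => by simp [hj]) (by simp)]
    simp
  | one => exact ⟨0, by simp⟩
  | mul x y _ _ hx hy =>
    obtain ⟨a, rfl⟩ := hx
    obtain ⟨b, rfl⟩ := hy
    exact ⟨a + b, by simp [zpow_add, Finset.prod_mul_distrib]⟩
  | inv x _ hx =>
    obtain ⟨a, rfl⟩ := hx
    exact ⟨-a, by simp⟩

/-- The homology of a commutative group with coefficients in `ℤ[G/K]`, where `K` is free on `e`, is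
generated by the products of the basis elements. By Shapiro's lemma this is the homology of `K`. -/
theorem isGenerated_quotient (e : Fin n → G)
    (he : ∀ m : Fin n → ℤ, ∏ i, e i ^ m i = 1 → m = 0) :
    IsGenerated (permRep G (G ⧸ Subgroup.closure (Set.range e)))
      (Finsupp.single ((1 : G) : G ⧸ Subgroup.closure (Set.range e)) (1 : ℤ)) e := by
  induction n with
  | zero =>
    have hb : ∀ x ∈ Subgroup.closure (Set.range e), x = 1 := by
      intro x hx
      simpa using hx
    have h1 : ∀ x y : G, (x : G ⧸ Subgroup.closure (Set.range e)) = y → x = y := by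
      intro x y h
      exact (inv_mul_eq_one.1 (hb _ (QuotientGroup.eq.1 h)))
    refine isGenerated_free (X := G ⧸ Subgroup.closure (Set.range e)) Quotient.out _
      (fun g x => h1 _ _ ?_) (fun x => ?_) e
    · rw [QuotientGroup.out_eq', ← smul_mk, QuotientGroup.out_eq']
    · obtain ⟨y, rfl⟩ := QuotientGroup.mk_surjective x
      rw [h1 _ y (QuotientGroup.out_eq' _), smul_mk, mul_one]
  | succ n ih =>
    obtain ⟨t, e, rfl⟩ : ∃ t e', e = Fin.cons t e' := ⟨e 0, Fin.tail e, by simp⟩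
    have hle : Subgroup.closure (Set.range e) ≤
        Subgroup.closure (Set.range (Fin.cons t e : Fin (n + 1) → G)) := by
      refine Subgroup.closure_mono ?_
      rintro _ ⟨i, rfl⟩
      exact ⟨i.succ, rfl⟩
    set K := Subgroup.closure (Set.range (Fin.cons t e : Fin (n + 1) → G)) with hK
    set K' := Subgroup.closure (Set.range e) with hK'
    have hfree : ∀ m : ℤ, t ^ m ∈ K' → m = 0 := by
      intro m hm
      obtain ⟨a, ha⟩ := exists_zpow_prod_of_mem_closure e hm
      have h := congrFun (he (Fin.cons (-m) a) (by simp [Fin.prod_univ_succ, ← ha])) 0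
      simpa using h
    let p : G ⧸ K' → G ⧸ K := Subgroup.quotientMapOfLE hle
    have hp : ∀ x : G, p x = (x : G ⧸ K) := fun x => rfl
    have hv : Finsupp.single ((1 : G) : G ⧸ K) (1 : ℤ) =
        Finsupp.lmapDomain ℤ ℤ p (Finsupp.single ((1 : G) : G ⧸ K') 1) := by
      rw [Finsupp.lmapDomain_apply, Finsupp.mapDomain_single, hp]
    rw [hv]
    have hone : ∀ g ∈ K', ((g : G) : G ⧸ K') = (1 : G) := fun g hg =>
      QuotientGroup.eq.2 (by simpa using hg)
    refine IsGenerated.cons (ih e fun m hm => ?_) (fun i => ?_) _ (fun g x => ?_) ?_ t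
      (fun x => ?_) (fun x hx => ?_) (fun x hx => ?_)
    · have h := he (Fin.cons 0 m) (by simp [Fin.prod_univ_succ, hm])
      funext i
      simpa using congrFun h i.succ
    · rw [permRep_single, smul_mk, mul_one,
        hone _ (inv_mem (Subgroup.subset_closure ⟨i, rfl⟩))]
    · induction x using Finsupp.induction_linear with
      | zero => simp
      | add x y hx hy => simp only [map_add, hx, hy]
      | single x m =>
        obtain ⟨x, rfl⟩ := QuotientGroup.mk_surjective x
        rw [Finsupp.lmapDomain_apply, Finsupp.lmapDomain_apply, Finsupp.mapDomain_single,
          permRep_single, permRep_single,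
          Finsupp.mapDomain_single]
        rfl
    · refine Finsupp.mapDomain_surjective fun y => ?_
      obtain ⟨x, rfl⟩ := QuotientGroup.mk_surjective y
      exact ⟨x, rfl⟩
    · induction x using Finsupp.induction_linear with
      | zero => simp
      | add x y hx hy => simp only [map_add, hx, hy]
      | single x m =>
        obtain ⟨x, rfl⟩ := QuotientGroup.mk_surjective x
        rw [Finsupp.lmapDomain_apply, Finsupp.lmapDomain_apply, permRep_single,
          Finsupp.mapDomain_single, Finsupp.mapDomain_single, smul_mk, hp, hp]
        congr 1
        refine QuotientGroup.eq.2 ?_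
        rw [mul_inv_rev, inv_inv, mul_comm, ← mul_assoc, mul_inv_cancel, one_mul]
        exact Subgroup.subset_closure ⟨0, rfl⟩
    · -- modulo the range of `t⁻¹ - 1` the points of an orbit of `⟨t⟩` are identified
      have hpow : ∀ (m : ℤ) (x : G ⧸ K'), Finsupp.single (t ^ m • x) (1 : ℤ) - Finsupp.single x 1 ∈
          LinearMap.range (permRep G (G ⧸ K') t⁻¹ - 1) := by
        have hstep : ∀ x : G ⧸ K', Finsupp.single (t⁻¹ • x) (1 : ℤ) - Finsupp.single x 1 ∈
            LinearMap.range (permRep G (G ⧸ K') t⁻¹ - 1) := fun x =>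
          ⟨Finsupp.single x 1, by
            rw [LinearMap.sub_apply, permRep_single, Module.End.one_apply]⟩
        intro m x
        induction m using Int.induction_on with
        | zero => simp
        | succ i hi =>
          have h := hstep (t ^ ((i : ℤ) + 1) • x)
          rw [smul_smul, zpow_add_one, mul_comm (t ^ (i : ℤ)), inv_mul_cancel_left] at h
          rw [zpow_add_one, mul_comm (t ^ (i : ℤ))]
          simpa using sub_mem hi h
        | pred i hi =>
          have h := hstep (t ^ (-(i : ℤ)) • x)
          rw [smul_smul] at h
          rw [zpow_sub_one, mul_comm (t ^ (-(i : ℤ)))]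
          simpa using add_mem h hi
      refine Submodule.span_le.2 ?_ (mem_span_of_mapDomain_eq_zero p x hx)
      rintro _ ⟨x, y, hxy, rfl⟩
      obtain ⟨x, rfl⟩ := QuotientGroup.mk_surjective x
      obtain ⟨y, rfl⟩ := QuotientGroup.mk_surjective y
      obtain ⟨a, ha⟩ := exists_zpow_prod_of_mem_closure _
        ((QuotientGroup.eq (s := K)).1 (show (y : G ⧸ K) = x from hxy.symm))
      rw [Fin.prod_univ_succ] at ha
      simp only [Fin.cons_zero, Fin.cons_succ] at ha
      have h1 : (x : G ⧸ K') = t ^ a 0 • (y : G ⧸ K') := by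
        rw [smul_mk]
        refine (QuotientGroup.eq.2 ?_).symm
        have h2 : (t ^ a 0 * y)⁻¹ * x = ∏ i, e i ^ a i.succ := by
          rw [mul_inv_rev, mul_right_comm, ha, mul_comm (t ^ a 0), mul_inv_cancel_right]
        rw [h2]
        exact Subgroup.prod_mem _ fun i _ =>
          Subgroup.zpow_mem K' (Subgroup.subset_closure ⟨i, rfl⟩) _
      rw [h1]
      exact hpow _ _
    · -- a finitely supported function invariant under a free action of `⟨t⟩` vanishes
      by_contra hne
      obtain ⟨y, hy⟩ := Finsupp.ne_iff.1 hne
      have h1 : ∀ y, x (t • y) = x y := by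
        intro y
        have h2 := DFunLike.congr_fun hx y
        rwa [permRep_apply, inv_inv] at h2
      have h2 : ∀ m : ℕ, x (t ^ m • y) ≠ 0 := by
        intro m
        induction m with
        | zero => simpa using hy
        | succ m ihm => rw [pow_succ', mul_smul, h1]; exact ihm
      refine Set.infinite_univ (α := ℕ) (Set.Finite.subset (Set.Finite.preimage (f := fun m : ℕ =>
        t ^ m • y) (fun a _ b _ hab => ?_) x.hasFiniteSupport) fun m _ => h2 m)
      obtain ⟨y, rfl⟩ := QuotientGroup.mk_surjective y
      simp only [smul_mk] at hab
      have h3 : (t ^ a * y)⁻¹ * (t ^ b * y) ∈ K' := QuotientGroup.eq.1 hab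
      have h4 := hfree ((b : ℤ) - a) (by
        rw [zpow_sub, zpow_natCast, zpow_natCast]
        convert h3 using 1
        rw [mul_inv, mul_mul_mul_comm, inv_mul_cancel, mul_one, mul_comm])
      omega

end Generation

/-! ### Cycles with coefficients in the span of an orbit -/

section DirectLimit

variable {G : Type} [CommGroup G] {V : Type} [AddCommGroup V] {q : ℕ}

/-- Finitely many elements of a subgroup `K` of a torsion-free commutative group lie in a free
subgroup of `K` of finite rank. -/
theorem exists_independent [IsMulTorsionFree G] (K : Subgroup G) {T : Set G} (hT : T.Finite)
    (hTK : T ⊆ K) : ∃ (n : ℕ) (e : Fin n → G), (∀ i, e i ∈ K) ∧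
      (∀ m : Fin n → ℤ, ∏ i, e i ^ m i = 1 → m = 0) ∧
      T ⊆ Subgroup.closure (Set.range e) := by
  let N : Submodule ℤ (Additive G) := Submodule.span ℤ (Additive.ofMul '' T)
  have hNK : N ≤ AddSubgroup.toIntSubmodule (Subgroup.toAddSubgroup K) := by
    refine Submodule.span_le.2 ?_
    rintro _ ⟨x, hx, rfl⟩
    exact hTK hx
  have _ : Module.Finite ℤ N := Module.Finite.span_of_finite ℤ (hT.image _)
  let b := Module.finBasis ℤ N
  refine ⟨_, fun i => ((b i : N) : Additive G).toMul, fun i => hNK (b i).2, fun m hm => ?_,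
    fun x hx => ?_⟩
  · have h1 : ∑ i, m i • b i = 0 := by
      refine Subtype.ext ?_
      rw [Submodule.coe_sum, Submodule.coe_zero]
      exact congrArg Additive.ofMul hm
    funext i
    exact Fintype.linearIndependent_iff.1 b.linearIndependent m h1 i
  · have hxN : Additive.ofMul x ∈ N := Submodule.subset_span ⟨x, hx, rfl⟩
    have h1 := congrArg (fun y : N => ((y : N) : Additive G).toMul) (b.sum_repr ⟨_, hxN⟩)
    simp only [Submodule.coe_sum] at h1
    change _ = x at h1
    rw [← h1]
    change ∏ i, ((b i : N) : Additive G).toMul ^ (b.repr ⟨_, hxN⟩ i) ∈ _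
    exact Subgroup.prod_mem _ fun i _ => Subgroup.zpow_mem _
      (Subgroup.subset_closure (Set.mem_range_self i)) _

/-- An element of `ℤ[G]` which vanishes in `ℤ[G/K]` vanishes in `ℤ[G/F]` for every subgroup `F`
which contains a certain finite subset of `K`. -/
theorem exists_finite_of_mapDomain_eq_zero (K : Subgroup G) (f : G →₀ ℤ)
    (hf : Finsupp.lmapDomain ℤ ℤ (QuotientGroup.mk : G → G ⧸ K) f = 0) :
    ∃ T : Set G, T.Finite ∧ T ⊆ K ∧ ∀ F : Subgroup G, T ⊆ F →
      Finsupp.lmapDomain ℤ ℤ (QuotientGroup.mk : G → G ⧸ F) f = 0 := by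
  have h := mem_span_of_mapDomain_eq_zero _ f hf
  induction h using Submodule.span_induction with
  | mem x hx =>
    obtain ⟨x, y, hxy, rfl⟩ := hx
    refine ⟨{x⁻¹ * y}, Set.finite_singleton _, by simpa using QuotientGroup.eq.1 hxy,
      fun F hF => ?_⟩
    rw [map_sub, sub_eq_zero, Finsupp.lmapDomain_apply, Finsupp.lmapDomain_apply,
      Finsupp.mapDomain_single, Finsupp.mapDomain_single,
      QuotientGroup.eq.2 (Set.singleton_subset_iff.1 hF)]
  | zero => exact ⟨∅, Set.finite_empty, Set.empty_subset _, fun F _ => map_zero _⟩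
  | add x y hx hy ihx ihy =>
    have hker : ∀ z ∈ Submodule.span ℤ {y : G →₀ ℤ | ∃ x x' : G,
        (x : G ⧸ K) = x' ∧ y = Finsupp.single x (1 : ℤ) - Finsupp.single x' 1},
        Finsupp.lmapDomain ℤ ℤ (QuotientGroup.mk : G → G ⧸ K) z = 0 := by
      intro z hz
      change z ∈ LinearMap.ker _
      refine Submodule.span_le.2 ?_ hz
      rintro _ ⟨x, y, hxy, rfl⟩
      rw [SetLike.mem_coe, LinearMap.mem_ker, map_sub, sub_eq_zero, Finsupp.lmapDomain_apply,
        Finsupp.lmapDomain_apply, Finsupp.mapDomain_single, Finsupp.mapDomain_single, hxy]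
    obtain ⟨T₁, h1, h1', h1''⟩ := ihx (hker _ hx)
    obtain ⟨T₂, h2, h2', h2''⟩ := ihy (hker _ hy)
    refine ⟨T₁ ∪ T₂, h1.union h2, Set.union_subset h1' h2', fun F hF => ?_⟩
    rw [map_add, h1'' F (Set.subset_union_left.trans hF),
      h2'' F (Set.subset_union_right.trans hF), add_zero]
  | smul a x hx ih =>
    by_cases ha : a = 0
    · subst ha
      exact ⟨∅, Set.finite_empty, Set.empty_subset _, fun F _ => by rw [zero_smul, map_zero]⟩
    · rw [map_zsmul] at hf
      obtain ⟨T, h1, h2, h3⟩ := ih ((smul_eq_zero.1 hf).resolve_left ha)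
      exact ⟨T, h1, h2, fun F hF => by rw [map_zsmul, h3 F hF, smul_zero]⟩

/-- The map `ℤ[G/F] → V`, `x ↦ x v`, for a vector `v` fixed by `F`. -/
noncomputable def orbitMap (ρ : Representation ℤ G V) (v : V) (F : Subgroup G) :
    (G ⧸ F →₀ ℤ) →ₗ[ℤ] V :=
  Finsupp.linearCombination ℤ fun x => ρ (Quotient.out x) v

theorem orbitMap_single {ρ : Representation ℤ G V} {v : V} {F : Subgroup G}
    (hF : ∀ g ∈ F, ρ g v = v) (g : G) (m : ℤ) :
    orbitMap ρ v F (Finsupp.single (g : G ⧸ F) m) = m • ρ g v := by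
  rw [orbitMap, Finsupp.linearCombination_single]
  congr 1
  have h : g⁻¹ * Quotient.out (g : G ⧸ F) ∈ F :=
    QuotientGroup.eq.1 (QuotientGroup.out_eq' _).symm
  rw [← mul_inv_cancel_left g (Quotient.out (g : G ⧸ F)), map_mul, Module.End.mul_apply, hF _ h]

/-- If the translates of `v` by `G/K` are linearly independent, then every cycle with coefficients
in their span is homologous to a combination of products of elements of `K` with coefficient `v`.
It lifts to a cycle with coefficients in `ℤ[G/F]` for some `F ≤ K` free of finite rank. -/
theorem exists_prodSpan_of_cycle [IsMulTorsionFree G] (ρ : Representation ℤ G V) (v : V)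
    (K : Subgroup G) (hfix : ∀ g ∈ K, ρ g v = v)
    (hindep : ∀ f : G →₀ ℤ, (Finsupp.linearCombination ℤ fun g => ρ g v) f = 0 →
      Finsupp.lmapDomain ℤ ℤ (QuotientGroup.mk : G → G ⧸ K) f = 0)
    (z : Chain G V q) (hz : IsCycle ρ q z)
    (hspan : ∀ w, z w ∈ Submodule.span ℤ (Set.range fun g => ρ g v)) :
    ∃ (n : ℕ) (e : Fin n → G), (∀ i, e i ∈ K) ∧
      (∀ m : Fin n → ℤ, ∏ i, e i ^ m i = 1 → m = 0) ∧
      ∃ c ∈ prodSpan v e q, ∃ u, z = c + bd ρ q u := by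
  obtain ⟨y, rfl⟩ := exists_mapCoeff_eq (Finsupp.linearCombination ℤ fun g => ρ g v) z
    fun w => by rw [Finsupp.range_linearCombination]; exact hspan w
  have hφ : ∀ g x, (Finsupp.linearCombination ℤ fun g => ρ g v) (permRep G G g x) =
      ρ g ((Finsupp.linearCombination ℤ fun g => ρ g v) x) := by
    intro g x
    induction x using Finsupp.induction_linear with
    | zero => simp
    | add x y hx hy => simp only [map_add, hx, hy]
    | single x m =>
      rw [permRep_single, Finsupp.linearCombination_single, Finsupp.linearCombination_single,
        smul_eq_mul, map_mul, map_zsmul, Module.End.mul_apply]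
  have hmk : ∀ (F : Subgroup G) (g : G) (x : G →₀ ℤ),
      Finsupp.lmapDomain ℤ ℤ (QuotientGroup.mk : G → G ⧸ F) (permRep G G g x) =
        permRep G (G ⧸ F) g (Finsupp.lmapDomain ℤ ℤ (QuotientGroup.mk : G → G ⧸ F) x) := by
    intro F g x
    induction x using Finsupp.induction_linear with
    | zero => simp
    | add x y hx hy => simp only [map_add, hx, hy]
    | single x m =>
      rw [permRep_single, Finsupp.lmapDomain_apply, Finsupp.lmapDomain_apply,
        Finsupp.mapDomain_single, Finsupp.mapDomain_single, permRep_single]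
      rfl
  -- the boundary of the lift `y` vanishes in `ℤ[G/F]` if `F` contains a certain finite set
  obtain ⟨T, hT, hTK, hTF⟩ : ∃ T : Set G, T.Finite ∧ T ⊆ K ∧ ∀ F : Subgroup G, T ⊆ F →
      IsCycle (permRep G (G ⧸ F)) q
        (mapCoeff (Finsupp.lmapDomain ℤ ℤ (QuotientGroup.mk : G → G ⧸ F)) y) := by
    cases q with
    | zero => exact ⟨∅, Set.finite_empty, Set.empty_subset _, fun _ _ => trivial⟩
    | succ q =>
      have h1 : mapCoeff (Finsupp.linearCombination ℤ fun g => ρ g v) (bd (permRep G G) q y) =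
          0 := by
        rw [mapCoeff_bd _ hφ]; exact hz
      have h2 := fun w => exists_finite_of_mapDomain_eq_zero K (bd (permRep G G) q y w)
        (hindep _ (by simpa using DFunLike.congr_fun h1 w))
      choose T h3 h4 h5 using h2
      refine ⟨⋃ w ∈ (bd (permRep G G) q y).support, T w,
        Set.Finite.biUnion (Finset.finite_toSet _) fun w _ => h3 w,
        Set.iUnion₂_subset fun w _ => h4 w, fun F hF => ?_⟩
      change bd _ q _ = 0
      rw [← mapCoeff_bd _ (hmk F)]
      ext1 w
      rw [Finsupp.mapRange.linearMap_apply, Finsupp.mapRange_apply, Finsupp.zero_apply]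
      by_cases hw : w ∈ (bd (permRep G G) q y).support
      · exact h5 w F ((Set.subset_biUnion_of_mem (u := T)
          (Finset.mem_coe.2 hw)).trans hF)
      · rw [Finsupp.notMem_support_iff.1 hw, map_zero]
  obtain ⟨n, e, heK, he, hTe⟩ := exists_independent K hT hTK
  have hFK : Subgroup.closure (Set.range e) ≤ K := by
    rw [Subgroup.closure_le]
    rintro _ ⟨i, rfl⟩
    exact heK i
  obtain ⟨c, hc, u, hu⟩ := isGenerated_quotient e he q _ (hTF _ hTe)
  have hfix' : ∀ g ∈ Subgroup.closure (Set.range e), ρ g v = v := fun g hg => hfix g (hFK hg)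
  let Φ := orbitMap ρ v (Subgroup.closure (Set.range e))
  have hΦ : ∀ g x, Φ (permRep G _ g x) = ρ g (Φ x) := by
    intro g x
    induction x using Finsupp.induction_linear with
    | zero => simp
    | add x y hx hy => simp only [map_add, hx, hy]
    | single x m =>
      obtain ⟨x, rfl⟩ := QuotientGroup.mk_surjective x
      rw [permRep_single, smul_mk, orbitMap_single hfix', orbitMap_single hfix', map_mul,
        map_zsmul, Module.End.mul_apply]
  have hv : Φ (Finsupp.single ((1 : G) : G ⧸ Subgroup.closure (Set.range e)) 1) = v := by
    rw [orbitMap_single hfix', map_one, one_smul, Module.End.one_apply]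
  refine ⟨n, e, heK, he, mapCoeff Φ c, ?_, mapCoeff Φ u, ?_⟩
  · have h := mapCoeff_mem_prodSpan Φ hc
    rwa [hv] at h
  · have h := congrArg (mapCoeff Φ) hu
    rw [map_add, mapCoeff_bd Φ hΦ] at h
    rw [← h, ← LinearMap.comp_apply (mapCoeff Φ), ← Finsupp.mapRange.linearMap_comp]
    congr 2
    refine Finsupp.lhom_ext fun g m => ?_
    rw [LinearMap.comp_apply, Finsupp.lmapDomain_apply, Finsupp.mapDomain_single,
      orbitMap_single hfix', Finsupp.linearCombination_single]

end DirectLimit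

/-! ### Subgroups of the limit and constructible subgroups -/

section Lattice

variable {S : Type} [Monoid S] [IsCancelMul S] [IsReversible S]
variable {X Y : Type} [AddCommGroup X] [DistribMulAction S X] [AddCommGroup Y]
  [DistribMulAction S Y]

/-- The canonical homomorphism from the copy of `X` at `s` to the limit. -/
noncomputable def toLimitHom (X : Type) [AddCommGroup X] [DistribMulAction S X] (s : S) :
    X →+ Limit S X :=
  AddMonoidHom.mk' (toLimit s) fun _ _ => (OreLocalization.add_oreDiv).symm

theorem toLimit_add (s : S) (x y : X) : toLimit s (x + y) = toLimit s x + toLimit s y :=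
  map_add (toLimitHom X s) x y

theorem toLimit_sub (s : S) (x y : X) : toLimit s (x - y) = toLimit s x - toLimit s y :=
  map_sub (toLimitHom X s) x y

theorem toLimit_zero (s : S) : toLimit s (0 : X) = 0 :=
  map_zero (toLimitHom X s)

theorem exists_toLimit (x : Limit S X) : ∃ (s : S) (y : X), x = toLimit s y := by
  induction x using OreLocalization.ind with
  | _ y s => exact ⟨s, y, rfl⟩

theorem toLimit_mul_smul (u s : S) (x : X) : toLimit (u * s) (u • x) = toLimit s x :=
  (toLimit_eq_iff _ _ _ _).2 ⟨1, u, by rw [one_mul], by rw [one_smul]⟩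

theorem toLimit_one_eq (s : S) (x : X) : toLimit (1 : S) x = toLimit s (s • x) := by
  rw [← toLimit_mul_smul s 1 x, mul_one]

theorem toLimit_injective (hX : ∀ s : S, Function.Injective fun x : X => s • x) (s : S) :
    Function.Injective (toLimit s : X → Limit S X) := by
  intro x y h
  obtain ⟨u, v, h1, h2⟩ := (toLimit_eq_iff _ _ _ _).1 h
  obtain rfl := mul_right_cancel h1
  exact hX u h2

theorem numeratorHom_smul_toLimit (s : S) (x : X) :
    (OreLocalization.numeratorHom s : FractionGroup S) • toLimit (1 : S) x =
      toLimit (1 : S) (s • x) := by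
  rw [OreLocalization.numeratorHom_apply]
  exact OreLocalization.smul_div_one

/-- The subgroup `s X` of the limit. -/
noncomputable def lattice (X : Type) [AddCommGroup X] [DistribMulAction S X] (s : S) :
    AddSubgroup (Limit S X) :=
  ((toLimitHom X 1).comp (DistribSMul.toAddMonoidHom X s)).range

theorem mem_lattice {s : S} {x : Limit S X} :
    x ∈ lattice X s ↔ ∃ y : X, toLimit (1 : S) (s • y) = x := Iff.rfl

theorem lattice_mul_le (s t : S) : lattice X (s * t) ≤ lattice X s := by
  rintro _ ⟨y, rfl⟩
  exact ⟨t • y, congrArg (toLimit (1 : S)) (mul_smul s t y).symm⟩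

theorem mem_lattice_one {x : Limit S X} : x ∈ lattice X (1 : S) ↔ ∃ y, toLimit (1 : S) y = x := by
  simp only [mem_lattice, one_smul]

theorem smul_mem_lattice_iff (s t : S) (x : Limit S X) :
    (OreLocalization.numeratorHom s : FractionGroup S) • x ∈ lattice X (s * t) ↔
      x ∈ lattice X t := by
  constructor
  · rintro ⟨y, hy⟩
    refine ⟨y, ?_⟩
    change toLimit (1 : S) ((s * t) • y) = _ at hy
    rw [mul_smul, ← numeratorHom_smul_toLimit] at hy
    exact smul_left_cancel _ hy
  · rintro ⟨y, rfl⟩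
    refine ⟨y, ?_⟩
    change toLimit (1 : S) ((s * t) • y) = _ • toLimit (1 : S) (t • y)
    rw [numeratorHom_smul_toLimit, mul_smul]

end Lattice

section Constructible

variable {S A : Type} [Monoid S] [AddCommGroup A] [DistribMulAction S A]

/-- The subgroup `σ_s A` as a constructible subgroup. -/
def rangeSubgroup (A : Type) [AddCommGroup A] [DistribMulAction S A] (s : S) : constructible S A :=
  ⟨(endo A s).range, range_mem_constructible S A s⟩

theorem range_mul_le (s t : S) : (endo A (s * t)).range ≤ (endo A s).range := by
  rintro _ ⟨a, rfl⟩
  exact ⟨t • a, (mul_smul s t a).symm⟩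

/-- The subgroups `σ_s A` are cofinal among the constructible subgroups. -/
theorem exists_range_le [IsReversible S] {C : AddSubgroup A} (hC : C ∈ constructible S A) :
    ∃ r : S, (endo A r).range ≤ C := by
  have key : ∀ (s t : S) (C : AddSubgroup A), (∃ r : S, (endo A r).range ≤ C) →
      ∃ r : S, (endo A r).range ≤ (C.map (endo A t)).comap (endo A s) := by
    rintro s t C ⟨r, hr⟩
    obtain ⟨x, y, hxy⟩ := IsReversible.left s (t * r)
    refine ⟨x, ?_⟩
    rintro _ ⟨a, rfl⟩
    refine ⟨r • y • a, hr ⟨y • a, rfl⟩, ?_⟩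
    change t • r • y • a = s • x • a
    rw [smul_smul, smul_smul, smul_smul, ← hxy]
  induction hC with
  | base s t => exact key s t ⊤ ⟨1, le_top⟩
  | step s t C _ ih => exact key s t C ih

/-- The image `σ_s C` as a constructible subgroup. -/
def pushforward (s : S) (C : constructible S A) : constructible S A :=
  ⟨(C : AddSubgroup A).map (endo A s), by
    have h := IsConstructible.step (S := S) (A := A) 1 s C.1 C.2
    have h1 : ((C : AddSubgroup A).map (endo A s)).comap (endo A (1 : S)) =
        (C : AddSubgroup A).map (endo A s) := by
      ext x
      simp
    rwa [h1] at h⟩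

theorem completion_smul_injective (hinj : ∀ s : S, Function.Injective fun a : A => s • a) (s : S) :
    Function.Injective fun x : completion S A => s • x := by
  suffices h : ∀ x : completion S A, s • x = 0 → x = 0 by
    intro x y hxy
    refine sub_eq_zero.1 (h _ ?_)
    rw [smul_sub, sub_eq_zero]
    exact hxy
  intro x hx
  refine Subtype.ext (funext fun C => ?_)
  obtain ⟨a, ha⟩ := QuotientAddGroup.mk_surjective (x.1 (pullback s (pushforward s C)))
  have h1 : ((pullback s (pushforward s C) : constructible S A) : AddSubgroup A) ≤ C := by
    rintro y ⟨c, hc, hcy⟩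
    rwa [← hinj s hcy]
  rw [completion_rep x _ _ h1 a ha.symm]
  have h2 : (s • x).1 (pushforward s C) = 0 := by rw [hx]; rfl
  rw [completion_smul_apply, ← ha] at h2
  have h3 : s • a ∈ (pushforward s C : AddSubgroup A) := (QuotientAddGroup.eq_zero_iff _).1 h2
  exact (QuotientAddGroup.eq_zero_iff _).2 (h1 h3)

/-- The image of `σ_s` on the completion is the kernel of the projection to `A / σ_s A`. -/
theorem exists_smul_eq_iff (hinj : ∀ s : S, Function.Injective fun a : A => s • a) (s : S)
    (x : completion S A) : (∃ y, s • y = x) ↔ x.1 (rangeSubgroup A s) = 0 := by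
  constructor
  · rintro ⟨y, rfl⟩
    rw [completion_smul_apply]
    obtain ⟨a, ha⟩ := QuotientAddGroup.mk_surjective (y.1 (pullback s (rangeSubgroup A s)))
    rw [← ha]
    exact (QuotientAddGroup.eq_zero_iff _).2 ⟨a, rfl⟩
  · intro hx
    have hle : ∀ C : constructible S A,
        (pushforward s C : AddSubgroup A) ≤ rangeSubgroup A s := by
      rintro C _ ⟨c, _, rfl⟩
      exact ⟨c, rfl⟩
    have hrep : ∀ C : constructible S A, ∃ a : A,
        x.1 (pushforward s C) = ((s • a : A) : A ⧸ (pushforward s C : AddSubgroup A)) := by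
      intro C
      obtain ⟨b, hb⟩ := QuotientAddGroup.mk_surjective (x.1 (pushforward s C))
      have h1 := completion_rep x _ _ (hle C) b hb.symm
      rw [hx] at h1
      obtain ⟨a, rfl⟩ := (QuotientAddGroup.eq_zero_iff _).1 h1.symm
      exact ⟨a, hb.symm⟩
    choose a ha using hrep
    refine ⟨⟨fun C => (a C : A ⧸ (C : AddSubgroup A)), fun C D h => ?_⟩, ?_⟩
    · have h1 := completion_rep x _ (pushforward s D) (AddSubgroup.map_mono h) _ (ha C)
      rw [ha D] at h1
      obtain ⟨d, hd, hd'⟩ := QuotientAddGroup.eq.1 h1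
      have h2 : d = -a D + a C := hinj s (by
        change s • d = s • (-a D + a C)
        rw [smul_add, smul_neg]; exact hd')
      exact (QuotientAddGroup.eq.2 (h2 ▸ hd)).symm
    · refine Subtype.ext (funext fun C => ?_)
      rw [completion_smul_apply]
      have h1 : ((pushforward s (pullback s C) : constructible S A) : AddSubgroup A) ≤ C := by
        rintro _ ⟨c, hc, rfl⟩
        exact hc
      exact (completion_rep x _ _ h1 _ (ha (pullback s C))).symm

end Constructible

section Dense

variable {S A : Type} [Monoid S] [IsCancelMul S] [IsReversible S] [AddCommGroup A]
  [DistribMulAction S A]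

theorem incl_toLimit (s : S) (a : A) :
    incl S A (toLimit s a) = toLimit s (toCompletion S A a) := rfl

theorem incl_mem_lattice_iff (hinj : ∀ s : S, Function.Injective fun a : A => s • a) (s : S)
    (x : LimitGroup S A) : incl S A x ∈ lattice (completion S A) s ↔ x ∈ lattice A s := by
  constructor
  · rintro ⟨y, hy⟩
    obtain ⟨t, a, rfl⟩ := exists_toLimit x
    change toLimit (1 : S) (s • y) = toLimit t (toCompletion S A a) at hy
    rw [toLimit_one_eq t, smul_smul] at hy
    have h1 := toLimit_injective (completion_smul_injective hinj) t hy
    have h2 := (exists_smul_eq_iff hinj (t * s) _).1 ⟨y, h1⟩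
    obtain ⟨b, rfl⟩ := (QuotientAddGroup.eq_zero_iff a).1 h2
    refine ⟨b, ?_⟩
    change toLimit (1 : S) (s • b) = toLimit t ((t * s) • b)
    rw [toLimit_one_eq t, smul_smul]
  · rintro ⟨a, rfl⟩
    exact ⟨toCompletion S A a, rfl⟩

/-- `𝒜` is dense: it meets every coset of `s Ā`. -/
theorem exists_sub_incl_mem_lattice (hinj : ∀ s : S, Function.Injective fun a : A => s • a)
    (s : S) (x : LimitCompletion S A) :
    ∃ a : LimitGroup S A, x - incl S A a ∈ lattice (completion S A) s := by
  obtain ⟨t, y, rfl⟩ := exists_toLimit x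
  obtain ⟨a, ha⟩ := QuotientAddGroup.mk_surjective (y.1 (rangeSubgroup A (t * s)))
  obtain ⟨b, hb⟩ := (exists_smul_eq_iff hinj (t * s) (y - toCompletion S A a)).2 (by
    change y.1 _ - (a : A ⧸ _) = 0
    rw [← ha, sub_self])
  refine ⟨toLimit t a, b, ?_⟩
  change toLimit (1 : S) (s • b) = _
  rw [incl_toLimit, ← toLimit_sub, ← hb, toLimit_one_eq t, smul_smul]

end Dense

/-! ### Finiteness of the indices -/

section Index

variable {A : Type} [AddCommGroup A] [IsAddTorsionFree A]

theorem one_tmul_injective : Function.Injective (TensorProduct.mk ℤ ℚ A 1) := by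
  intro x y h
  obtain ⟨c, hc⟩ := (IsLocalizedModule.eq_iff_exists (nonZeroDivisors ℤ)
    (TensorProduct.mk ℤ ℚ A 1)).1 h
  exact smul_right_injective A (nonZeroDivisors.coe_ne_zero c) hc

omit [IsAddTorsionFree A] in
theorem linearIndependent_one_tmul {ι : Type*} {v : ι → A} (hv : LinearIndependent ℤ v) :
    LinearIndependent ℚ fun i => (1 : ℚ) ⊗ₜ[ℤ] v i :=
  hv.of_isLocalizedModule ℚ (nonZeroDivisors ℤ) (TensorProduct.mk ℤ ℚ A 1)

omit [IsAddTorsionFree A] in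
theorem rank_rat_tensor : Module.rank ℚ (ℚ ⊗[ℤ] A) = Module.rank ℤ A :=
  (TensorProduct.isBaseChange ℤ A ℚ).rank_eq

/-- An injective endomorphism of a torsion-free abelian group of finite rank divides a nonzero
integer, namely the lowest coefficient of an integral polynomial of which it is a root. -/
theorem exists_zsmul_mem_range (d : ℕ) (hrank : Module.rank ℤ A = d) (f : A →ₗ[ℤ] A)
    (hf : Function.Injective f) : ∃ c : ℤ, c ≠ 0 ∧ ∀ a, c • a ∈ LinearMap.range f := by
  classical
  have hfin : Module.Finite ℚ (ℚ ⊗[ℤ] A) := by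
    have h1 := (rank_rat_tensor (A := A)).trans hrank
    exact Module.rank_lt_aleph0_iff.1 (h1 ▸ Cardinal.natCast_lt_aleph0)
  -- a nonzero integral polynomial which annihilates `f` exists; one of least degree is chosen
  have hex : ∃ n : ℕ, ∃ p : Polynomial ℤ, p ≠ 0 ∧ Polynomial.aeval f p = 0 ∧ p.natDegree = n := by
    let m := minpoly ℚ (f.baseChange ℚ)
    obtain ⟨b, hb0, hb⟩ := IsLocalization.integerNormalization_spec (nonZeroDivisors ℤ) m
    let p := IsLocalization.integerNormalization (nonZeroDivisors ℤ) m
    have hm : m ≠ 0 := minpoly.ne_zero (Algebra.IsIntegral.isIntegral _)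
    have hp : p ≠ 0 := by
      intro h0
      rw [show IsLocalization.integerNormalization (nonZeroDivisors ℤ) m = 0 from h0,
        Polynomial.map_zero] at hb
      exact hm ((smul_eq_zero.1 hb.symm).resolve_left (nonZeroDivisors.ne_zero hb0))
    refine ⟨_, p, hp, ?_, rfl⟩
    have h1 : Polynomial.aeval (f.baseChange ℚ) p = 0 := by
      rw [← Polynomial.aeval_map_algebraMap ℚ, hb, map_zsmul, minpoly.aeval, smul_zero]
    have h2 : (Polynomial.aeval f p).baseChange ℚ = 0 := by
      rw [← h1]
      exact (Polynomial.aeval_algHom_apply (Module.End.baseChangeHom ℤ ℚ A) f p).symm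
    refine LinearMap.ext fun a => one_tmul_injective ?_
    have h3 := LinearMap.congr_fun h2 ((1 : ℚ) ⊗ₜ[ℤ] a)
    rw [LinearMap.baseChange_tmul] at h3
    simpa using h3
  obtain ⟨p, hp, hpf, hdeg⟩ := Nat.find_spec hex
  refine ⟨p.coeff 0, fun h0 => ?_, fun a => ?_⟩
  · -- otherwise `p` could be divided by `X`
    have h1 : p = Polynomial.X * p.divX := by
      conv_lhs => rw [← Polynomial.X_mul_divX_add p, h0, map_zero, add_zero]
    have h2 : Polynomial.aeval f p.divX = 0 := by
      refine LinearMap.ext fun a => hf ?_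
      have h3 := LinearMap.congr_fun hpf a
      rw [h1, map_mul, Polynomial.aeval_X] at h3
      simpa using h3
    have h3 : p.divX ≠ 0 := fun h => hp (by rw [h1, h, mul_zero])
    refine Nat.find_min hex (m := p.divX.natDegree) ?_ ⟨_, h3, h2, rfl⟩
    rw [← hdeg]
    conv_rhs => rw [h1, Polynomial.natDegree_X_mul h3]
    exact Nat.lt_succ_self _
  · have h1 := LinearMap.congr_fun hpf a
    rw [← Polynomial.X_mul_divX_add p, map_add, map_mul, Polynomial.aeval_X,
      Polynomial.aeval_C] at h1
    refine ⟨-(Polynomial.aeval f p.divX a), ?_⟩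
    rw [map_neg, neg_eq_iff_add_eq_zero]
    simpa using h1

/-- In a torsion-free abelian group of rank `d` there are at most `m ^ d` classes modulo `m`. -/
theorem finite_quotient_zsmul (d : ℕ) (hrank : Module.rank ℤ A = d) (m : ℕ) (hm : m ≠ 0) :
    Finite (A ⧸ (zsmulAddGroupHom (m : ℤ) : A →+ A).range) := by
  by_contra hinf
  rw [not_finite_iff_infinite] at hinf
  have _ : NeZero m := ⟨hm⟩
  obtain ⟨T, hT⟩ := Infinite.exists_subset_card_eq
    (A ⧸ (zsmulAddGroupHom (m : ℤ) : A →+ A).range) (m ^ d + 1)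
  -- representatives of `m ^ d + 1` classes generate a free group of rank at most `d`
  let N : Submodule ℤ A := Submodule.span ℤ
    ((fun t => Quotient.out t) '' (T : Set (A ⧸ (zsmulAddGroupHom (m : ℤ) : A →+ A).range)))
  have _ : Module.Finite ℤ N := Module.Finite.span_of_finite ℤ (T.finite_toSet.image _)
  let b := Module.finBasis ℤ N
  have hr : Module.finrank ℤ N ≤ d := by
    have h1 := Submodule.rank_le N
    rw [← Module.finrank_eq_rank, hrank] at h1
    exact_mod_cast h1
  have hmem : ∀ t ∈ T, Quotient.out t ∈ N := fun t ht => Submodule.subset_span ⟨t, ht, rfl⟩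
  let F : T → (Fin (Module.finrank ℤ N) → ZMod m) := fun t i =>
    ((b.repr ⟨_, hmem t t.2⟩ i : ℤ) : ZMod m)
  have hF : Function.Injective F := by
    intro t t' h
    have h1 : ∀ i, ∃ k : ℤ, b.repr ⟨_, hmem t' t'.2⟩ i - b.repr ⟨_, hmem t t.2⟩ i = m * k :=
      fun i => (ZMod.intCast_eq_intCast_iff_dvd_sub _ _ _).1 (congrFun h i)
    choose k hk using h1
    have h2 : (⟨_, hmem t' t'.2⟩ : N) - ⟨_, hmem t t.2⟩ = (m : ℤ) • ∑ i, k i • b i := by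
      rw [← b.sum_repr (⟨_, hmem t' t'.2⟩ : N), ← b.sum_repr (⟨_, hmem t t.2⟩ : N),
        ← Finset.sum_sub_distrib, Finset.smul_sum]
      refine Finset.sum_congr rfl fun i _ => ?_
      rw [← sub_smul, hk, mul_smul]
    refine Subtype.ext ?_
    rw [← QuotientAddGroup.out_eq' t.1, ← QuotientAddGroup.out_eq' t'.1]
    refine QuotientAddGroup.eq.2 ⟨((∑ i, k i • b i : N) : A), ?_⟩
    have h3 := congrArg (fun x : N => (x : A)) h2
    simp only [Submodule.coe_sub, Submodule.coe_smul] at h3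
    rw [neg_add_eq_sub, h3]
    rfl
  have h1 := Fintype.card_le_of_injective F hF
  rw [Fintype.card_coe, hT, Fintype.card_fun, ZMod.card, Fintype.card_fin] at h1
  have h2 := Nat.pow_le_pow_right (Nat.pos_of_ne_zero hm) hr
  omega

variable {S : Type} [Monoid S] [DistribMulAction S A]

theorem finiteIndex_range (d : ℕ) (hrank : Module.rank ℤ A = d)
    (hinj : ∀ s : S, Function.Injective fun a : A => s • a) (s : S) :
    (endo A s).range.FiniteIndex := by
  obtain ⟨c, hc, hcr⟩ := exists_zsmul_mem_range d hrank (endo A s).toIntLinearMap (hinj s)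
  have h1 := finite_quotient_zsmul (A := A) d hrank c.natAbs (Int.natAbs_ne_zero.2 hc)
  have h2 : (zsmulAddGroupHom (c.natAbs : ℤ) : A →+ A).range.FiniteIndex :=
    AddSubgroup.finiteIndex_of_finite_quotient
  refine AddSubgroup.finiteIndex_of_le (H := (zsmulAddGroupHom (c.natAbs : ℤ) : A →+ A).range) ?_
  rintro _ ⟨a, rfl⟩
  obtain ⟨b, hb⟩ := hcr a
  rcases Int.natAbs_eq c with h | h
  · refine ⟨b, hb.trans ?_⟩
    conv_lhs => rw [h]
    rfl
  · refine ⟨-b, ?_⟩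
    rw [map_neg]
    refine (congrArg Neg.neg hb).trans ?_
    conv_lhs => rw [h, neg_smul, neg_neg]
    rfl

theorem finite_quotient_constructible [IsReversible S] (d : ℕ) (hrank : Module.rank ℤ A = d)
    (hinj : ∀ s : S, Function.Injective fun a : A => s • a) {C : AddSubgroup A}
    (hC : C ∈ constructible S A) : Finite (A ⧸ C) := by
  obtain ⟨r, hr⟩ := exists_range_le hC
  have h1 := finiteIndex_range d hrank hinj r
  have h2 : C.FiniteIndex := AddSubgroup.finiteIndex_of_le hr
  infer_instance

end Index

/-- The index of `σ_s A` is multiplicative in `s`. -/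
theorem index_range_mul {S A : Type} [Monoid S] [AddCommGroup A] [DistribMulAction S A]
    (hinj : ∀ s : S, Function.Injective fun a : A => s • a) (s t : S) :
    (endo A (s * t)).range.index = (endo A s).range.index * (endo A t).range.index := by
  have h1 : (endo A (s * t)).range = (endo A t).range.map (endo A s) := by
    ext x
    constructor
    · rintro ⟨a, rfl⟩
      exact ⟨t • a, ⟨a, rfl⟩, (mul_smul s t a).symm⟩
    · rintro ⟨_, ⟨a, rfl⟩, rfl⟩
      exact ⟨a, mul_smul s t a⟩
  rw [h1, AddSubgroup.index_map, (AddMonoidHom.ker_eq_bot_iff _).2 (hinj s), sup_bot_eq, mul_comm]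

/-! ### The topology of the limit of the completions -/

section CompletionTopology

variable {S A : Type} [Monoid S] [AddCommGroup A] [DistribMulAction S A]

theorem nhds_completion (x : completion S A) :
    nhds x = ⨅ C : constructible S A, Filter.principal {y | y.1 C = x.1 C} := by
  rw [nhds_iInf]
  refine iInf_congr fun C => ?_
  let _ : TopologicalSpace (A ⧸ (C : AddSubgroup A)) := ⊥
  have _ : DiscreteTopology (A ⧸ (C : AddSubgroup A)) := ⟨rfl⟩
  rw [nhds_induced, nhds_discrete, ← Filter.principal_singleton, Filter.comap_principal]
  rfl

/-- An ultrafilter on the completion singles out a class in each finite quotient `A / C`. -/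
theorem isCompact_completion (hfin : ∀ C : constructible S A, Finite (A ⧸ (C : AddSubgroup A))) :
    IsCompact (Set.univ : Set (completion S A)) := by
  rw [isCompact_iff_ultrafilter_le_nhds]
  intro U _
  have h1 : ∀ C : constructible S A, ∃ a : A ⧸ (C : AddSubgroup A),
      ∀ᶠ y in (U : Filter (completion S A)), y.1 C = a := by
    intro C
    have h2 : (⋃ a : A ⧸ (C : AddSubgroup A), {y : completion S A | y.1 C = a}) ∈ U :=
      Filter.mem_of_superset Filter.univ_mem fun (y : completion S A) _ =>
        Set.mem_iUnion.2 ⟨y.1 C, rfl⟩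
    rw [← Set.biUnion_univ] at h2
    obtain ⟨a, _, ha⟩ := (Ultrafilter.finite_biUnion_mem_iff Set.finite_univ).1 h2
    exact ⟨a, ha⟩
  choose a ha using h1
  refine ⟨⟨a, fun C D h => ?_⟩, trivial, ?_⟩
  · obtain ⟨y, hy1, hy2⟩ := ((ha C).and (ha D)).exists
    rw [← hy1, ← hy2]
    exact y.2 C D h
  · rw [nhds_completion]
    exact le_iInf fun C => Filter.le_principal_iff.2 (ha C)

theorem smul_coord_eq_zero (s t : S) (y : completion S A) :
    ((s * t) • y).1 (rangeSubgroup A s) = 0 := by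
  rw [mul_smul, completion_smul_apply]
  obtain ⟨a, ha⟩ := QuotientAddGroup.mk_surjective ((t • y).1 (pullback s (rangeSubgroup A s)))
  rw [← ha]
  exact (QuotientAddGroup.eq_zero_iff _).2 ⟨a, rfl⟩

variable [IsReversible S]

/-- The fibres of the projections to the groups `A / σ_s A` form a basis of the topology. -/
theorem exists_fibre_subset_of_mem_nhds {x : completion S A} {U : Set (completion S A)}
    (hU : U ∈ nhds x) :
    ∃ s : S, ∀ y, y.1 (rangeSubgroup A s) = x.1 (rangeSubgroup A s) → y ∈ U := by
  rw [nhds_completion] at hU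
  have hdir : Directed (· ≥ ·) fun C : constructible S A =>
      Filter.principal {y : completion S A | y.1 C = x.1 C} := by
    intro C D
    obtain ⟨r, hr⟩ := exists_range_le C.2
    obtain ⟨t, ht⟩ := exists_range_le D.2
    obtain ⟨u, v, huv⟩ := IsReversible.left r t
    have key : ∀ E : constructible S A, (rangeSubgroup A (r * u) : AddSubgroup A) ≤ E →
        Filter.principal {y : completion S A |
          y.1 (rangeSubgroup A (r * u)) = x.1 (rangeSubgroup A (r * u))} ≤
        Filter.principal {y : completion S A | y.1 E = x.1 E} := by
      intro E hE
      refine Filter.principal_mono.2 fun y hy => ?_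
      change y.1 E = x.1 E
      rw [← y.2 _ E hE, ← x.2 _ E hE, show y.1 _ = x.1 _ from hy]
    refine ⟨rangeSubgroup A (r * u), key C ((range_mul_le r u).trans hr), key D ?_⟩
    rw [huv]
    exact (range_mul_le t v).trans ht
  have _ : Nonempty (constructible S A) := ⟨rangeSubgroup A 1⟩
  obtain ⟨C, hC⟩ := (Filter.mem_iInf_of_directed hdir U).1 hU
  obtain ⟨r, hr⟩ := exists_range_le C.2
  refine ⟨r, fun y hy => Filter.mem_principal.1 hC ?_⟩
  change y.1 C = x.1 C
  rw [← y.2 (rangeSubgroup A r) C hr, ← x.2 (rangeSubgroup A r) C hr, hy]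

/-- A locally constant function on the completion is invariant under some `s Ā`. -/
theorem exists_forall_add_smul_eq (hfin : ∀ C : constructible S A, Finite (A ⧸ (C : AddSubgroup A)))
    {f : completion S A → ℤ} (hf : Continuous f) :
    ∃ s : S, ∀ x y, f (x + s • y) = f x := by
  have h1 : ∀ x, ∃ s : S, ∀ y : completion S A,
      y.1 (rangeSubgroup A s) = x.1 (rangeSubgroup A s) → f y = f x := fun x =>
    exists_fibre_subset_of_mem_nhds (U := f ⁻¹' {f x})
      (hf.continuousAt.preimage_mem_nhds (by simp))
  choose s hs using h1
  obtain ⟨T, -, hT⟩ := (isCompact_completion hfin).elim_nhds_subcover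
    (fun x => {y | y.1 (rangeSubgroup A (s x)) = x.1 (rangeSubgroup A (s x))}) fun x _ => by
      rw [nhds_completion]
      exact Filter.mem_iInf_of_mem _ (Filter.mem_principal_self _)
  obtain ⟨r, hr⟩ : ∃ r : S, ∀ x ∈ T, ∃ u, s x * u = r := by
    clear hT
    induction T using Finset.cons_induction with
    | empty => exact ⟨1, by simp⟩
    | cons x T _ ih =>
      obtain ⟨r, hr⟩ := ih
      obtain ⟨u, v, huv⟩ := IsReversible.left (s x) r
      refine ⟨s x * u, fun y hy => ?_⟩
      rcases Finset.mem_cons.1 hy with rfl | hy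
      · exact ⟨u, rfl⟩
      · obtain ⟨w, rfl⟩ := hr y hy
        exact ⟨w * v, by rw [huv, mul_assoc]⟩
  refine ⟨r, fun x y => ?_⟩
  obtain ⟨z, hz, hxz⟩ := Set.mem_iUnion₂.1 (hT (Set.mem_univ x))
  obtain ⟨u, rfl⟩ := hr z hz
  rw [hs z x hxz, hs z]
  change x.1 _ + ((s z * u) • y).1 _ = _
  rw [smul_coord_eq_zero, add_zero]
  exact hxz

end CompletionTopology

section LimitTopology

variable {S A : Type} [Monoid S] [IsCancelMul S] [IsReversible S] [AddCommGroup A]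
  [DistribMulAction S A]

theorem isOpen_limit_iff {U : Set (LimitCompletion S A)} :
    IsOpen U ↔ ∀ s : S, IsOpen {x : completion S A | toLimit s x ∈ U} := by
  refine isOpen_iSup_iff.trans ⟨fun h s => ?_, fun h s => ?_⟩
  · exact isOpen_coinduced.1 (h ⟨s, trivial⟩)
  · exact isOpen_coinduced.2 (h s)

theorem continuous_toLimit (s : S) :
    Continuous (toLimit s : completion S A → LimitCompletion S A) :=
  continuous_oreDiv ⟨s, trivial⟩

theorem toLimit_mem_lattice_iff (hinj : ∀ s : S, Function.Injective fun a : A => s • a) (s t : S)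
    (x : completion S A) :
    toLimit t x ∈ lattice (completion S A) s ↔ x.1 (rangeSubgroup A (t * s)) = 0 := by
  rw [← exists_smul_eq_iff hinj, mem_lattice]
  refine exists_congr fun y => ?_
  rw [toLimit_one_eq t, smul_smul, (toLimit_injective (completion_smul_injective hinj) t).eq_iff]

theorem isClopen_lattice (hinj : ∀ s : S, Function.Injective fun a : A => s • a) (s : S) :
    IsClopen (lattice (completion S A) s : Set (LimitCompletion S A)) := by
  have h (t : S) := (isLocallyConstant_coord (rangeSubgroup A (t * s))).isClopen_fiber 0
  have h1 : ∀ t : S, {x : completion S A | toLimit t x ∈ lattice (completion S A) s} =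
      {x | x.1 (rangeSubgroup A (t * s)) = 0} := fun t =>
    Set.ext fun x => toLimit_mem_lattice_iff hinj s t x
  refine ⟨⟨isOpen_limit_iff.2 fun t => ?_⟩, isOpen_limit_iff.2 fun t => ?_⟩
  · change IsOpen {x : completion S A | toLimit t x ∈ lattice (completion S A) s}ᶜ
    rw [h1]
    exact (h t).compl.isOpen
  · change IsOpen {x : completion S A | toLimit t x ∈ lattice (completion S A) s}
    rw [h1]
    exact (h t).isOpen

theorem isCompact_lattice (hfin : ∀ C : constructible S A, Finite (A ⧸ (C : AddSubgroup A)))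
    (s : S) : IsCompact (lattice (completion S A) s : Set (LimitCompletion S A)) := by
  have h := (isCompact_completion hfin).image
    ((continuous_toLimit (1 : S)).comp (completion_continuous_smul s))
  rw [Set.image_univ] at h
  exact h

/-- The indicator function of `s Ā`. -/
noncomputable def latticeIndicator (hinj : ∀ s : S, Function.Injective fun a : A => s • a)
    (hfin : ∀ C : constructible S A, Finite (A ⧸ (C : AddSubgroup A))) (s : S) :
    C_c(LimitCompletion S A, ℤ) where
  toFun := (lattice (completion S A) s : Set (LimitCompletion S A)).indicator 1
  continuous_toFun := (isClopen_lattice hinj s).continuous_indicator continuous_const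
  hasCompactSupport' := HasCompactSupport.intro' (isCompact_lattice hfin s)
    (isClopen_lattice hinj s).isClosed fun _ hx => Set.indicator_of_notMem hx _

theorem isOpen_range_toLimit (hinj : ∀ s : S, Function.Injective fun a : A => s • a) (s : S) :
    IsOpen (Set.range (toLimit s : completion S A → LimitCompletion S A)) := by
  refine isOpen_limit_iff.2 fun t => ?_
  obtain ⟨u, v, huv⟩ := IsReversible.right t s
  have h1 : {x : completion S A | toLimit t x ∈ Set.range (toLimit s)} =
      (fun x => u • x) ⁻¹' {x | x.1 (rangeSubgroup A v) = 0} := by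
    ext x
    change (∃ y, toLimit s y = toLimit t x) ↔ (u • x).1 _ = 0
    rw [← exists_smul_eq_iff hinj]
    refine exists_congr fun y => ?_
    rw [← toLimit_mul_smul u t, ← toLimit_mul_smul v s, huv,
      (toLimit_injective (completion_smul_injective hinj) _).eq_iff]
  rw [h1]
  exact ((isLocallyConstant_coord _).isClopen_fiber 0).isOpen.preimage
    (completion_continuous_smul u)

/-- A compact subset of the limit lies in one of the copies of the completion. -/
theorem exists_subset_range_toLimit (hinj : ∀ s : S, Function.Injective fun a : A => s • a)
    {K : Set (LimitCompletion S A)} (hK : IsCompact K) :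
    ∃ s : S, K ⊆ Set.range (toLimit s) := by
  have _ : Nonempty S := ⟨1⟩
  refine hK.elim_directed_cover _ (isOpen_range_toLimit hinj) (fun x _ => ?_) ?_
  · obtain ⟨s, y, rfl⟩ := exists_toLimit x
    exact Set.mem_iUnion.2 ⟨s, y, rfl⟩
  · intro s t
    obtain ⟨u, v, huv⟩ := IsReversible.right s t
    refine ⟨u * s, ?_, ?_⟩
    · rintro _ ⟨x, rfl⟩
      exact ⟨u • x, toLimit_mul_smul u s x⟩
    · rintro _ ⟨x, rfl⟩
      exact ⟨v • x, by rw [huv]; exact toLimit_mul_smul v t x⟩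

/-- A compactly supported continuous function is invariant under some `s Ā`. -/
theorem exists_invariant (hinj : ∀ s : S, Function.Injective fun a : A => s • a)
    (hfin : ∀ C : constructible S A, Finite (A ⧸ (C : AddSubgroup A)))
    (f : C_c(LimitCompletion S A, ℤ)) :
    ∃ s : S, ∀ x, ∀ b ∈ lattice (completion S A) s, f (x + b) = f x := by
  obtain ⟨s, hs⟩ := exists_subset_range_toLimit hinj f.hasCompactSupport
  have hs' : ∀ x, x ∉ Set.range (toLimit s : completion S A → LimitCompletion S A) → f x = 0 :=
    fun x hx => image_eq_zero_of_notMem_tsupport fun h => hx (hs h)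
  obtain ⟨t, ht⟩ := exists_forall_add_smul_eq hfin
    (f := fun x : completion S A => f (toLimit s x)) (f.continuous.comp (continuous_toLimit s))
  obtain ⟨r, w, hrw⟩ := IsReversible.left s t
  refine ⟨r, ?_⟩
  rintro x _ ⟨y, rfl⟩
  change f (x + toLimit (1 : S) (r • y)) = f x
  rw [toLimit_one_eq s, smul_smul, hrw, mul_smul]
  by_cases hx : x ∈ Set.range (toLimit s : completion S A → LimitCompletion S A)
  · obtain ⟨x, rfl⟩ := hx
    rw [← toLimit_add]
    exact ht x _
  · rw [hs' x hx, hs' _]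
    rintro ⟨z, hz⟩
    exact hx ⟨z - t • w • y, by rw [toLimit_sub, hz, add_sub_cancel_right]⟩

/-- A compactly supported function vanishes on all but finitely many cosets of `s Ā`. -/
theorem exists_finite_cosets (hinj : ∀ s : S, Function.Injective fun a : A => s • a) (s : S)
    (f : C_c(LimitCompletion S A, ℤ)) :
    ∃ T : Finset (LimitCompletion S A), ∀ x, f x ≠ 0 →
      ∃ t ∈ T, -t + x ∈ lattice (completion S A) s := by
  obtain ⟨T, -, hT⟩ := f.hasCompactSupport.elim_nhds_subcover
    (fun t => {x | -t + x ∈ lattice (completion S A) s}) fun t _ => by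
      refine IsOpen.mem_nhds ((isClopen_lattice hinj s).isOpen.preimage
        (limit_continuous_add_left (-t))) ?_
      change -t + t ∈ lattice (completion S A) s
      rw [neg_add_cancel]
      exact zero_mem _
  refine ⟨T, fun x hx => ?_⟩
  obtain ⟨t, ht, h⟩ := Set.mem_iUnion₂.1 (hT (subset_tsupport _ hx))
  exact ⟨t, ht, h⟩

end LimitTopology

/-! ### Functions invariant under a lattice -/

section Translates

variable {S A : Type} [Monoid S] [IsCancelMul S] [IsReversible S] [AddCommGroup A]
  [DistribMulAction S A]

/-- The subgroup `s A` of `𝒜`, written multiplicatively. -/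
noncomputable abbrev latticeSubgroup (A : Type) [AddCommGroup A] [DistribMulAction S A] (s : S) :
    Subgroup (Multiplicative (LimitGroup S A)) :=
  AddSubgroup.toSubgroup (lattice A s)

variable (hinj : ∀ s : S, Function.Injective fun a : A => s • a)
  (hfin : ∀ C : constructible S A, Finite (A ⧸ (C : AddSubgroup A)))

theorem translationRep_apply (a : Multiplicative (LimitGroup S A))
    (f : C_c(LimitCompletion S A, ℤ)) (x : LimitCompletion S A) :
    translationRep S A a f x = f (-incl S A a.toAdd + x) := rfl

theorem latticeIndicator_of_mem {s : S} {x : LimitCompletion S A}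
    (hx : x ∈ lattice (completion S A) s) : latticeIndicator hinj hfin s x = 1 :=
  Set.indicator_of_mem (s := (lattice (completion S A) s : Set (LimitCompletion S A))) hx _

theorem latticeIndicator_of_notMem {s : S} {x : LimitCompletion S A}
    (hx : x ∉ lattice (completion S A) s) : latticeIndicator hinj hfin s x = 0 :=
  Set.indicator_of_notMem (s := (lattice (completion S A) s : Set (LimitCompletion S A))) hx _

theorem latticeIndicator_add {s : S} (x : LimitCompletion S A) {b : LimitCompletion S A}
    (hb : b ∈ lattice (completion S A) s) :
    latticeIndicator hinj hfin s (x + b) = latticeIndicator hinj hfin s x := by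
  by_cases hx : x ∈ lattice (completion S A) s
  · rw [latticeIndicator_of_mem _ _ hx, latticeIndicator_of_mem _ _ (add_mem hx hb)]
  · rw [latticeIndicator_of_notMem _ _ hx, latticeIndicator_of_notMem]
    rwa [AddSubgroup.add_mem_cancel_right _ hb]

theorem translationRep_latticeIndicator {s : S} {a : Multiplicative (LimitGroup S A)}
    (ha : a ∈ latticeSubgroup A s) :
    translationRep S A a (latticeIndicator hinj hfin s) = latticeIndicator hinj hfin s := by
  ext x
  rw [translationRep_apply, add_comm]
  exact latticeIndicator_add hinj hfin x (neg_mem ((incl_mem_lattice_iff hinj s _).2 ha))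

/-- On `𝒜`, the translate by `a` of the indicator function of `s Ā` is the indicator function of the
coset `a + s A`. -/
theorem translationRep_latticeIndicator_incl (s : S) (a : Multiplicative (LimitGroup S A))
    (x : LimitGroup S A) (m : ℤ) :
    m * translationRep S A a (latticeIndicator hinj hfin s) (incl S A x) =
      Finsupp.single (a : Multiplicative (LimitGroup S A) ⧸ latticeSubgroup A s) m
        (Multiplicative.ofAdd x : Multiplicative (LimitGroup S A)) := by
  classical
  have h1 : ((a : Multiplicative (LimitGroup S A) ⧸ latticeSubgroup A s) =
      (Multiplicative.ofAdd x : Multiplicative (LimitGroup S A))) ↔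
      -incl S A a.toAdd + incl S A x ∈ lattice (completion S A) s := by
    rw [← map_neg, ← map_add, incl_mem_lattice_iff hinj]
    exact QuotientGroup.eq
  rw [translationRep_apply, Finsupp.single_apply]
  by_cases h : -incl S A a.toAdd + incl S A x ∈ lattice (completion S A) s
  · rw [if_pos (h1.2 h), latticeIndicator_of_mem _ _ h, mul_one]
  · rw [if_neg (fun h2 => h (h1.1 h2)), latticeIndicator_of_notMem _ _ h, mul_zero]

/-- The translates of the indicator function of `s Ā` are linearly independent. -/
theorem mapDomain_eq_zero_of_linearCombination (s : S)
    (c : Multiplicative (LimitGroup S A) →₀ ℤ)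
    (hc : (Finsupp.linearCombination ℤ fun a =>
      translationRep S A a (latticeIndicator hinj hfin s)) c = 0) :
    Finsupp.lmapDomain ℤ ℤ (QuotientGroup.mk :
      Multiplicative (LimitGroup S A) → _ ⧸ latticeSubgroup A s) c = 0 := by
  have key : ∀ (c : Multiplicative (LimitGroup S A) →₀ ℤ) (x : LimitGroup S A),
      (Finsupp.linearCombination ℤ fun a =>
        translationRep S A a (latticeIndicator hinj hfin s)) c (incl S A x) =
      Finsupp.lmapDomain ℤ ℤ (QuotientGroup.mk :
        Multiplicative (LimitGroup S A) → _ ⧸ latticeSubgroup A s) c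
        (Multiplicative.ofAdd x : Multiplicative (LimitGroup S A)) := by
    intro c x
    induction c using Finsupp.induction_linear with
    | zero => simp
    | add c₁ c₂ h₁ h₂ =>
      rw [map_add, map_add, Finsupp.add_apply, ← h₁, ← h₂]
      rfl
    | single a m =>
      rw [Finsupp.linearCombination_single, Finsupp.lmapDomain_apply, Finsupp.mapDomain_single,
        ← translationRep_latticeIndicator_incl hinj hfin]
      rfl
  ext y
  obtain ⟨y, rfl⟩ := QuotientGroup.mk_surjective y
  rw [← ofAdd_toAdd y, ← key, hc]
  rfl

/-- The value of a function at a representative of a coset of `s A`. It does not depend on the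
choice if the function is invariant under `s Ā`. -/
noncomputable def cosetValue (s : S) (f : C_c(LimitCompletion S A, ℤ))
    (y : LimitGroup S A ⧸ lattice A s) : ℤ :=
  f (incl S A (Quotient.out y))

/-- The functions invariant under `s Ā`. -/
def IsInvariant (s : S) (f : C_c(LimitCompletion S A, ℤ)) : Prop :=
  ∀ x, ∀ b ∈ lattice (completion S A) s, f (x + b) = f x

theorem IsInvariant.mul_right {s : S} {f : C_c(LimitCompletion S A, ℤ)} (hf : IsInvariant s f)
    (t : S) : IsInvariant (s * t) f :=
  fun x b hb => hf x b (lattice_mul_le s t hb)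

theorem IsInvariant.cosetValue_mk {s : S} {f : C_c(LimitCompletion S A, ℤ)}
    (hf : IsInvariant s f) (a : LimitGroup S A) : cosetValue s f a = f (incl S A a) := by
  have h1 : -a + Quotient.out (a : LimitGroup S A ⧸ lattice A s) ∈ lattice A s :=
    QuotientAddGroup.eq.1 (QuotientAddGroup.out_eq' _).symm
  obtain ⟨b, hb⟩ := h1
  have h2 : Quotient.out (a : LimitGroup S A ⧸ lattice A s) = a + toLimit (1 : S) (s • b) := by
    rw [← neg_add_eq_iff_eq_add]
    exact hb.symm
  rw [cosetValue, h2, map_add]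
  exact hf _ _ ⟨toCompletion S A b, rfl⟩

include hinj in
theorem finite_support_cosetValue (s : S) (f : C_c(LimitCompletion S A, ℤ)) :
    (Function.support (cosetValue s f)).Finite := by
  obtain ⟨T, hT⟩ := exists_finite_cosets hinj s f
  refine Set.Finite.subset (Set.Finite.biUnion T.finite_toSet (t := fun t =>
    {y : LimitGroup S A ⧸ lattice A s |
      -t + incl S A (Quotient.out y) ∈ lattice (completion S A) s}) fun t _ => ?_) fun y hy => ?_
  · refine Set.Subsingleton.finite fun y hy y' hy' => ?_
    have h1 : (-t + incl S A (Quotient.out y')) - (-t + incl S A (Quotient.out y)) ∈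
        lattice (completion S A) s := sub_mem hy' hy
    rw [add_sub_add_left_eq_sub, ← map_sub, incl_mem_lattice_iff hinj, sub_eq_neg_add] at h1
    rw [← QuotientAddGroup.out_eq' y, ← QuotientAddGroup.out_eq' y']
    exact QuotientAddGroup.eq.2 h1
  · obtain ⟨t, ht, h⟩ := hT _ hy
    exact Set.mem_biUnion (Finset.mem_coe.2 ht) h

/-- Since `𝒜` is dense, an invariant function is a combination of indicator functions of translates
of `s Ā` by elements of `𝒜`. -/
theorem IsInvariant.mem_span {s : S} {f : C_c(LimitCompletion S A, ℤ)} (hf : IsInvariant s f) :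
    f ∈ Submodule.span ℤ (Set.range fun a =>
      translationRep S A a (latticeIndicator hinj hfin s)) := by
  let c : (Multiplicative (LimitGroup S A) ⧸ latticeSubgroup A s) →₀ ℤ :=
    Finsupp.ofSupportFinite (cosetValue s f) (finite_support_cosetValue hinj s f)
  have key : ∀ (c : (Multiplicative (LimitGroup S A) ⧸ latticeSubgroup A s) →₀ ℤ)
      (x : LimitCompletion S A) (a : LimitGroup S A),
      x - incl S A a ∈ lattice (completion S A) s →
      orbitMap (translationRep S A) (latticeIndicator hinj hfin s) (latticeSubgroup A s) c x =
        c (Multiplicative.ofAdd a : Multiplicative (LimitGroup S A)) := by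
    intro c x a hx
    induction c using Finsupp.induction_linear with
    | zero => simp
    | add c₁ c₂ h₁ h₂ =>
      rw [map_add, Finsupp.add_apply, ← h₁, ← h₂]
      rfl
    | single g m =>
      obtain ⟨g, rfl⟩ := QuotientGroup.mk_surjective g
      rw [orbitMap_single fun b hb => translationRep_latticeIndicator hinj hfin hb,
        ← translationRep_latticeIndicator_incl hinj hfin]
      change m * translationRep S A g (latticeIndicator hinj hfin s) x = _
      rw [translationRep_apply, translationRep_apply, ← latticeIndicator_add hinj hfin
        (-incl S A g.toAdd + incl S A a) hx, add_assoc, add_sub_cancel]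
  have h1 : f = orbitMap (translationRep S A) (latticeIndicator hinj hfin s)
      (latticeSubgroup A s) c := by
    ext x
    obtain ⟨a, ha⟩ := exists_sub_incl_mem_lattice hinj s x
    rw [key c x a ha, ← sub_add_cancel x (incl S A a), add_comm, hf _ _ ha, ← hf.cosetValue_mk]
    rfl
  rw [h1]
  have h2 := LinearMap.mem_range_self (orbitMap (translationRep S A)
    (latticeIndicator hinj hfin s) (latticeSubgroup A s)) c
  rw [orbitMap, Finsupp.range_linearCombination] at h2
  refine Submodule.span_mono ?_ h2
  rintro _ ⟨y, rfl⟩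
  exact ⟨_, rfl⟩

/-! ### The Haar measure -/

/-- The sum of the values of an invariant function over the cosets of `s A`. -/
noncomputable def cosetSum (s : S) (f : C_c(LimitCompletion S A, ℤ)) : ℤ :=
  ∑ᶠ y, cosetValue s f y

theorem cosetSum_latticeIndicator (s : S) : cosetSum s (latticeIndicator hinj hfin s) = 1 := by
  have hχ : IsInvariant s (latticeIndicator hinj hfin s) := fun x b hb =>
    latticeIndicator_add hinj hfin x hb
  rw [cosetSum, finsum_eq_single _ ((0 : LimitGroup S A) : LimitGroup S A ⧸ lattice A s)]
  · rw [hχ.cosetValue_mk, map_zero, latticeIndicator_of_mem _ _ (zero_mem _)]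
  · intro y hy
    obtain ⟨y, rfl⟩ := QuotientAddGroup.mk_surjective y
    rw [hχ.cosetValue_mk, latticeIndicator_of_notMem]
    rw [incl_mem_lattice_iff hinj]
    exact fun h => hy ((QuotientAddGroup.eq_zero_iff _).2 h)

include hinj in
theorem relIndex_lattice (s t : S) :
    (lattice A (s * t)).relIndex (lattice A s) = (endo A t).range.index := by
  have h1 : Function.Injective ((toLimitHom A (1 : S)).comp (endo A s)) :=
    (toLimit_injective hinj 1).comp (hinj s)
  have h2 : lattice A (s * t) = (endo A t).range.map ((toLimitHom A (1 : S)).comp (endo A s)) := by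
    ext x
    constructor
    · rintro ⟨a, rfl⟩
      exact ⟨t • a, ⟨a, rfl⟩, congrArg (toLimit (1 : S)) (mul_smul s t a).symm⟩
    · rintro ⟨_, ⟨a, rfl⟩, rfl⟩
      exact ⟨a, congrArg (toLimit (1 : S)) (mul_smul s t a)⟩
  have h3 : lattice A s = (⊤ : AddSubgroup A).map ((toLimitHom A (1 : S)).comp (endo A s)) :=
    AddMonoidHom.range_eq_map _
  rw [h2, h3, AddSubgroup.relIndex_map_map_of_injective _ _ h1, AddSubgroup.relIndex_top_right]

include hinj hfin in
theorem cosetSum_mul (s t : S) {f : C_c(LimitCompletion S A, ℤ)} (hf : IsInvariant s f) :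
    cosetSum (s * t) f = (endo A t).range.index * cosetSum s f := by
  have hfin' : Finite (A ⧸ (endo A t).range) := hfin (rangeSubgroup A t)
  have hidx : (lattice A (s * t)).relIndex (lattice A s) ≠ 0 := by
    rw [relIndex_lattice hinj]
    exact (AddSubgroup.finiteIndex_of_finite_quotient (H := (endo A t).range)).index_ne_zero
  let e := AddSubgroup.quotientEquivProdOfLE (lattice_mul_le (X := A) s t)
  have _ : Finite (lattice A s ⧸ (lattice A (s * t)).addSubgroupOf (lattice A s)) :=
    @AddSubgroup.finite_quotient_of_finiteIndex _ _ _ ⟨hidx⟩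
  have h1 : ∀ y, cosetValue (s * t) f y = cosetValue s f (e y).1 := by
    intro y
    obtain ⟨y, rfl⟩ := QuotientAddGroup.mk_surjective y
    rw [(hf.mul_right t).cosetValue_mk, ← hf.cosetValue_mk]
    rfl
  have h2 : (Function.support fun p : (LimitGroup S A ⧸ lattice A s) ×
      (lattice A s ⧸ (lattice A (s * t)).addSubgroupOf (lattice A s)) =>
      cosetValue s f p.1).Finite :=
    ((finite_support_cosetValue hinj s f).prod Set.finite_univ).subset fun p hp => ⟨hp, trivial⟩
  rw [cosetSum, finsum_congr h1, finsum_comp_equiv e (f := fun p => cosetValue s f p.1),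
    finsum_curry _ h2, cosetSum, mul_finsum]
  refine finsum_congr fun y => ?_
  have _ := Fintype.ofFinite (lattice A s ⧸ (lattice A (s * t)).addSubgroupOf (lattice A s))
  rw [finsum_eq_sum_of_fintype]
  change ∑ _ : lattice A s ⧸ (lattice A (s * t)).addSubgroupOf (lattice A s), cosetValue s f y = _
  rw [Finset.sum_const, Finset.card_univ, ← Nat.card_eq_fintype_card,
    nsmul_eq_mul]
  congr 2
  exact relIndex_lattice hinj s t

/-- The integral of a function invariant under `s Ā`, the measure being normalised by `Ā`: each
coset of `s Ā` has the measure `1 / [A : s A]`. -/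
noncomputable def mean (s : S) (f : C_c(LimitCompletion S A, ℤ)) : ℚ :=
  ((endo A s).range.index : ℚ)⁻¹ * cosetSum s f

omit [IsCancelMul S] [IsReversible S] in
include hfin in
theorem index_ne_zero (s : S) : ((endo A s).range.index : ℚ) ≠ 0 := by
  have hfin' : Finite (A ⧸ (endo A s).range) := hfin (rangeSubgroup A s)
  exact Nat.cast_ne_zero.2
    (AddSubgroup.finiteIndex_of_finite_quotient (H := (endo A s).range)).index_ne_zero

include hinj hfin in
theorem mean_mul (s t : S) {f : C_c(LimitCompletion S A, ℤ)} (hf : IsInvariant s f) :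
    mean (s * t) f = mean s f := by
  rw [mean, cosetSum_mul hinj hfin s t hf, index_range_mul hinj, mean]
  have h1 := index_ne_zero hfin s
  have h2 := index_ne_zero hfin t
  push_cast
  field_simp

include hinj hfin in
theorem mean_eq {s t : S} {f : C_c(LimitCompletion S A, ℤ)} (hs : IsInvariant s f)
    (ht : IsInvariant t f) : mean s f = mean t f := by
  obtain ⟨u, v, huv⟩ := IsReversible.left s t
  rw [← mean_mul hinj hfin s u hs, huv, mean_mul hinj hfin t v ht]

include hinj in
theorem mean_add (s : S) (f g : C_c(LimitCompletion S A, ℤ)) :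
    mean s (f + g) = mean s f + mean s g := by
  have h1 : cosetSum s (f + g) = cosetSum s f + cosetSum s g :=
    finsum_add_distrib (finite_support_cosetValue hinj s f) (finite_support_cosetValue hinj s g)
  rw [mean, mean, mean, h1, Int.cast_add, mul_add]

/-- The Haar measure of the limit of the completions, normalised by `Ā`, as a functional on the
functions. A function is evaluated as a combination of indicator functions of cosets of any `s Ā`
under which it is invariant. -/
noncomputable def haar : C_c(LimitCompletion S A, ℤ) →+ ℚ :=
  AddMonoidHom.mk' (fun f => mean (exists_invariant hinj hfin f).choose f) fun f g => by
    have hf : IsInvariant _ f := (exists_invariant hinj hfin f).choose_spec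
    have hg : IsInvariant _ g := (exists_invariant hinj hfin g).choose_spec
    have hfg : IsInvariant _ (f + g) := (exists_invariant hinj hfin (f + g)).choose_spec
    obtain ⟨u, v, huv⟩ := IsReversible.left (exists_invariant hinj hfin f).choose
      (exists_invariant hinj hfin g).choose
    have hf' := hf.mul_right u
    have hg' := huv ▸ hg.mul_right v
    have hfg' : IsInvariant ((exists_invariant hinj hfin f).choose * u) (f + g) :=
      fun x b hb => congrArg₂ (· + ·) (hf' x b hb) (hg' x b hb)
    rw [mean_eq hinj hfin hf hf', mean_eq hinj hfin hg hg', mean_eq hinj hfin hfg hfg',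
      mean_add hinj]

theorem haar_eq {s : S} {f : C_c(LimitCompletion S A, ℤ)} (hf : IsInvariant s f) :
    haar hinj hfin f = mean s f :=
  mean_eq hinj hfin (exists_invariant hinj hfin f).choose_spec hf

theorem haar_latticeIndicator (s : S) :
    haar hinj hfin (latticeIndicator hinj hfin s) = ((endo A s).range.index : ℚ)⁻¹ := by
  rw [haar_eq hinj hfin (s := s) fun x b hb => latticeIndicator_add hinj hfin x hb, mean,
    cosetSum_latticeIndicator, Int.cast_one, mul_one]

theorem haar_translationRep (a : Multiplicative (LimitGroup S A))
    (f : C_c(LimitCompletion S A, ℤ)) :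
    haar hinj hfin (translationRep S A a f) = haar hinj hfin f := by
  obtain ⟨s, hs⟩ := exists_invariant hinj hfin f
  have hs : IsInvariant s f := hs
  have hs' : IsInvariant s (translationRep S A a f) := fun x b hb => by
    rw [translationRep_apply, translationRep_apply, ← add_assoc, hs _ _ hb]
  rw [haar_eq hinj hfin hs, haar_eq hinj hfin hs', mean, mean]
  congr 2
  refine Eq.trans (finsum_congr fun y => ?_) (finsum_comp_equiv
    (Equiv.addLeft ((-a.toAdd : LimitGroup S A) : LimitGroup S A ⧸ lattice A s)))
  obtain ⟨y, rfl⟩ := QuotientAddGroup.mk_surjective y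
  rw [hs'.cosetValue_mk, translationRep_apply]
  change _ = cosetValue s f ((-a.toAdd + y : LimitGroup S A) : LimitGroup S A ⧸ lattice A s)
  rw [hs.cosetValue_mk, (incl S A).map_add, (incl S A).map_neg]

theorem haar_functionRep (s : S) (f : C_c(LimitCompletion S A, ℤ)) :
    haar hinj hfin (functionRep S A (OreLocalization.numeratorHom s) f) =
      ((endo A s).range.index : ℚ)⁻¹ * haar hinj hfin f := by
  obtain ⟨t, ht⟩ := exists_invariant hinj hfin f
  have ht : IsInvariant t f := ht
  set g : FractionGroup S := OreLocalization.numeratorHom s with hg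
  have happ : ∀ x, functionRep S A g f x = f (g⁻¹ • x) := fun x => rfl
  have ht' : IsInvariant (s * t) (functionRep S A g f) := fun x b hb => by
    rw [happ, happ, smul_add, ht]
    rwa [← smul_mem_lattice_iff s, smul_inv_smul]
  rw [haar_eq hinj hfin ht, haar_eq hinj hfin ht', mean, mean, index_range_mul hinj]
  have h1 : cosetSum (s * t) (functionRep S A g f) = cosetSum t f := by
    let e : LimitGroup S A ⧸ lattice A t ≃+ LimitGroup S A ⧸ lattice A (s * t) :=
      QuotientAddGroup.congr _ _ (DistribMulAction.toAddEquiv (LimitGroup S A) g) (by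
        ext x
        constructor
        · rintro ⟨y, hy, rfl⟩
          exact (smul_mem_lattice_iff s t y).2 hy
        · intro hx
          refine ⟨g⁻¹ • x, (smul_mem_lattice_iff s t _).1 ?_, smul_inv_smul g x⟩
          rwa [← hg, smul_inv_smul])
    refine Eq.trans (finsum_comp_equiv e.toEquiv).symm (finsum_congr fun y => ?_)
    obtain ⟨y, rfl⟩ := QuotientAddGroup.mk_surjective y
    rw [ht.cosetValue_mk]
    refine (ht'.cosetValue_mk (g • y)).trans ?_
    rw [happ, incl, limitMap_smul, inv_smul_smul]
  rw [h1, Nat.cast_mul, mul_inv, mul_assoc]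

end Translates

/-! ### Antisymmetrised chains and alternating maps -/

section Antisymmetrization

variable {G V : Type} [AddCommGroup V] {q : ℕ}

/-- The chain `∑_π sgn(π) [a_π(1)|⋯|a_π(q)]` with coefficient `v`. -/
noncomputable def antisymm (v : V) (a : Fin q → G) : Chain G V q :=
  ∑ π : Equiv.Perm (Fin q), Finsupp.single (fun i => a (π i)) ((Equiv.Perm.sign π : ℤ) • v)

theorem antisymm_comp_perm (v : V) (a : Fin q → G) (τ : Equiv.Perm (Fin q)) :
    antisymm v (fun i => a (τ i)) = (Equiv.Perm.sign τ : ℤ) • antisymm v a := by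
  rw [antisymm, antisymm, Finset.smul_sum]
  refine Fintype.sum_equiv (Equiv.mulLeft τ) _ _ fun π => ?_
  rw [Finsupp.smul_single, smul_smul, Equiv.coe_mulLeft, Equiv.Perm.sign_mul, Units.val_mul,
    ← mul_assoc, ← Units.val_mul, Int.units_mul_self, Units.val_one, one_mul]
  rfl

/-- Expansion along the first entry. -/
theorem antisymm_succ (v : V) (a : Fin (q + 1) → G) :
    antisymm v a = ∑ i : Fin (q + 1), (-1 : ℤ) ^ (i : ℕ) •
      consChain (a i) (antisymm v fun j => a (i.succAbove j)) := by
  have h1 : ∀ p : Fin (q + 1) × Equiv.Perm (Fin q),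
      (fun i => a (Equiv.Perm.decomposeFin.symm p i)) =
        (Fin.cons (a p.1) fun j => a (Equiv.swap 0 p.1 (p.2 j).succ) : Fin (q + 1) → G) := by
    rintro ⟨i, π⟩
    funext k
    refine Fin.cases ?_ (fun k => ?_) k
    · rw [Equiv.Perm.decomposeFin_symm_apply_zero, Fin.cons_zero]
    · rw [Equiv.Perm.decomposeFin_symm_apply_succ, Fin.cons_succ]
  have h2 : antisymm v a = ∑ i : Fin (q + 1), (if i = 0 then 1 else -1 : ℤ) •
      consChain (a i) (antisymm v fun j => a (Equiv.swap 0 i j.succ)) := by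
    rw [antisymm, ← Equiv.Perm.decomposeFin.symm.sum_comp, Fintype.sum_prod_type]
    refine Finset.sum_congr rfl fun i _ => ?_
    rw [antisymm, map_sum, Finset.smul_sum]
    refine Finset.sum_congr rfl fun π _ => ?_
    rw [h1, Equiv.Perm.decomposeFin.symm_sign, consChain_single, Finsupp.smul_single, smul_smul]
    split_ifs <;> simp
  rw [h2]
  refine Finset.sum_congr rfl fun i _ => ?_
  refine Fin.cases ?_ (fun i => ?_) i
  · simp [Equiv.swap_self]
  · have h3 : (fun j => a (Equiv.swap 0 i.succ j.succ)) =
        fun j => (fun j => a (i.succ.succAbove j)) (i.cycleRange j) := by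
      funext j
      exact congrArg a (Fin.succAbove_cycleRange i j).symm
    rw [h3, antisymm_comp_perm v (fun j => a (i.succ.succAbove j)), Fin.sign_cycleRange,
      map_zsmul, smul_smul, if_neg (Fin.succ_ne_zero i), Fin.val_succ, pow_succ']
    simp

theorem shuffle_antisymm (v : V) (b : G) (a : Fin q → G) :
    shuffle b q (antisymm v a) = antisymm v (Fin.cons b a : Fin (q + 1) → G) := by
  induction q with
  | zero =>
    rw [antisymm_succ, shuffle_zero]
    simp
  | succ q ih =>
    have h1 : shuffle b (q + 1) (antisymm v a) = consChain b (antisymm v a) -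
        ∑ i : Fin (q + 1), (-1 : ℤ) ^ (i : ℕ) • consChain (a i)
          (antisymm v (Fin.cons b fun j => a (i.succAbove j) : Fin (q + 1) → G)) := by
      rw [antisymm_succ v a]
      simp only [map_sum, map_zsmul, shuffle_consChain, ih, smul_sub, Finset.sum_sub_distrib]
    rw [h1, antisymm_succ v (Fin.cons b a : Fin (q + 2) → G),
      Fin.sum_univ_succ (n := q + 1), sub_eq_add_neg,
      ← Finset.sum_neg_distrib]
    congr 1
    · simp
    · refine Finset.sum_congr rfl fun i _ => ?_
      rw [Fin.val_succ, pow_succ, mul_neg_one, neg_smul, Fin.cons_succ]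
      congr 4
      funext j
      refine Fin.cases ?_ (fun j => ?_) j
      · rw [Fin.succ_succAbove_zero]; rfl
      · rw [Fin.succ_succAbove_succ]; rfl

theorem antisymm_eq_shuffleProd (v : V) (a : Fin q → G) : antisymm v a = shuffleProd v q a := by
  induction q with
  | zero =>
    rw [antisymm, shuffleProd]
    simp [Subsingleton.elim _ (default : Fin 0 → G)]
  | succ q ih => rw [shuffleProd, ← ih, shuffle_antisymm, Fin.cons_self_tail]

end Antisymmetrization

section Functional

variable {G V W : Type} [CommGroup G] [AddCommGroup V] [AddCommGroup W] [Module ℚ W] {q : ℕ}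

/-- The functional `v ⊗ [g₁|⋯|g_q] ↦ μ(v) m(g₁, …, g_q)` on chains. -/
noncomputable def pairing (μ : V →+ ℚ) (m : Additive G [⋀^Fin q]→ₗ[ℤ] W) : Chain G V q →ₗ[ℤ] W :=
  Finsupp.lsum ℤ fun w =>
    ((LinearMap.toSpanSingleton ℚ W (m fun i => Additive.ofMul (w i))).toAddMonoidHom.comp
      μ).toIntLinearMap

theorem pairing_single (μ : V →+ ℚ) (m : Additive G [⋀^Fin q]→ₗ[ℤ] W) (w : Fin q → G) (v : V) :
    pairing μ m (Finsupp.single w v) = μ v • m fun i => Additive.ofMul (w i) := by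
  simp [pairing]

theorem pairing_add (μ : V →+ ℚ) (m m' : Additive G [⋀^Fin q]→ₗ[ℤ] W) (c : Chain G V q) :
    pairing μ (m + m') c = pairing μ m c + pairing μ m' c := by
  induction c using Finsupp.induction_linear with
  | zero => simp
  | add c₁ c₂ h₁ h₂ => simp only [map_add, h₁, h₂]; abel
  | single w v => simp only [pairing_single, AlternatingMap.add_apply, smul_add]

theorem pairing_zero (μ : V →+ ℚ) (c : Chain G V q) :
    pairing μ (0 : Additive G [⋀^Fin q]→ₗ[ℤ] W) c = 0 := by
  have h := pairing_add μ (0 : Additive G [⋀^Fin q]→ₗ[ℤ] W) 0 c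
  rwa [add_zero, left_eq_add] at h

theorem pairing_consChain (μ : V →+ ℚ) (m : Additive G [⋀^Fin (q + 1)]→ₗ[ℤ] W) (g : G)
    (c : Chain G V q) :
    pairing μ m (consChain g c) = pairing μ (m.curryLeft (Additive.ofMul g)) c := by
  induction c using Finsupp.induction_linear with
  | zero => simp
  | add c₁ c₂ h₁ h₂ => simp only [map_add, h₁, h₂]
  | single w v =>
    rw [consChain_single, pairing_single, pairing_single, AlternatingMap.curryLeft_apply_apply]
    congr 2

/-- For a multilinear map the terms from the inner faces telescope. -/
theorem pairing_innerFace (μ : V →+ ℚ) (m : Additive G [⋀^Fin q]→ₗ[ℤ] W) (g : G)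
    (c : Chain G V q) : pairing μ m (innerFace g c) = -pairing μ m c := by
  induction q generalizing g with
  | zero => rw [innerFace_zero, map_neg]
  | succ q ih =>
    suffices h : pairing μ m ∘ₗ innerFace g = -pairing μ m from LinearMap.congr_fun h c
    refine chain_hom_ext fun h c => ?_
    rw [LinearMap.comp_apply, innerFace_consChain, map_sub, map_neg, LinearMap.neg_apply,
      pairing_consChain, pairing_consChain, pairing_consChain, ih, ofMul_mul, map_add, pairing_add]
    abel

/-- Since a multilinear map is a cocycle, the functional vanishes on boundaries. -/
theorem pairing_bd {ρ : Representation ℤ G V} {μ : V →+ ℚ} (hμ : ∀ g v, μ (ρ g v) = μ v)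
    (m : Additive G [⋀^Fin q]→ₗ[ℤ] W) (c : Chain G V (q + 1)) : pairing μ m (bd ρ q c) = 0 := by
  suffices h : pairing μ m ∘ₗ bd ρ q = 0 from LinearMap.congr_fun h c
  refine chain_hom_ext fun g c => ?_
  have h1 : pairing μ m (mapCoeff (ρ g⁻¹) c) = pairing μ m c := by
    induction c using Finsupp.induction_linear with
    | zero => simp
    | add c₁ c₂ h₁ h₂ => simp only [map_add, h₁, h₂]
    | single w v => rw [mapCoeff_single, pairing_single, pairing_single, hμ]
  rw [LinearMap.comp_apply, bd_consChain, map_add, h1, pairing_innerFace, add_neg_cancel,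
    LinearMap.zero_apply]

theorem pairing_shuffle (μ : V →+ ℚ) (m : Additive G [⋀^Fin (q + 1)]→ₗ[ℤ] W) (a : G)
    (c : Chain G V q) : pairing μ m (shuffle a q c) =
      (q + 1) • pairing μ (m.curryLeft (Additive.ofMul a)) c := by
  induction q with
  | zero => rw [shuffle_zero, pairing_consChain, zero_add, one_smul]
  | succ q ih =>
    suffices h : pairing μ m ∘ₗ shuffle a (q + 1) =
        (q + 1 + 1) • pairing μ (m.curryLeft (Additive.ofMul a)) from LinearMap.congr_fun h c
    refine chain_hom_ext fun g c => ?_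
    -- the alternating map changes its sign when its first two arguments `a`, `g` are exchanged
    have h1 := m.curryLeft_same (Additive.ofMul g + Additive.ofMul a)
    rw [m.curryLeft.map_add, AlternatingMap.curryLeft_add, LinearMap.add_apply, map_add, map_add,
      m.curryLeft_same, m.curryLeft_same, zero_add, add_zero] at h1
    have h2 := congrArg (fun n => pairing μ n c) h1
    simp only [pairing_add, pairing_zero] at h2
    rw [LinearMap.comp_apply, shuffle_consChain, map_sub, pairing_consChain, pairing_consChain,
      pairing_consChain, ih, LinearMap.smul_apply, pairing_consChain, eq_neg_of_add_eq_zero_left h2,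
      smul_neg, sub_neg_eq_add, succ_nsmul' _ (q + 1)]

theorem pairing_shuffleProd (μ : V →+ ℚ) (m : Additive G [⋀^Fin q]→ₗ[ℤ] W) (v : V)
    (a : Fin q → G) : pairing μ m (shuffleProd v q a) =
      ((q.factorial : ℚ) * μ v) • m fun i => Additive.ofMul (a i) := by
  induction q with
  | zero =>
    rw [shuffleProd, pairing_single, Nat.factorial_zero, Nat.cast_one, one_mul]
    congr 2
    exact Subsingleton.elim _ _
  | succ q ih =>
    rw [shuffleProd, pairing_shuffle, ih, AlternatingMap.curryLeft_apply_apply,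
      ← Nat.cast_smul_eq_nsmul ℚ, smul_smul, ← mul_assoc, ← Nat.cast_mul, ← Nat.factorial_succ]
    congr 2
    funext i
    refine Fin.cases ?_ (fun i => ?_) i <;> rfl

end Functional

/-! ### Cycles and homology classes -/

section Classes

variable {G V : Type} [CommGroup G] [AddCommGroup V] {ρ : Representation ℤ G V} {q : ℕ}

variable (ρ) in
/-- `h` is the homology class of the cycle `c`. -/
def Represents (h : groupHomology (Rep.of ρ) q) (c : Chain G V q) : Prop :=
  ∃ z : groupHomology.cycles (Rep.of ρ) q,
    groupHomology.iCycles (Rep.of ρ) q z = c ∧ groupHomology.π (Rep.of ρ) q z = h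

theorem Represents.isCycle {h : groupHomology (Rep.of ρ) q} {c : Chain G V q}
    (hc : Represents ρ h c) : IsCycle ρ q c := by
  obtain ⟨z, rfl, -⟩ := hc
  cases q with
  | zero => trivial
  | succ q =>
    have h1 := (groupHomology.inhomogeneousChains (Rep.of ρ)).iCycles_d (q + 1) q
    rw [groupHomology.inhomogeneousChains.d_def] at h1
    exact congrArg (fun T => T.hom z) h1

theorem IsCycle.exists_represents {c : Chain G V q} (hc : IsCycle ρ q c) :
    ∃ h, Represents ρ h c := by
  cases q with
  | zero =>
    refine ⟨_, groupHomology.cyclesMk 0 0 (by simp) c ?_, groupHomology.iCycles_mk _ _ _, rfl⟩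
    rw [(groupHomology.inhomogeneousChains (Rep.of ρ)).shape 0 0 (by simp)]
    rfl
  | succ q =>
    refine ⟨_, groupHomology.cyclesMk (q + 1) q (by simp) c ?_, groupHomology.iCycles_mk _ _ _, rfl⟩
    rw [groupHomology.inhomogeneousChains.d_def]
    exact hc

theorem exists_represents (h : groupHomology (Rep.of ρ) q) : ∃ c, Represents ρ h c := by
  induction h using groupHomology_induction_on with
  | h z => exact ⟨_, z, rfl, rfl⟩

theorem Represents.eq_zero_of_bd {h : groupHomology (Rep.of ρ) q} {u : Chain G V (q + 1)}
    (hu : Represents ρ h (bd ρ q u)) : h = 0 := by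
  obtain ⟨z, hz, rfl⟩ := hu
  have h1 : z = groupHomology.toCycles (Rep.of ρ) (q + 1) q u := by
    refine (ModuleCat.mono_iff_injective (groupHomology.iCycles (Rep.of ρ) q)).1 inferInstance ?_
    have h2 := (groupHomology.inhomogeneousChains (Rep.of ρ)).toCycles_i (q + 1) q
    rw [groupHomology.inhomogeneousChains.d_def] at h2
    exact hz.trans (congrArg (fun T => T.hom u) h2).symm
  have h3 := (groupHomology.inhomogeneousChains (Rep.of ρ)).toCycles_comp_homologyπ (q + 1) q
  rw [h1]
  exact congrArg (fun T => T.hom u) h3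

open CategoryTheory in
/-- A functional on chains that vanishes on boundaries descends to homology. -/
theorem exists_descend {W : Type} [AddCommGroup W] (Λ : Chain G V q →ₗ[ℤ] W)
    (hΛ : ∀ u, Λ (bd ρ q u) = 0) :
    ∃ κ : groupHomology (Rep.of ρ) q →ₗ[ℤ] W, ∀ h c, Represents ρ h c → κ h = Λ c := by
  let K := groupHomology.inhomogeneousChains (Rep.of ρ)
  have hK := K.homologyIsCokernel (q + 1) q (by simp)
  have h1 : K.toCycles (q + 1) q ≫ (K.iCycles q ≫ ModuleCat.ofHom Λ) = 0 := by
    rw [← Category.assoc, K.toCycles_i, groupHomology.inhomogeneousChains.d_def]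
    exact ModuleCat.hom_ext (LinearMap.ext hΛ)
  refine ⟨(hK.desc (Limits.CokernelCofork.ofπ _ h1)).hom, ?_⟩
  rintro _ _ ⟨z, rfl, rfl⟩
  exact congrArg (fun T => T.hom z)
    (hK.fac (Limits.CokernelCofork.ofπ _ h1)
      Limits.WalkingParallelPair.one)

theorem Represents.map {G' V' : Type} [CommGroup G'] [AddCommGroup V']
    {ρ' : Representation ℤ G' V'} (f : G →* G') (φ : Rep.of ρ ⟶ Rep.res f (Rep.of ρ'))
    {h : groupHomology (Rep.of ρ) q} {c : Chain G V q} (hc : Represents ρ h c) :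
    Represents ρ' ((groupHomology.map f φ q).hom h)
      (((groupHomology.chainsMap f φ).f q).hom c) := by
  obtain ⟨z, rfl, rfl⟩ := hc
  refine ⟨(groupHomology.cyclesMap f φ q).hom z, ?_, ?_⟩
  · exact congrArg (fun T => T.hom z)
      (HomologicalComplex.cyclesMap_i (groupHomology.chainsMap f φ) q)
  · exact congrArg (fun T => T.hom z) (groupHomology.π_map f φ q).symm

end Classes

/-! ### Rational exterior powers and denominators -/

section RationalExteriorPowers

variable {A B : Type} [AddCommGroup A] [AddCommGroup B] {q : ℕ}

variable (B q) in
/-- The alternating map `(b₁, …, b_q) ↦ b₁ ∧ ⋯ ∧ b_q` into the exterior power of `ℚ ⊗ B` over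
`ℚ`. -/
noncomputable def ratWedge : B [⋀^Fin q]→ₗ[ℤ] ⋀[ℚ]^q (ℚ ⊗[ℤ] B) :=
  { ((exteriorPower.ιMulti ℚ q).toMultilinearMap.restrictScalars ℤ).compLinearMap
      fun _ => TensorProduct.mk ℤ ℚ B 1 with
    map_eq_zero_of_eq' := fun v _ _ h hij =>
      (exteriorPower.ιMulti ℚ q).map_eq_zero_of_eq (fun i => (1 : ℚ) ⊗ₜ[ℤ] v i)
        (congrArg (fun b => (1 : ℚ) ⊗ₜ[ℤ] b) h) hij }

theorem ratWedge_apply (b : Fin q → B) :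
    ratWedge B q b = exteriorPower.ιMulti ℚ q fun i => (1 : ℚ) ⊗ₜ[ℤ] b i := rfl

theorem linearIndependent_ratWedge {n : ℕ} {e : Fin n → B} (he : LinearIndependent ℤ e) :
    LinearIndependent ℚ fun f : Fin q ↪o Fin n => ratWedge B q (e ∘ f) := by
  have h := exteriorPower.ιMulti_family_linearIndependent_field (n := q)
    (linearIndependent_one_tmul he)
  have h2 := h.comp Set.powersetCard.ofFinEmbEquiv Set.powersetCard.ofFinEmbEquiv.injective
  have h3 : exteriorPower.ιMulti_family ℚ q (fun i => (1 : ℚ) ⊗ₜ[ℤ] e i) ∘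
      Set.powersetCard.ofFinEmbEquiv = fun f : Fin q ↪o Fin n => ratWedge B q (e ∘ f) := by
    funext f
    rw [Function.comp_apply, exteriorPower.ιMulti_family, Equiv.symm_apply_apply]
    rfl
  rw [h3] at h2
  exact h2

/-- The map of exterior powers induced by `f : A → B`, followed by extension of scalars. -/
noncomputable def ratWedgeMap (q : ℕ) (f : A →ₗ[ℤ] B) : ⋀[ℤ]^q A →ₗ[ℤ] ⋀[ℚ]^q (ℚ ⊗[ℤ] B) :=
  exteriorPower.alternatingMapLinearEquiv ((ratWedge B q).compLinearMap f)

theorem ratWedgeMap_ιMulti (f : A →ₗ[ℤ] B) (a : Fin q → A) :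
    ratWedgeMap q f (exteriorPower.ιMulti ℤ q a) = ratWedge B q fun i => f (a i) :=
  exteriorPower.alternatingMapLinearEquiv_apply_ιMulti _ _

/-- An element of an exterior power comes from a finitely generated subgroup. -/
theorem exists_fg_mem_range_map (x : ⋀[ℤ]^q A) :
    ∃ C : Submodule ℤ A, C.FG ∧ x ∈ LinearMap.range (exteriorPower.map q C.subtype) := by
  have hmono : ∀ {C D : Submodule ℤ A}, C ≤ D →
      LinearMap.range (exteriorPower.map q C.subtype) ≤
        LinearMap.range (exteriorPower.map q D.subtype) := by
    intro C D h
    rw [← Submodule.subtype_comp_inclusion C D h, exteriorPower.map_comp]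
    exact LinearMap.range_comp_le_range _ _
  have hx : x ∈ Submodule.span ℤ (Set.range (exteriorPower.ιMulti ℤ q (M := A))) := by
    rw [exteriorPower.ιMulti_span]
    trivial
  induction hx using Submodule.span_induction with
  | mem x hx =>
    obtain ⟨a, rfl⟩ := hx
    refine ⟨Submodule.span ℤ (Set.range a), Submodule.fg_span (Set.finite_range a),
      exteriorPower.ιMulti ℤ q fun i => ⟨a i, Submodule.subset_span ⟨i, rfl⟩⟩, ?_⟩
    rw [exteriorPower.map_apply_ιMulti]
    rfl
  | zero => exact ⟨⊥, Submodule.fg_bot, zero_mem _⟩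
  | add x y _ _ hx hy =>
    obtain ⟨C, hC, hx⟩ := hx
    obtain ⟨D, hD, hy⟩ := hy
    exact ⟨C ⊔ D, hC.sup hD, add_mem (hmono le_sup_left hx) (hmono le_sup_right hy)⟩
  | smul m x _ hx =>
    obtain ⟨C, hC, hx⟩ := hx
    exact ⟨C, hC, Submodule.smul_mem _ m hx⟩

/-- By `exists_fg_mem_range_map` it suffices to consider the exterior power of a finitely generated
subgroup, which is free on products of basis elements. -/
theorem ratWedgeMap_injective [IsAddTorsionFree A] (q : ℕ) {f : A →ₗ[ℤ] B}
    (hf : Function.Injective f) : Function.Injective (ratWedgeMap q f) := by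
  rw [injective_iff_map_eq_zero]
  intro x hx
  obtain ⟨C, hC, y, rfl⟩ := exists_fg_mem_range_map x
  have _ : Module.Finite ℤ C := Module.Finite.of_fg hC
  let b := Module.finBasis ℤ C
  have h1 : LinearIndependent ℤ fun i => f (b i : A) :=
    (b.linearIndependent.map' C.subtype (Submodule.ker_subtype C)).map' f
      (LinearMap.ker_eq_bot.2 hf)
  have h2 : LinearIndependent ℤ
      fun g : Fin q ↪o Fin (Module.finrank ℤ C) => ratWedge B q fun i => f (b (g i) : A) :=
    (linearIndependent_ratWedge h1).restrict_scalars fun m n h => by simpa using h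
  obtain ⟨c, rfl⟩ : ∃ c : Set.powersetCard (Fin (Module.finrank ℤ C)) q → ℤ,
      y = ∑ g, c g • exteriorPower.ιMulti_family ℤ q b g := by
    refine ⟨fun g => (b.exteriorPower q).repr y g, ?_⟩
    rw [← exteriorPower.coe_basis]
    exact ((b.exteriorPower q).sum_repr y).symm
  have h3 : LinearIndependent ℤ fun g => ratWedgeMap q f (exteriorPower.map q C.subtype
      (exteriorPower.ιMulti_family ℤ q b g)) := by
    convert h2.comp Set.powersetCard.ofFinEmbEquiv.symm
      Set.powersetCard.ofFinEmbEquiv.symm.injective using 1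
    funext g
    rw [exteriorPower.ιMulti_family, exteriorPower.map_apply_ιMulti, ratWedgeMap_ιMulti]
    rfl
  simp only [map_sum, map_zsmul] at hx
  have h4 := Fintype.linearIndependent_iff.1 h3 c hx
  simp [h4]

end RationalExteriorPowers

section Denominators

variable {S A : Type} [Monoid S] [AddCommGroup A] [DistribMulAction S A]

/-- The elements of `ℤ[𝕀⁻¹]` are fractions whose denominators are invertible in `ℤ[𝕀⁻¹]`. -/
theorem exists_denominator (r : invRing S A) :
    ∃ (n m : ℤ) (u : invRing S A), (n : invRing S A) * u = 1 ∧ r = m * u := by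
  obtain ⟨r, hr⟩ := r
  induction hr using Subring.closure_induction with
  | mem x hx =>
    obtain ⟨C, hC, k, hk, rfl⟩ := hx
    by_cases h : k = 0
    · exact ⟨1, 0, 1, by simp, Subtype.ext (by simp [h])⟩
    · refine ⟨k, 1, ⟨(k : ℚ)⁻¹, Subring.subset_closure ⟨C, hC, k, hk, rfl⟩⟩, Subtype.ext ?_,
        by simp⟩
      simpa using mul_inv_cancel₀ (Nat.cast_ne_zero.2 h)
  | zero => exact ⟨1, 0, 1, by simp, by simp; rfl⟩
  | one => exact ⟨1, 1, 1, by simp, by simp; rfl⟩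
  | add x y hx hy h₁ h₂ =>
    obtain ⟨n, m, u, h1, h2⟩ := h₁
    obtain ⟨n', m', u', h1', h2'⟩ := h₂
    refine ⟨n * n', m * n' + m' * n, u * u', ?_, ?_⟩
    · push_cast
      linear_combination (n' : invRing S A) * u' * h1 + h1'
    · refine Eq.trans (b := (⟨x, hx⟩ : invRing S A) + ⟨y, hy⟩) rfl ?_
      rw [h2, h2']
      push_cast
      linear_combination -(m : invRing S A) * u * h1' - (m' : invRing S A) * u' * h1
  | neg x hx h₁ =>
    obtain ⟨n, m, u, h1, h2⟩ := h₁
    refine ⟨n, -m, u, h1, ?_⟩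
    refine Eq.trans (b := -(⟨x, hx⟩ : invRing S A)) rfl ?_
    rw [h2]
    push_cast
    ring
  | mul x y hx hy h₁ h₂ =>
    obtain ⟨n, m, u, h1, h2⟩ := h₁
    obtain ⟨n', m', u', h1', h2'⟩ := h₂
    refine ⟨n * n', m * m', u * u', ?_, ?_⟩
    · push_cast
      linear_combination (n' : invRing S A) * u' * h1 + h1'
    · refine Eq.trans (b := (⟨x, hx⟩ : invRing S A) * ⟨y, hy⟩) rfl ?_
      rw [h2, h2']
      push_cast
      ring

/-- Every element of `ℤ[𝕀⁻¹] ⊗ N` is a pure tensor with an invertible first factor. -/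
theorem exists_eq_tmul {N : Type} [AddCommGroup N] [iN : Module ℤ N]
    (t : invRing S A ⊗[ℤ] N) :
    ∃ (n : ℤ) (u : invRing S A) (x : N), (n : invRing S A) * u = 1 ∧ t = u ⊗ₜ[ℤ] x := by
  obtain rfl : iN = AddCommGroup.toIntModule N := Subsingleton.elim _ _
  induction t using TensorProduct.induction_on with
  | zero => exact ⟨1, 1, 0, by simp, by simp⟩
  | tmul r x =>
    obtain ⟨n, m, u, h1, rfl⟩ := exists_denominator r
    exact ⟨n, u, m • x, h1, by rw [← zsmul_eq_mul, TensorProduct.smul_tmul]⟩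
  | add t t' h₁ h₂ =>
    obtain ⟨n, u, x, h1, rfl⟩ := h₁
    obtain ⟨n', u', x', h1', rfl⟩ := h₂
    refine ⟨n * n', u * u', n' • x + n • x', ?_, ?_⟩
    · push_cast
      linear_combination (n' : invRing S A) * u' * h1 + h1'
    · rw [TensorProduct.tmul_add, ← TensorProduct.smul_tmul, ← TensorProduct.smul_tmul,
        zsmul_eq_mul, zsmul_eq_mul]
      congr 2
      · linear_combination -u * h1'
      · linear_combination -u' * h1

theorem liftBaseChange_injective {N P : Type} [AddCommGroup N] [AddCommGroup P]
    [Module ℤ N] [Module (invRing S A) P] {f : N →ₗ[ℤ] P} (hf : Function.Injective f) :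
    Function.Injective (f.liftBaseChange (invRing S A)) := by
  rw [injective_iff_map_eq_zero]
  intro t ht
  obtain ⟨n, u, x, h1, rfl⟩ := exists_eq_tmul t
  rw [LinearMap.liftBaseChange_tmul] at ht
  have h2 : f x = 0 := by
    rw [← one_smul (invRing S A) (f x), ← h1, mul_smul, ht, smul_zero]
  rw [hf (h2.trans (map_zero f).symm), TensorProduct.tmul_zero]

end Denominators

section WedgeValue

variable {G V : Type} [CommGroup G] [AddCommGroup V] {q : ℕ}

/-- The functional `v ⊗ [g₁|⋯|g_q] ↦ (μ(v) / q!) g₁ ∧ ⋯ ∧ g_q` on chains. -/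
noncomputable def wedgeValue (q : ℕ) (μ : V →+ ℚ) :
    Chain G V q →ₗ[ℤ] ⋀[ℚ]^q (ℚ ⊗[ℤ] Additive G) :=
  (q.factorial : ℚ)⁻¹ • pairing μ (ratWedge (Additive G) q)

theorem wedgeValue_shuffleProd (μ : V →+ ℚ) (v : V) (a : Fin q → G) :
    wedgeValue q μ (shuffleProd v q a) =
      μ v • ratWedge (Additive G) q fun i => Additive.ofMul (a i) := by
  rw [wedgeValue, LinearMap.smul_apply, pairing_shuffleProd, smul_smul,
    inv_mul_cancel_left₀ (Nat.cast_ne_zero.2 q.factorial_ne_zero)]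

theorem wedgeValue_bd {ρ : Representation ℤ G V} {μ : V →+ ℚ} (hμ : ∀ g v, μ (ρ g v) = μ v)
    (c : Chain G V (q + 1)) : wedgeValue q μ (bd ρ q c) = 0 := by
  rw [wedgeValue, LinearMap.smul_apply, pairing_bd hμ, smul_zero]

theorem wedgeValue_chainsMap {ρ : Representation ℤ G V} {μ : V →+ ℚ} (f : G →* G)
    (φ : Rep.of ρ ⟶ Rep.res f (Rep.of ρ)) (r : ℚ) (hφ : ∀ v : V, μ (φ.hom v) = r * μ v)
    (c : Chain G V q) : wedgeValue q μ (((groupHomology.chainsMap f φ).f q).hom c) =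
      r • exteriorPower.map q (f.toAdditive.toIntLinearMap.baseChange ℚ) (wedgeValue q μ c) := by
  induction c using Finsupp.induction_linear with
  | zero => simp
  | add c₁ c₂ h₁ h₂ =>
    rw [map_add, map_add, h₁, h₂, map_add, map_add, smul_add]
  | single w v =>
    have h1 : ((groupHomology.chainsMap f φ).f q).hom (Finsupp.single w v) =
        Finsupp.single (f ∘ w) (φ.hom v : V) := groupHomology.chainsMap_f_single f φ q w v
    rw [h1, wedgeValue, LinearMap.smul_apply, LinearMap.smul_apply, pairing_single, pairing_single,
      map_smul, map_smul, ratWedge_apply, ratWedge_apply, exteriorPower.map_apply_ιMulti, hφ,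
      smul_smul, smul_smul, smul_smul]
    congr 1
    ring

/-- If `μ(v) ≠ 0`, the functional is injective on the span of the products of independent elements
with coefficient `v`. -/
theorem eq_zero_of_wedgeValue_eq_zero {μ : V →+ ℚ} {v : V} (hv : μ v ≠ 0) {n : ℕ} {e : Fin n → G}
    (he : ∀ m : Fin n → ℤ, ∏ i, e i ^ m i = 1 → m = 0) {c : Chain G V q}
    (hc : c ∈ prodSpan v e q) (h0 : wedgeValue q μ c = 0) : c = 0 := by
  have he' : LinearIndependent ℤ fun i => Additive.ofMul (e i) := by
    rw [Fintype.linearIndependent_iff]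
    intro m hm
    exact congrFun (he m (by simpa [← ofMul_zpow, ← ofMul_prod] using hm))
  obtain ⟨m, rfl⟩ := (Submodule.mem_span_range_iff_exists_fun ℤ).1 hc
  simp only [map_sum, map_zsmul, wedgeValue_shuffleProd, ← Int.cast_smul_eq_zsmul ℚ,
    smul_smul] at h0
  have h1 := Fintype.linearIndependent_iff.1 (linearIndependent_ratWedge (q := q) he')
    (fun f => (m f : ℚ) * μ v) h0
  refine Finset.sum_eq_zero fun f _ => ?_
  rw [Int.cast_eq_zero.1 ((mul_eq_zero.1 (h1 f)).resolve_right hv), zero_smul]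

end WedgeValue

/-! ### Identification of the homology -/

section Assembly

variable {S A : Type} [Monoid S] [IsCancelMul S] [IsReversible S] [AddCommGroup A]
  [DistribMulAction S A]

theorem isMulTorsionFree_limit [IsAddTorsionFree A]
    (hinj : ∀ s : S, Function.Injective fun a : A => s • a) :
    IsMulTorsionFree (Multiplicative (LimitGroup S A)) := by
  refine ⟨fun n hn x y hxy => ?_⟩
  change n • x.toAdd = n • y.toAdd at hxy
  rw [← sub_eq_zero, ← smul_sub] at hxy
  obtain ⟨s, a, ha⟩ := exists_toLimit (x.toAdd - y.toAdd)
  rw [ha] at hxy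
  have h1 : toLimit s (n • a) = toLimit s (0 : A) := by
    rw [toLimit_zero, ← hxy]
    exact map_nsmul (toLimitHom A s) n a
  have h2 : a = 0 := (nsmul_eq_zero_iff_right hn).1 (toLimit_injective hinj s h1)
  rw [h2, toLimit_zero, sub_eq_zero] at ha
  exact ha

variable (hinj : ∀ s : S, Function.Injective fun a : A => s • a)
  (hfin : ∀ C : constructible S A, Finite (A ⧸ (C : AddSubgroup A)))

include hinj hfin in
theorem exists_common_invariant (F : Finset C_c(LimitCompletion S A, ℤ)) :
    ∃ s : S, ∀ f ∈ F, IsInvariant s f := by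
  classical
  induction F using Finset.induction_on with
  | empty => exact ⟨1, by simp⟩
  | insert f F _ ih =>
    obtain ⟨s, hs⟩ := ih
    obtain ⟨t, ht⟩ := exists_invariant hinj hfin f
    have ht : IsInvariant t f := ht
    obtain ⟨u, v, huv⟩ := IsReversible.left s t
    refine ⟨s * u, fun g hg => ?_⟩
    rcases Finset.mem_insert.1 hg with rfl | hg
    · exact huv ▸ ht.mul_right v
    · exact (hs g hg).mul_right u

/-- Every class in the homology of `𝒜` is represented by a combination of products of independent
elements of some `s A`, with the indicator function of `s Ā` as coefficient. -/
theorem exists_represents_prodSpan [IsAddTorsionFree A] {q : ℕ} (h : homology S A q) :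
    ∃ (s : S) (n : ℕ) (e : Fin n → Multiplicative (LimitGroup S A)),
      (∀ i, e i ∈ latticeSubgroup A s) ∧ (∀ m : Fin n → ℤ, ∏ i, e i ^ m i = 1 → m = 0) ∧
      ∃ c ∈ prodSpan (latticeIndicator hinj hfin s) e q, ∃ u,
        Represents (translationRep S A) h (c + bd (translationRep S A) q u) := by
  classical
  have _ := isMulTorsionFree_limit hinj
  obtain ⟨z, hz⟩ := exists_represents h
  obtain ⟨s, hs⟩ := exists_common_invariant hinj hfin (z.support.image z)
  obtain ⟨n, e, h1, h2, c, hc, u, rfl⟩ := exists_prodSpan_of_cycle (translationRep S A)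
    (latticeIndicator hinj hfin s) (latticeSubgroup A s)
    (fun g hg => translationRep_latticeIndicator hinj hfin hg)
    (mapDomain_eq_zero_of_linearCombination hinj hfin s) z hz.isCycle fun w => by
      by_cases hw : w ∈ z.support
      · exact (hs _ (Finset.mem_image_of_mem z hw)).mem_span hinj hfin
      · rw [Finsupp.notMem_support_iff.1 hw]
        exact zero_mem _
  exact ⟨s, n, e, h1, h2, c, hc, u, hz⟩

/-- The embedding of `A` in `𝒜`, as a homomorphism to the additive copy of the multiplicative
group. -/
noncomputable def limitEmbedding (S A : Type) [Monoid S] [IsCancelMul S] [IsReversible S]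
    [AddCommGroup A] [DistribMulAction S A] :
    A →ₗ[ℤ] Additive (Multiplicative (LimitGroup S A)) :=
  (toLimitHom A (1 : S)).toIntLinearMap

theorem shuffleChain_eq_shuffleProd {q : ℕ} (χ : C_c(LimitCompletion S A, ℤ)) (a : Fin q → A) :
    shuffleChain S A χ a =
      shuffleProd χ q fun i => Multiplicative.ofAdd (toLimit (1 : S) (a i)) :=
  antisymm_eq_shuffleProd χ fun i => Multiplicative.ofAdd (toLimit (1 : S) (a i))

theorem isCycle_shuffleChain {q : ℕ} (a : Fin q → A) :
    IsCycle (translationRep S A) q (shuffleChain S A (latticeIndicator hinj hfin 1) a) := by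
  rw [shuffleChain_eq_shuffleProd]
  refine isCycle_shuffleProd _ fun i => ?_
  exact translationRep_latticeIndicator hinj hfin
    (inv_mem (mem_lattice_one.2 ⟨a i, rfl⟩))

theorem wedgeValue_shuffleChain {q : ℕ} (a : Fin q → A) :
    wedgeValue q (haar hinj hfin) (shuffleChain S A (latticeIndicator hinj hfin 1) a) =
      ratWedge _ q fun i => limitEmbedding S A (a i) := by
  have h1 : ((endo A (1 : S)).range.index : ℚ)⁻¹ = 1 := by
    have h2 : (endo A (1 : S)).range = ⊤ := by
      rw [AddMonoidHom.range_eq_top]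
      exact fun a => ⟨a, one_smul S a⟩
    rw [h2, AddSubgroup.index_top, Nat.cast_one, inv_one]
  rw [shuffleChain_eq_shuffleProd, wedgeValue_shuffleProd, haar_latticeIndicator, h1, one_smul]
  rfl

/-- The homomorphism from the homology of `𝒜` to the rational exterior power induced by the
functional `f ⊗ [g₁|⋯|g_q] ↦ (μ(f) / q!) g₁ ∧ ⋯ ∧ g_q`, where `μ` is the Haar measure. -/
noncomputable def wedgeClass (q : ℕ) : homology S A q →ₗ[ℤ]
    ⋀[ℚ]^q (ℚ ⊗[ℤ] Additive (Multiplicative (LimitGroup S A))) :=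
  (exists_descend _ (wedgeValue_bd (haar_translationRep hinj hfin))).choose

theorem wedgeClass_eq {q : ℕ} {h : homology S A q}
    {c : Chain (Multiplicative (LimitGroup S A)) C_c(LimitCompletion S A, ℤ) q}
    (hc : Represents (translationRep S A) h c) :
    wedgeClass hinj hfin q h = wedgeValue q (haar hinj hfin) c :=
  (exists_descend _ (wedgeValue_bd (haar_translationRep hinj hfin))).choose_spec h c hc

theorem wedgeClass_injective [IsAddTorsionFree A] (q : ℕ) :
    Function.Injective (wedgeClass hinj hfin q) := by
  rw [injective_iff_map_eq_zero]
  intro h h0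
  obtain ⟨s, n, e, -, h2, c, hc, u, hu⟩ := exists_represents_prodSpan hinj hfin h
  rw [wedgeClass_eq hinj hfin hu, map_add, wedgeValue_bd (haar_translationRep hinj hfin),
    add_zero] at h0
  have hμ : haar hinj hfin (latticeIndicator hinj hfin s) ≠ 0 := by
    rw [haar_latticeIndicator]
    exact inv_ne_zero (index_ne_zero hfin s)
  rw [eq_zero_of_wedgeValue_eq_zero hμ h2 hc h0, zero_add] at hu
  exact hu.eq_zero_of_bd

/-- The map `r ⊗ (a₁ ∧ ⋯ ∧ a_q) ↦ r a₁ ∧ ⋯ ∧ a_q` to the rational exterior power; it is injective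
by `ratWedgeMap_injective` and `liftBaseChange_injective`. -/
noncomputable abbrev wedgeInclusion (S A : Type) [Monoid S] [IsCancelMul S] [IsReversible S]
    [AddCommGroup A] [DistribMulAction S A] (q : ℕ) : invRing S A ⊗[ℤ] (⋀[ℤ]^q A) →ₗ[invRing S A]
    ⋀[ℚ]^q (ℚ ⊗[ℤ] Additive (Multiplicative (LimitGroup S A))) :=
  (ratWedgeMap q (limitEmbedding S A)).liftBaseChange (invRing S A)

include hinj in
theorem limitEmbedding_injective : Function.Injective (limitEmbedding S A) :=
  toLimit_injective hinj 1

theorem wedgeClass_mem_range [IsAddTorsionFree A] {q : ℕ} (h : homology S A q) :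
    ∃ t, wedgeInclusion S A q t = wedgeClass hinj hfin q h := by
  obtain ⟨s, n, e, he, -, c, hc, u, hu⟩ := exists_represents_prodSpan hinj hfin h
  rw [wedgeClass_eq hinj hfin hu, map_add, wedgeValue_bd (haar_translationRep hinj hfin),
    add_zero]
  obtain ⟨m, rfl⟩ := (Submodule.mem_span_range_iff_exists_fun ℤ).1 hc
  choose a ha using fun i => mem_lattice.1 (he i)
  refine ⟨∑ f, m f • (invIndex A s ⊗ₜ[ℤ]
    exteriorPower.ιMulti ℤ q fun i => s • a ((f : Fin q ↪o Fin n) i)), ?_⟩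
  rw [map_sum, map_sum]
  refine Finset.sum_congr rfl fun f _ => ?_
  rw [map_zsmul, map_zsmul, LinearMap.liftBaseChange_tmul, ratWedgeMap_ιMulti,
    wedgeValue_shuffleProd, haar_latticeIndicator]
  refine congrArg (fun b => m f • ((endo A s).range.index : ℚ)⁻¹ •
    ratWedge (Additive (Multiplicative (LimitGroup S A))) q b) (funext fun i => ?_)
  exact ha (f i)

theorem wedgeClass_theta {q : ℕ} (s : S) (h : homology S A q) :
    wedgeClass hinj hfin q (theta S A q (OreLocalization.numeratorHom s) h) =
      ((endo A s).range.index : ℚ)⁻¹ • exteriorPower.map q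
        ((groupAuto A (OreLocalization.numeratorHom s)).toAdditive.toIntLinearMap.baseChange ℚ)
        (wedgeClass hinj hfin q h) := by
  obtain ⟨c, hc⟩ := exists_represents h
  rw [wedgeClass_eq hinj hfin hc, ← wedgeValue_chainsMap (groupAuto A _)
    (resHom (translationRep S A) (functionRep S A) (groupAuto A) (functionRep_compat S A) _) _
    (haar_functionRep hinj hfin s)]
  exact wedgeClass_eq hinj hfin (hc.map _ _)

/-- The embedding is equivariant with respect to `s`. -/
theorem map_wedgeInclusion {q : ℕ} (s : S) (t : invRing S A ⊗[ℤ] (⋀[ℤ]^q A)) :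
    exteriorPower.map q
      ((groupAuto A (OreLocalization.numeratorHom s)).toAdditive.toIntLinearMap.baseChange ℚ)
      (wedgeInclusion S A q t) = wedgeInclusion S A q
        ((exteriorPower.map q (endo A s).toIntLinearMap).baseChange (invRing S A) t) := by
  have key : ∀ x : ⋀[ℤ]^q A, exteriorPower.map q
      ((groupAuto A (OreLocalization.numeratorHom s)).toAdditive.toIntLinearMap.baseChange ℚ)
      (ratWedgeMap q (limitEmbedding S A) x) = ratWedgeMap q (limitEmbedding S A)
        (exteriorPower.map q (endo A s).toIntLinearMap x) := by
    intro x
    have hx : x ∈ Submodule.span ℤ (Set.range (exteriorPower.ιMulti ℤ q (M := A))) := by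
      rw [exteriorPower.ιMulti_span]
      trivial
    induction hx using Submodule.span_induction with
    | zero => simp only [map_zero]
    | add x y _ _ hx hy => simp only [map_add, hx, hy]
    | smul m x _ hx => rw [map_zsmul, map_zsmul, hx, map_zsmul, map_zsmul]
    | mem x hx =>
      obtain ⟨a, rfl⟩ := hx
      rw [ratWedgeMap_ιMulti, exteriorPower.map_apply_ιMulti, ratWedgeMap_ιMulti, ratWedge_apply,
        exteriorPower.map_apply_ιMulti]
      refine congrArg (exteriorPower.ιMulti ℚ q) (funext fun i => ?_)
      exact congrArg (fun b => (1 : ℚ) ⊗ₜ[ℤ] b) (numeratorHom_smul_toLimit s (a i))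
  induction t using TensorProduct.induction_on with
  | zero => simp only [map_zero]
  | add t t' h h' => simp only [map_add, h, h']
  | tmul r x =>
    rw [LinearMap.liftBaseChange_tmul, LinearMap.baseChange_tmul, LinearMap.liftBaseChange_tmul,
      ← key]
    exact map_smul _ (r : ℚ) _

/-- A linear map with values in the range of an injective one factors through it. -/
theorem exists_comp_eq {R M N P : Type} [Ring R] [AddCommGroup M] [AddCommGroup N]
    [AddCommGroup P] [Module R M] [Module R N] [Module R P] {f : M →ₗ[R] P}
    (hf : Function.Injective f) (g : N →ₗ[R] P) (h : ∀ x, ∃ y, f y = g x) :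
    ∃ k : N →ₗ[R] M, ∀ x, f (k x) = g x := by
  choose k hk using h
  exact ⟨{ toFun := k
           map_add' := fun x y => hf (by rw [map_add, hk, hk, hk, map_add])
           map_smul' := fun r x => hf (by
            rw [RingHom.id_apply, map_smul, hk, hk, map_smul]) }, hk⟩

end Assembly

end AlgebraicAction

theorem mainTheorem9 (S A : Type) [Monoid S] [IsCancelMul S] [AlgebraicAction.IsReversible S]
    [AddCommGroup A] [IsAddTorsionFree A] (d : ℕ) (hrank : Module.rank ℤ A = d)
    [DistribMulAction S A] [FaithfulSMul S A]
    (hinj : ∀ s : S, Function.Injective fun a : A => s • a)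
    (hexact : sInf (AlgebraicAction.constructible S A) = ⊥) (q : ℕ) :
    ∃ (χ : C_c(AlgebraicAction.LimitCompletion S A, ℤ))
      (j : (⋀[ℤ]^q A) →ₗ[ℤ] AlgebraicAction.homology S A q)
      (k : AlgebraicAction.homology S A q →ₗ[ℤ] AlgebraicAction.invRing S A ⊗[ℤ] (⋀[ℤ]^q A))
      (Φ : (AlgebraicAction.invRing S A ⊗[ℤ] AlgebraicAction.homology S A q)
        ≃ₗ[AlgebraicAction.invRing S A] (AlgebraicAction.invRing S A ⊗[ℤ] (⋀[ℤ]^q A))),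
      (⇑χ = (Set.range (AlgebraicAction.toLimit (X := AlgebraicAction.completion S A)
        (1 : S))).indicator 1) ∧
      (∀ a : Fin q → A, AlgebraicAction.IsClassOf S A (j (exteriorPower.ιMulti ℤ q a))
        (AlgebraicAction.shuffleChain S A χ a)) ∧
      Function.Injective j ∧
      Function.Injective k ∧
      (∀ x, k (j x) = 1 ⊗ₜ[ℤ] x) ∧
      (∀ h, Φ (1 ⊗ₜ[ℤ] h) = k h) ∧
      ∀ (s : S) (y : AlgebraicAction.invRing S A ⊗[ℤ] AlgebraicAction.homology S A q),
        Φ ((AlgebraicAction.theta S A q (OreLocalization.numeratorHom s)).baseChange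
            (AlgebraicAction.invRing S A) y) =
          AlgebraicAction.invIndex A s •
            (exteriorPower.map q (AlgebraicAction.endo A s).toIntLinearMap).baseChange
              (AlgebraicAction.invRing S A) (Φ y) := by
  have hfin : ∀ C : AlgebraicAction.constructible S A, Finite (A ⧸ (C : AddSubgroup A)) :=
    fun C => AlgebraicAction.finite_quotient_constructible d hrank hinj C.2
  set R := AlgebraicAction.invRing S A with hR
  set κ := AlgebraicAction.wedgeClass hinj hfin q with hκ
  set ι := AlgebraicAction.ratWedgeMap q (AlgebraicAction.limitEmbedding S A) with hι
  have hκinj : Function.Injective κ := AlgebraicAction.wedgeClass_injective hinj hfin q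
  have hιinj : Function.Injective ι := AlgebraicAction.ratWedgeMap_injective q
    (AlgebraicAction.limitEmbedding_injective hinj)
  have hLinj : Function.Injective (ι.liftBaseChange R) :=
    AlgebraicAction.liftBaseChange_injective hιinj
  -- the class of the antisymmetrised chain of `a` is mapped to `a₁ ∧ ⋯ ∧ a_q`
  have hclass : ∀ a : Fin q → A, ∃ h, AlgebraicAction.IsClassOf S A h
      (AlgebraicAction.shuffleChain S A (AlgebraicAction.latticeIndicator hinj hfin 1) a) ∧
      κ h = ι (exteriorPower.ιMulti ℤ q a) := by
    intro a
    obtain ⟨h, hh⟩ := (AlgebraicAction.isCycle_shuffleChain hinj hfin a).exists_represents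
    exact ⟨h, hh, (AlgebraicAction.wedgeClass_eq hinj hfin hh).trans
      ((AlgebraicAction.wedgeValue_shuffleChain hinj hfin a).trans
        (AlgebraicAction.ratWedgeMap_ιMulti _ a).symm)⟩
  obtain ⟨j, hj⟩ := AlgebraicAction.exists_comp_eq hκinj ι fun x => by
    have hx : x ∈ Submodule.span ℤ (Set.range (exteriorPower.ιMulti ℤ q (M := A))) := by
      rw [exteriorPower.ιMulti_span]
      trivial
    refine Submodule.span_induction (p := fun x _ => ∃ y, κ y = ι x) ?_ ?_ ?_ ?_ hx
    · rintro _ ⟨a, rfl⟩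
      obtain ⟨h, -, hh⟩ := hclass a
      exact ⟨h, hh⟩
    · exact ⟨0, by rw [map_zero, map_zero]⟩
    · rintro x y _ _ ⟨x', hx⟩ ⟨y', hy⟩
      exact ⟨x' + y', by rw [map_add, map_add, hx, hy]⟩
    · rintro m x _ ⟨x', hx⟩
      exact ⟨m • x', by rw [map_zsmul, map_zsmul, hx]⟩
  obtain ⟨k, hk⟩ := AlgebraicAction.exists_comp_eq
    (f := (ι.liftBaseChange R).restrictScalars ℤ) hLinj κ
    (AlgebraicAction.wedgeClass_mem_range hinj hfin)
  have hk : ∀ h, ι.liftBaseChange R (k h) = κ h := hk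
  have hkinj : Function.Injective k := fun x y hxy => hκinj (by rw [← hk, ← hk, hxy])
  have hkj : ∀ x, k (j x) = 1 ⊗ₜ[ℤ] x := fun x => hLinj (by
    rw [hk, hj, LinearMap.liftBaseChange_tmul, one_smul])
  have hΦ : Function.Bijective (k.liftBaseChange R) := by
    refine ⟨AlgebraicAction.liftBaseChange_injective hkinj, fun t => ?_⟩
    induction t using TensorProduct.induction_on with
    | zero => exact ⟨0, map_zero _⟩
    | add t t' h h' =>
      obtain ⟨y, rfl⟩ := h
      obtain ⟨y', rfl⟩ := h'
      exact ⟨y + y', map_add _ _ _⟩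
    | tmul r x =>
      refine ⟨r ⊗ₜ[ℤ] j x, ?_⟩
      rw [LinearMap.liftBaseChange_tmul, hkj, TensorProduct.smul_tmul', smul_eq_mul, mul_one]
  refine ⟨AlgebraicAction.latticeIndicator hinj hfin 1, j, k,
    LinearEquiv.ofBijective (k.liftBaseChange R) hΦ, ?_, fun a => ?_, fun x y hxy => hιinj ?_,
    hkinj, hkj, fun h => ?_, fun s y => ?_⟩
  · have h1 : (Set.range (AlgebraicAction.toLimit (X := AlgebraicAction.completion S A) (1 : S))) =
        AlgebraicAction.lattice (AlgebraicAction.completion S A) (1 : S) :=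
      Set.ext fun x => AlgebraicAction.mem_lattice_one.symm
    rw [h1]
    rfl
  · obtain ⟨h, h1, h2⟩ := hclass a
    rwa [show j (exteriorPower.ιMulti ℤ q a) = h from hκinj ((hj _).trans h2.symm)]
  · rw [← hj, ← hj, hxy]
  · rw [LinearEquiv.ofBijective_apply, LinearMap.liftBaseChange_tmul, one_smul]
  · -- both sides are determined by their images in the rational exterior power
    have key : ∀ h, k (AlgebraicAction.theta S A q (OreLocalization.numeratorHom s) h) =
        AlgebraicAction.invIndex A s •
          (exteriorPower.map q (AlgebraicAction.endo A s).toIntLinearMap).baseChange R (k h) := by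
      intro h
      refine hLinj ?_
      rw [hk, map_smul, ← AlgebraicAction.map_wedgeInclusion, hk]
      exact AlgebraicAction.wedgeClass_theta hinj hfin s h
    induction y using TensorProduct.induction_on with
    | zero => simp only [map_zero, smul_zero]
    | add y y' h h' => simp only [map_add, smul_add, h, h']
    | tmul r h =>
      simp only [LinearEquiv.ofBijective_apply, LinearMap.baseChange_tmul,
        LinearMap.liftBaseChange_tmul, map_smul, key]
      rw [smul_comm]
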